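/- **Model.** Fix $\lambda>0$, $\eta>2$, $P_d,P_u^{(M)},\rho,N_o>0$, $\beta_d,\beta_u\ge 0$, $\epsilon\ge 0$, $\alpha\in[0,1]$, half-duplex bandwidths $B_d^{HD},B_u^{HD}>0$, pulse types $b_d,b_u\in\{\mathrm R,\mathrm T\}$, and a probability law $\mu_s$ on $[0,\infty)$ with mean $1$. Put $B=\min(B_d^{HD},B_u^{HD})$ and, for $v\in\{d,u\}$ (with $\bar v$ the other direction), $B_v=B_v^{HD}+\alpha(\epsilon+1)B$, $\Delta f=\tfrac12\big(B_d^{HD}+B_u^{HD}+2\epsilon B-2\alpha B(\epsilon+1)\big)$. Let $\operatorname{sinc}x=\sin(\pi x)/(\pi x)$; for $k=1$ if $b=\mathrm R$ and $k=2$ if $b=\mathrm T$ let $S(f,W,b)=\operatorname{sinc}^k(2f/W)\big/\big(\int_{\mathbb R}\operatorname{sinc}^{2k}(2x/W)\,dx\big)^{1/2}$. Let $$\mathcal I_v=\int_{-B_v/2}^{B_v/2}S(f,B_v,b_v)^2df,\qquad \mathcal C_v=\int_{-B_v/2}^{B_v/2}S(f,B_v,b_v)\,S(f-\Delta f,B_{\bar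 v},b_{\bar v})\,df .$$ Base stations (BSs) $x_j$ and users of other cells $y_j$ transmitting on the test channel form independent homogeneous Poisson point processes of intensity $\lambda$ in $\mathbb R^2$. Every user is served by its nearest BS at some distance $r$, transmits with power $\rho r^{\eta}$ (truncated channel inversion), and is active only if $\rho r^\eta\le P_u^{(M)}$, i.e. $r\le R_M=(P_u^{(M)}/\rho)^{1/\eta}$. In the downlink (DL) the test receiver is a user at the origin, $r_o=\min_j|x_j|$, all BSs but the nearest one interfere, and expectations are conditioned on $r_o\le R_M$. In the uplink (UL) the test receiver is a BS at the origin, the $x_j$ are the other BSs and all of them interfere. The link distance $d_j$ of the user at $y_j$ and the link distance of the user served by the test BS have the law of $\min_j|x_j|$ conditioned to be at most $R_M$. In both directions the user at $y_j$ interferes only if $d_j<|y_j|$ (its mean received power at the test receiver is below $\rho$). All channel power gains are exponential with mean $1$; all these variables, and the normalized self-interference gain $h_s\sim\mu_s$, are mutually independent. The SINR is $$\mathrm{SINR}_d=\frac{P_dr_o^{-\eta}h_o|\mathcal I_d|^2}{\sum_{j:|x_j|>r_o}P_dh_j|x_j|^{-\eta}|\mathcal I_d|^2+\sum_{j:d_j<|y_j|}\rho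 d_j^{\eta}h'_j|y_j|^{-\eta}|\mathcal C_d|^2+Z+N_o|\mathcal I_d|^2},$$ $$\mathrm{SINR}_u=\frac{\rho h_o|\mathcal I_u|^2}{\sum_{j:d_j<|y_j|}\rho d_j^{\eta}h'_j|y_j|^{-\eta}|\mathcal I_u|^2+\sum_{j}P_dh_j|x_j|^{-\eta}|\mathcal C_u|^2+\beta_uh_sP_d|\mathcal C_u|^2+N_o|\mathcal I_u|^2},$$ where $Z=\beta_dh_s\rho r_o^\eta|\mathcal C_d|^2$ in the 2-node topology (2NT), and, in the 3-node topology (3NT), $Z=\rho d^\eta h\,(r_o^2+d^2-2r_od\cos\theta)^{-\eta/2}|\mathcal C_d|^2$ is the interference from the UL user of the same cell, whose link distance $d$ has the same law as the $d_j$, $\theta$ is uniform on $[0,\pi]$, $h$ is exponential with mean $1$, and these are independent of each other and of everything else. The ergodic rate is $\mathcal R_v=\mathbb E[B_v\log_2(1+\mathrm{SINR}_v)]$. **Theorem.** In both topologies the two ergodic rates are finite, the integrals below converge, and $$\mathcal R_d=\int_0^\infty\!\int_0^{R_M}\frac{f_R(r_o)B_d}{(g+1)\ln 2}\exp\!\Big(-\frac{N_og}{P_dr_o^{-\eta}}\Big)\mathcal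 L_{I_d}\!\Big(\frac{g}{P_dr_o^{-\eta}|\mathcal I_d|^2}\Big)dr_o\,dg,$$ $$\mathcal R_u=\int_0^\infty\frac{B_u}{(g+1)\ln 2}\exp\!\Big(-\frac{N_og}{\rho}\Big)\mathcal L_{I_u}\!\Big(\frac{g}{\rho|\mathcal I_u|^2}\Big)dg,$$ where, with $F(z)={}_2F_1(1,1-\tfrac2\eta;2-\tfrac2\eta;z)$ and $\gamma$ the lower incomplete gamma function, $$f_R(r)=\frac{2\pi\lambda r e^{-\pi\lambda r^2}}{1-e^{-\pi\lambda R_M^2}},\qquad m=\frac{\rho^{2/\eta}\gamma(2,\pi\lambda R_M^2)}{\pi\lambda(1-e^{-\pi\lambda R_M^2})}\ \ (=\mathbb E[P_u^{2/\eta}]),$$ $$\mathcal L_{I_d}(s)=\exp\!\Big(\tfrac{-2\pi\lambda}{\eta-2}r_o^{2-\eta}|\mathcal I_d|^2sP_dF(-r_o^{-\eta}P_d|\mathcal I_d|^2s)\Big)\exp\!\Big(\tfrac{-2\pi\lambda\rho^{1-2/\eta}}{\eta-2}m|\mathcal C_d|^2sF(-\rho|\mathcal C_d|^2s)\Big)U_1(r_o,s)U_2(r_o,s),$$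 $$\mathcal L_{I_u}(s)=\exp\!\Big(\tfrac{-2\pi\lambda\rho^{1-2/\eta}}{\eta-2}m|\mathcal I_u|^2sF(-\rho|\mathcal I_u|^2s)\Big)\exp\!\Big(-\tfrac{2\pi^2\lambda}{\eta}(s|\mathcal C_u|^2P_d)^{2/\eta}\csc\tfrac{2\pi}{\eta}\Big)U_3(s),$$ $$U_1(r_o,s)=\int_0^{R_M}\!\!\int_0^\pi\frac{f_R(r)\,d\theta\,dr}{\pi+\pi s|\mathcal C_d|^2\rho\big(1+(\frac{r_o}{r})^2-2\frac{r_o}{r}\cos\theta\big)^{-\eta/2}}\ \text{ in 3NT},\quad U_1=1\ \text{ in 2NT},$$ $$U_2(r_o,s)=\int e^{-\beta_dsh\rho r_o^\eta|\mathcal C_d|^2}\mu_s(dh)\ \text{ in 2NT},\quad U_2=1\ \text{ in 3NT},\qquad U_3(s)=\int e^{-\beta_ushP_d|\mathcal C_u|^2}\mu_s(dh).$$ -/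

import Mathlib

open MeasureTheory ProbabilityTheory

noncomputable section

namespace AlphaDuplex

/-! ## Poisson point processes in the plane -/

/-- The plane with its Euclidean norm and Lebesgue measure. -/
abbrev Plane : Type := EuclideanSpace ℝ (Fin 2)

/-- The number (possibly infinite, with multiplicity) of points of the enumerated point process
`X 0, X 1, …` that lie in `A`. -/
def pointCount {Ω E : Type*} (X : ℕ → Ω → E) (A : Set E) (ω : Ω) : ℕ∞ :=
  {j : ℕ | X j ω ∈ A}.encard

/-- The enumerated random points `X 0, X 1, …` form a Poisson point process with intensity measure
`m`: the number of points in a measurable set `A` of finite `m`-measure is Poisson distributed with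
mean `m A`, and the numbers of points in disjoint measurable sets are independent. -/
structure IsPoissonProcess {Ω E : Type*} [MeasurableSpace Ω] [MeasurableSpace E]
    (X : ℕ → Ω → E) (m : Measure E) (P : Measure Ω) : Prop where
  measurable : ∀ j, Measurable (X j)
  count_law : ∀ A : Set E, MeasurableSet A → m A < ⊤ → ∀ n : ℕ,
    P {ω | pointCount X A ω = (n : ℕ∞)} = poissonMeasure (m A).toNNReal {n}
  count_indep : ∀ (k : ℕ) (A : Fin k → Set E), (∀ i, MeasurableSet (A i)) →
    Pairwise (fun i j => Disjoint (A i) (A j)) →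
    iIndepFun (fun i => pointCount X (A i)) P

/-! ## System parameters -/

/-- The two pulse shapes: rectangular and triangular (in the time domain). -/
inductive Pulse | rectangular | triangular

/-- Transmission direction: downlink or uplink. -/
inductive Direction | dl | ul

/-- The opposite direction. -/
def Direction.other : Direction → Direction
  | .dl => .ul
  | .ul => .dl

/-- 2-node topology (full-duplex users) or 3-node topology (half-duplex users). -/
inductive NodeTopology | twoNode | threeNode

/-- The deterministic parameters of the network. -/
structure Params where
  /-- intensity of the base stations -/
  lam : ℝ
  /-- path-loss exponent -/
  η : ℝ
  /-- transmit power of the base stations -/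
  Pd : ℝ
  /-- maximum transmit power of the users -/
  PuMax : ℝ
  /-- target average received power of the uplink power control -/
  ρ : ℝ
  /-- noise level -/
  N0 : ℝ
  /-- mean self-interference attenuation, in each direction -/
  β : Direction → ℝ
  /-- law of the normalized self-interference attenuation `h_s` -/
  siLaw : Measure ℝ
  /-- half-duplex bandwidths -/
  bwHD : Direction → ℝ
  /-- relative size of the guard band -/
  ε : ℝ
  /-- duplexing parameter (0: half duplex, 1: full duplex) -/
  α : ℝ
  /-- pulse shape used in each direction -/
  pulse : Direction → Pulse
  lam_pos : 0 < lam
  two_lt_η : 2 < η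
  Pd_pos : 0 < Pd
  PuMax_pos : 0 < PuMax
  ρ_pos : 0 < ρ
  N0_pos : 0 < N0
  β_nonneg : ∀ v, 0 ≤ β v
  siLaw_prob : IsProbabilityMeasure siLaw
  siLaw_nonneg : ∀ᵐ h ∂siLaw, 0 ≤ h
  siLaw_integrable : Integrable (fun h : ℝ => h) siLaw
  siLaw_mean : ∫ h, h ∂siLaw = 1
  bwHD_pos : ∀ v, 0 < bwHD v
  ε_nonneg : 0 ≤ ε
  α_nonneg : 0 ≤ α
  α_le_one : α ≤ 1

/-! ## Pulse shapes and effective received energy factors -/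

/-- The normalized sinc function `sin (π x) / (π x)`. -/
def nsinc (x : ℝ) : ℝ := Real.sinc (Real.pi * x)

/-- Fourier transform of the unit-energy pulse with null-to-null bandwidth `BW`. -/
def pulseFT (f BW : ℝ) : Pulse → ℝ
  | .rectangular => nsinc (2 * f / BW) / Real.sqrt (∫ x : ℝ, nsinc (2 * x / BW) ^ 2)
  | .triangular => nsinc (2 * f / BW) ^ 2 / Real.sqrt (∫ x : ℝ, nsinc (2 * x / BW) ^ 4)

namespace Params

variable (p : Params)

/-- The smaller of the two half-duplex bandwidths. -/
def bwMin : ℝ := min (p.bwHD .dl) (p.bwHD .ul)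

/-- Bandwidth in direction `v` under partial overlap `α`. -/
def bw (v : Direction) : ℝ := p.bwHD v + p.α * (p.ε + 1) * p.bwMin

/-- Difference between the downlink and uplink center frequencies. -/
def deltaF : ℝ :=
  (p.bwHD .dl + p.bwHD .ul + 2 * p.ε * p.bwMin - 2 * p.α * p.bwMin * (p.ε + 1)) / 2

/-- Intra-mode factor `𝓘_v(α)`. The pulse spectra are real, hence equal to their conjugates. -/
def intra (v : Direction) : ℝ :=
  ∫ f in (-(p.bw v / 2))..(p.bw v / 2),
    pulseFT f (p.bw v) (p.pulse v) * pulseFT f (p.bw v) (p.pulse v)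

/-- Cross-mode factor `𝓒_v(α)`. -/
def cross (v : Direction) : ℝ :=
  ∫ f in (-(p.bw v / 2))..(p.bw v / 2),
    pulseFT f (p.bw v) (p.pulse v) *
      pulseFT (f - p.deltaF) (p.bw v.other) (p.pulse v.other)

/-- Effective noise power after filtering. -/
def noise (v : Direction) : ℝ := p.N0 * |p.intra v| ^ 2

/-- Largest distance at which a user can invert its path loss. -/
def RM : ℝ := (p.PuMax / p.ρ) ^ (1 / p.η)

end Params

/-! ## The random network -/

/-- The sources of randomness. -/
inductive Source
  | bsPos | uePos
  | bsGain (j : ℕ) | ueGain (j : ℕ) | ueDist (j : ℕ)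
  | desiredGain | siGain | ulDist
  | mateDist | mateAngle | mateGain

/-- Random variables of the network as seen from the test receiver at the origin. -/
structure Network (Ω : Type*) where
  /-- positions of the base stations (in the uplink: other than the test one) -/
  bsPos : ℕ → Ω → Plane
  /-- positions of the users of other cells that transmit on the test channel -/
  uePos : ℕ → Ω → Plane
  /-- power gain of the channel from the `j`-th base station -/
  bsGain : ℕ → Ω → ℝ
  /-- power gain of the channel from the `j`-th interfering user -/
  ueGain : ℕ → Ω → ℝ
  /-- distance of the `j`-th interfering user to its own serving base station -/
  ueDist : ℕ → Ω → ℝ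
  /-- power gain `h_o` of the intended channel -/
  desiredGain : Ω → ℝ
  /-- normalized self-interference attenuation `h_s` -/
  siGain : Ω → ℝ
  /-- distance between the test base station and the uplink user it serves -/
  ulDist : Ω → ℝ
  /-- 3-node topology: distance from the uplink user of the test user's cell to the common
  serving base station -/
  mateDist : Ω → ℝ
  /-- 3-node topology: angle at the serving base station between that user and the test user -/
  mateAngle : Ω → ℝ
  /-- 3-node topology: power gain of the channel between these two users -/
  mateGain : Ω → ℝ

namespace Network

variable {Ω : Type*} (N : Network Ω)

/-- The σ-algebra generated by a source of randomness. -/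
@[reducible]
def sigma : Source → MeasurableSpace Ω
  | .bsPos => MeasurableSpace.comap (fun ω j => N.bsPos j ω) inferInstance
  | .uePos => MeasurableSpace.comap (fun ω j => N.uePos j ω) inferInstance
  | .bsGain j => MeasurableSpace.comap (N.bsGain j) inferInstance
  | .ueGain j => MeasurableSpace.comap (N.ueGain j) inferInstance
  | .ueDist j => MeasurableSpace.comap (N.ueDist j) inferInstance
  | .desiredGain => MeasurableSpace.comap N.desiredGain inferInstance
  | .siGain => MeasurableSpace.comap N.siGain inferInstance
  | .ulDist => MeasurableSpace.comap N.ulDist inferInstance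
  | .mateDist => MeasurableSpace.comap N.mateDist inferInstance
  | .mateAngle => MeasurableSpace.comap N.mateAngle inferInstance
  | .mateGain => MeasurableSpace.comap N.mateGain inferInstance

/-- Distance `r_o` from the test user at the origin to its serving (nearest) base station. -/
def servingDist (ω : Ω) : ℝ := ⨅ j, ‖N.bsPos j ω‖

/-- The event that a user at the origin is not in truncation outage: the power needed to invert
the path loss to its nearest base station does not exceed the maximum. -/
def active (p : Params) : Set Ω := {ω | p.ρ * N.servingDist ω ^ p.η ≤ p.PuMax}

/-- Law of the distance of a user to its serving base station, given that the user is not in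
truncation outage. -/
def linkDistLaw [MeasurableSpace Ω] (p : Params) (P : Measure Ω) : Measure ℝ :=
  (cond P (N.active p)).map N.servingDist

/-- The modelling assumptions: base stations and interfering users form independent homogeneous
Poisson point processes of intensity `lam`; channel power gains are exponential with mean one; link
distances of transmitting users have the law of the distance to the nearest base station given no
truncation; all sources of randomness are independent. -/
structure IsModel [MeasurableSpace Ω] (p : Params) (P : Measure Ω) : Prop where
  bs_poisson : IsPoissonProcess N.bsPos (ENNReal.ofReal p.lam • (volume : Measure Plane)) P
  ue_poisson : IsPoissonProcess N.uePos (ENNReal.ofReal p.lam • (volume : Measure Plane)) P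
  measurable_bsGain : ∀ j, Measurable (N.bsGain j)
  measurable_ueGain : ∀ j, Measurable (N.ueGain j)
  measurable_ueDist : ∀ j, Measurable (N.ueDist j)
  measurable_desiredGain : Measurable N.desiredGain
  measurable_siGain : Measurable N.siGain
  measurable_ulDist : Measurable N.ulDist
  measurable_mateDist : Measurable N.mateDist
  measurable_mateAngle : Measurable N.mateAngle
  measurable_mateGain : Measurable N.mateGain
  law_bsGain : ∀ j, P.map (N.bsGain j) = expMeasure 1
  law_ueGain : ∀ j, P.map (N.ueGain j) = expMeasure 1
  law_desiredGain : P.map N.desiredGain = expMeasure 1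
  law_mateGain : P.map N.mateGain = expMeasure 1
  law_siGain : P.map N.siGain = p.siLaw
  law_ueDist : ∀ j, P.map (N.ueDist j) = N.linkDistLaw p P
  law_ulDist : P.map N.ulDist = N.linkDistLaw p P
  law_mateDist : P.map N.mateDist = N.linkDistLaw p P
  law_mateAngle : P.map N.mateAngle = cond volume (Set.Icc 0 Real.pi)
  indep : iIndep N.sigma P

/-- Truncated channel inversion: transmit power of a user whose serving base station is at
distance `d`. -/
def uePower (p : Params) (d : ℝ) : ℝ := p.ρ * d ^ p.η

/-- Aggregate power at the origin from the base stations with index in `J`, before filtering. -/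
def bsSum (p : Params) (J : Set ℕ) (ω : Ω) : ENNReal :=
  ∑' j : J, ENNReal.ofReal (p.Pd * N.bsGain j ω * ‖N.bsPos j ω‖ ^ (-p.η))

/-- Aggregate power at the origin from the users of other cells, before filtering. Such a user is
closer to its own serving base station than to the test receiver, that is, its mean received power
at the test receiver is below `ρ`. -/
def ueSum (p : Params) (ω : Ω) : ENNReal :=
  ∑' j : {j : ℕ | N.ueDist j ω < ‖N.uePos j ω‖},
    ENNReal.ofReal (uePower p (N.ueDist j ω) * N.ueGain j ω * ‖N.uePos j ω‖ ^ (-p.η))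

/-- 3-node topology: distance between the test user and the uplink user of its cell
(law of cosines). -/
def mateSeparation (ω : Ω) : ℝ :=
  Real.sqrt (N.servingDist ω ^ 2 + N.mateDist ω ^ 2
    - 2 * N.servingDist ω * N.mateDist ω * Real.cos (N.mateAngle ω))

/-- Downlink: residual self-interference (2-node topology) or interference from the uplink user of
the same cell (3-node topology). -/
def dlOwnCell (p : Params) (ω : Ω) : NodeTopology → ℝ
  | .twoNode =>
      p.β .dl * N.siGain ω * uePower p (N.servingDist ω) * |p.cross .dl| ^ 2
  | .threeNode =>
      uePower p (N.mateDist ω) * N.mateGain ω * N.mateSeparation ω ^ (-p.η) * |p.cross .dl| ^ 2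

/-- Aggregate interference at the test receiver after filtering, in each direction. In the downlink
all base stations but the serving (nearest) one interfere; in the uplink all base stations other
than the test one. -/
def interference (p : Params) (τ : NodeTopology) (ω : Ω) : Direction → ENNReal
  | .dl =>
      ENNReal.ofReal (|p.intra .dl| ^ 2) *
          N.bsSum p {j | N.servingDist ω < ‖N.bsPos j ω‖} ω
        + ENNReal.ofReal (|p.cross .dl| ^ 2) * N.ueSum p ω
        + ENNReal.ofReal (N.dlOwnCell p ω τ)
  | .ul =>
      ENNReal.ofReal (|p.intra .ul| ^ 2) * N.ueSum p ω
        + ENNReal.ofReal (|p.cross .ul| ^ 2) * N.bsSum p Set.univ ω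
        + ENNReal.ofReal (p.β .ul * N.siGain ω * p.Pd * |p.cross .ul| ^ 2)

/-- Received power of the intended signal after filtering. -/
def signal (p : Params) (ω : Ω) : Direction → ℝ
  | .dl => p.Pd * N.servingDist ω ^ (-p.η) * N.desiredGain ω * |p.intra .dl| ^ 2
  | .ul =>
      uePower p (N.ulDist ω) * N.ulDist ω ^ (-p.η) * N.desiredGain ω * |p.intra .ul| ^ 2

/-- Signal-to-interference-plus-noise ratio (zero if the interference is infinite). -/
def SINR (p : Params) (τ : NodeTopology) (v : Direction) (ω : Ω) : ℝ :=
  (ENNReal.ofReal (N.signal p ω v) /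
    (N.interference p τ ω v + ENNReal.ofReal (p.noise v))).toReal

/-- Instantaneous rate. -/
def rate (p : Params) (τ : NodeTopology) (v : Direction) (ω : Ω) : ℝ :=
  p.bw v * Real.logb 2 (1 + N.SINR p τ v ω)

/-- The probability measure for each direction: the served test user is not in truncation outage.
In the uplink this is already part of the law of `ulDist`. -/
def testMeasure [MeasurableSpace Ω] (p : Params) (P : Measure Ω) : Direction → Measure Ω
  | .dl => cond P (N.active p)
  | .ul => P

/-- The ergodic rate in direction `v`. -/
def ergodicRate [MeasurableSpace Ω] (p : Params) (P : Measure Ω) (τ : NodeTopology)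
    (v : Direction) : ℝ :=
  ∫ ω, N.rate p τ v ω ∂(N.testMeasure p P v)

end Network

/-! ## The closed-form expressions -/

/-- Gauss hypergeometric function `₂F₁(a, b; c; z)` for `0 < b < c` and `z < 1`, by Euler's
integral (the analytic continuation of the hypergeometric series). -/
def hyp2F1 (a b c z : ℝ) : ℝ :=
  Real.Gamma c / (Real.Gamma b * Real.Gamma (c - b)) *
    ∫ t in (0 : ℝ)..1, t ^ (b - 1) * (1 - t) ^ (c - b - 1) * (1 - z * t) ^ (-a)

/-- Lower incomplete gamma function. -/
def lowerGamma (a x : ℝ) : ℝ := ∫ t in (0 : ℝ)..x, t ^ (a - 1) * Real.exp (-t)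

namespace Params

variable (p : Params)

/-- The function `₂F₁(1, 1 - 2/η; 2 - 2/η; z)`. -/
def F (z : ℝ) : ℝ := hyp2F1 1 (1 - 2 / p.η) (2 - 2 / p.η) z

/-- Density of the serving distance on `[0, R_M]`. -/
def fR (r : ℝ) : ℝ :=
  2 * Real.pi * p.lam * r * Real.exp (-(Real.pi * p.lam * r ^ 2)) /
    (1 - Real.exp (-(Real.pi * p.lam * p.RM ^ 2)))

/-- The moment `𝔼[P_u^{2/η}]`. -/
def powerMoment : ℝ :=
  p.ρ ^ (2 / p.η) * lowerGamma 2 (Real.pi * p.lam * p.RM ^ 2) /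
    (Real.pi * p.lam * (1 - Real.exp (-(Real.pi * p.lam * p.RM ^ 2))))

/-- The factor `U₁(r_o, s)`. -/
def U1 (r s : ℝ) : NodeTopology → ℝ
  | .twoNode => 1
  | .threeNode =>
      ∫ x in (0 : ℝ)..p.RM, ∫ θ in (0 : ℝ)..Real.pi,
        p.fR x / (Real.pi + Real.pi * s * |p.cross .dl| ^ 2 * p.ρ *
          (1 + (r / x) ^ 2 - 2 * (r / x) * Real.cos θ) ^ (-p.η / 2))

/-- The factor `U₂(r_o, s)`. -/
def U2 (r s : ℝ) : NodeTopology → ℝ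
  | .twoNode => ∫ h, Real.exp (-(p.β .dl * s * h * p.ρ * r ^ p.η * |p.cross .dl| ^ 2)) ∂p.siLaw
  | .threeNode => 1

/-- The factor `U₃(s)`. -/
def U3 (s : ℝ) : ℝ :=
  ∫ h, Real.exp (-(p.β .ul * s * h * p.Pd * |p.cross .ul| ^ 2)) ∂p.siLaw

/-- The expression for the Laplace transform of the downlink interference given `r_o = r`. -/
def LId (τ : NodeTopology) (r s : ℝ) : ℝ :=
  Real.exp (-(2 * Real.pi * p.lam) / (p.η - 2) * r ^ (2 - p.η) * |p.intra .dl| ^ 2 * s * p.Pd *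
      p.F (-(r ^ (-p.η) * p.Pd * |p.intra .dl| ^ 2 * s))) *
    Real.exp (-(2 * Real.pi * p.lam * p.ρ ^ (1 - 2 / p.η)) / (p.η - 2) * p.powerMoment *
      |p.cross .dl| ^ 2 * s * p.F (-(p.ρ * |p.cross .dl| ^ 2 * s))) *
    p.U1 r s τ * p.U2 r s τ

/-- The expression for the Laplace transform of the uplink interference. -/
def LIu (s : ℝ) : ℝ :=
  Real.exp (-(2 * Real.pi * p.lam * p.ρ ^ (1 - 2 / p.η)) / (p.η - 2) * p.powerMoment *
      |p.intra .ul| ^ 2 * s * p.F (-(p.ρ * |p.intra .ul| ^ 2 * s))) *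
    Real.exp (-(2 * Real.pi ^ 2 * p.lam / p.η) *
      (s * |p.cross .ul| ^ 2 * p.Pd) ^ (2 / p.η) * (Real.sin (2 * Real.pi / p.η))⁻¹) *
    p.U3 s

/-- Integrand of the downlink rate formula. -/
def dlIntegrand (τ : NodeTopology) (g r : ℝ) : ℝ :=
  p.fR r * p.bw .dl / ((g + 1) * Real.log 2) * Real.exp (-(p.N0 * g / (p.Pd * r ^ (-p.η)))) *
    p.LId τ r (g / (p.Pd * r ^ (-p.η) * |p.intra .dl| ^ 2))

/-- Integrand of the uplink rate formula. -/
def ulIntegrand (g : ℝ) : ℝ :=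
  p.bw .ul / ((g + 1) * Real.log 2) * Real.exp (-(p.N0 * g / p.ρ)) *
    p.LIu (g / (p.ρ * |p.intra .ul| ^ 2))

end Params

end AlphaDuplex

end

/-! Rates reduce to coverage probabilities by the layer-cake formula `lintegral_logb_one_add`: the
expectation of B log₂(1 + X) is the integral of P(X > g) against the derivative B / ((g + 1) ln 2).
The intended gain is exponential and independent of everything else, and its tail is P(h > x) =
exp(-x). Hence P(SINR > g) is the Laplace transform of interference plus noise, taken at g divided
by the mean signal power (`measure_lt_sinr`). The exponential turns the sum of noise, base stations,
users of other cells and own cell into a product, which independence lets one integrate factor by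
factor (in the downlink, at a given serving distance).

The two Poisson factors come from the Laplace functional E exp(-∑ φ(X_j)) = exp(-∫ (1 - exp(-φ))
dm), proved from independent Poisson counts by simple-function approximation. Independent marks are
integrated out one at a time, which replaces exp(-φ) by its mean over the mark
(`IsPoissonProcess.lintegral_negExp_tsum_mark`). An exponential gain turns the integrand into u / (1
+ u) with u proportional to |x|^(-η). Polar coordinates and the substitution x = b t^(-1/η) then
give a hypergeometric function outside a disc and a cosecant on the whole plane. A user of another
cell is excluded from a disc whose radius is its own link distance d. Channel inversion makes its
mean power at the edge of that disc equal to ρ, so the integral is a multiple of d², and the mean of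
d² produces the moment m.

The delicate point is the downlink, where the serving distance and the interfering base stations
come from one process. Instead of conditioning on a null event, the serving distance is confined to
a dyadic interval [a, b) and only the stations beyond b are kept. The event of an empty disc of
radius a or b factorises from the field beyond b, and subtracting the two identities gives the
interval. Refining the dyadic grid yields `IsModel.lintegral_negExp_bsSum_serving`, an identity
tested against every measurable function of the serving distance.

Everything takes place in [0, ∞] with exp(-∞) = 0, so almost sure finiteness of the interference is
never needed. Finiteness of the rates is settled last: the Laplace transforms are at most 1 and the
noise factor gives decay in g. In the downlink this decay degenerates as r → 0, at a cost of only
1/r, which the factor r of `fR` absorbs. -/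

noncomputable section

namespace AlphaDuplex

open Set Filter
open scoped ENNReal Topology

/-! ## The function `x ↦ exp (-x)` on `[0, ∞]` -/

/-- The function `exp (-x)` on `[0, ∞]`, with value `0` at `∞`. -/
def negExp (x : ℝ≥0∞) : ℝ≥0∞ := EReal.exp (-(x : EReal))

@[simp] lemma negExp_zero : negExp 0 = 1 := by simp [negExp]

@[simp] lemma negExp_top : negExp ∞ = 0 := by simp [negExp]

lemma negExp_add (x y : ℝ≥0∞) : negExp (x + y) = negExp x * negExp y := by
  unfold negExp
  rw [← EReal.exp_add, EReal.coe_ennreal_add, EReal.neg_add (by simp) (by simp)]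
  rfl

lemma negExp_antitone : Antitone negExp := fun x y h =>
  EReal.exp_monotone (EReal.neg_le_neg_iff.2 (by exact_mod_cast h))

lemma negExp_le_one (x : ℝ≥0∞) : negExp x ≤ 1 :=
  negExp_zero ▸ negExp_antitone zero_le

lemma negExp_ne_top (x : ℝ≥0∞) : negExp x ≠ ∞ :=
  ((negExp_le_one x).trans_lt ENNReal.one_lt_top).ne

lemma continuous_negExp : Continuous negExp :=
  ENNReal.continuous_exp.comp (continuous_neg.comp continuous_coe_ennreal_ereal)

@[fun_prop]
lemma measurable_negExp : Measurable negExp := continuous_negExp.measurable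

lemma negExp_ofReal {x : ℝ} (hx : 0 ≤ x) :
    negExp (ENNReal.ofReal x) = ENNReal.ofReal (Real.exp (-x)) := by
  unfold negExp
  rw [EReal.coe_ennreal_ofReal, max_eq_left hx, ← EReal.coe_neg, EReal.exp_coe]

lemma negExp_sum {ι : Type*} (s : Finset ι) (f : ι → ℝ≥0∞) :
    negExp (∑ i ∈ s, f i) = ∏ i ∈ s, negExp (f i) := by
  classical
  induction s using Finset.induction_on with
  | empty => simp
  | insert a s ha ih => rw [Finset.sum_insert ha, Finset.prod_insert ha, negExp_add, ih]

lemma negExp_mul_natCast (c : ℝ≥0∞) (n : ℕ) : negExp (c * n) = negExp c ^ n := by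
  induction n with
  | zero => simp
  | succ n ih => rw [Nat.cast_succ, mul_add, mul_one, negExp_add, ih, pow_succ]

/-- The inverse of `negExp` on `[0, 1]`. -/
def negLog (x : ℝ≥0∞) : ℝ≥0∞ := (-(ENNReal.log x)).toENNReal

lemma negExp_negLog {x : ℝ≥0∞} (hx : x ≤ 1) : negExp (negLog x) = x := by
  unfold negExp negLog
  rw [EReal.coe_toENNReal, neg_neg, ENNReal.exp_log]
  have := ENNReal.log_le_zero_iff.2 hx
  exact EReal.neg_nonneg.2 this

@[fun_prop]
lemma measurable_negLog : Measurable negLog :=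
  measurable_ereal_toENNReal.comp (measurable_neg.comp ENNReal.measurable_log)

/-- Replaces an infinite sum, possibly divergent, by a limit of products with values in [0, 1], to
which dominated convergence applies. -/
lemma tendsto_prod_negExp (f : ℕ → ℝ≥0∞) :
    Tendsto (fun n => ∏ j ∈ Finset.range n, negExp (f j)) atTop (𝓝 (negExp (∑' j, f j))) := by
  simp_rw [← negExp_sum]
  exact (continuous_negExp.tendsto _).comp (ENNReal.tendsto_nat_tsum f)

/-! ## The Laplace functional of a Poisson point process -/

lemma pointCount_eq_tsum {Ω E : Type*} (X : ℕ → Ω → E) (A : Set E) (ω : Ω) :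
    ((pointCount X A ω : ℕ∞) : ℝ≥0∞) = ∑' j, A.indicator (fun _ => (1 : ℝ≥0∞)) (X j ω) := by
  unfold pointCount
  rw [← ENNReal.tsum_set_one, tsum_subtype {j | X j ω ∈ A} fun _ => (1 : ℝ≥0∞)]
  rfl

section Poisson

variable {Ω E : Type*} [MeasurableSpace Ω] [MeasurableSpace E]

lemma measurable_pointCount {X : ℕ → Ω → E} (hX : ∀ j, Measurable (X j)) {A : Set E}
    (hA : MeasurableSet A) : Measurable (pointCount X A) := by
  have h : Measurable fun ω => ((pointCount X A ω : ℕ∞) : ℝ≥0∞) := by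
    simp_rw [pointCount_eq_tsum]
    exact Measurable.tsum fun j => (measurable_const.indicator hA).comp (hX j)
  refine measurable_to_countable' fun x => ?_
  have : pointCount X A ⁻¹' {x} = (fun ω => ((pointCount X A ω : ℕ∞) : ℝ≥0∞)) ⁻¹' {(x : ℝ≥0∞)} := by
    ext ω
    simp
  rw [this]
  exact h (measurableSet_singleton _)

variable {X : ℕ → Ω → E} {m : Measure E} {P : Measure Ω} [IsProbabilityMeasure P]

/-- The definition prescribes only the probabilities of finite counts. Those of a Poisson law
already add up to 1, so the value ∞ carries no mass. -/
lemma IsPoissonProcess.map_pointCount (hX : IsPoissonProcess X m P) {A : Set E}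
    (hA : MeasurableSet A) (hmA : m A < ∞) :
    P.map (pointCount X A) = (poissonMeasure (m A).toNNReal).map (fun n : ℕ => (n : ℕ∞)) := by
  have hm := measurable_pointCount hX.measurable hA
  have : IsProbabilityMeasure (P.map (pointCount X A)) :=
    Measure.isProbabilityMeasure_map hm.aemeasurable
  have hc : Measurable (fun n : ℕ => (n : ℕ∞)) := measurable_from_top
  have : IsProbabilityMeasure ((poissonMeasure (m A).toNNReal).map (fun n : ℕ => (n : ℕ∞))) :=
    Measure.isProbabilityMeasure_map hc.aemeasurable
  have hn : ∀ n : ℕ, P.map (pointCount X A) {(n : ℕ∞)} =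
      (poissonMeasure (m A).toNNReal).map (fun n : ℕ => (n : ℕ∞)) {(n : ℕ∞)} := by
    intro n
    rw [Measure.map_apply hm (measurableSet_singleton _),
      Measure.map_apply hc (measurableSet_singleton _)]
    have h1 := hX.count_law A hA hmA n
    have h2 : (fun n : ℕ => (n : ℕ∞)) ⁻¹' {(n : ℕ∞)} = {n} := by ext k; simp
    rw [h2, ← h1]
    rfl
  refine Measure.ext_of_singleton fun x => ?_
  induction x using ENat.recTopCoe with
  | coe n => exact hn n
  | top =>
    have h3 : ({⊤} : Set ℕ∞) = (⋃ n : ℕ, {(n : ℕ∞)})ᶜ := by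
      ext x
      induction x using ENat.recTopCoe <;> simp
    have hd : Pairwise (Function.onFun Disjoint fun n : ℕ => ({(n : ℕ∞)} : Set ℕ∞)) := by
      intro a b hab
      simpa [Function.onFun] using hab
    rw [h3, prob_compl_eq_one_sub (MeasurableSet.of_discrete),
      prob_compl_eq_one_sub (MeasurableSet.of_discrete),
      measure_iUnion hd fun _ => measurableSet_singleton _,
      measure_iUnion hd fun _ => measurableSet_singleton _]
    simp_rw [hn]

/-- The probability generating function, from the exponential series. -/
lemma lintegral_pow_poissonMeasure (r : NNReal) {q : ℝ≥0∞} (hq : q ≤ 1) :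
    ∫⁻ n, q ^ n ∂(poissonMeasure r) = negExp ((1 - q) * r) := by
  lift q to NNReal using (hq.trans_lt ENNReal.one_lt_top).ne
  have hq' : (q : ℝ) ≤ 1 := by exact_mod_cast hq
  rw [lintegral_countable']
  have h1 : ∀ n : ℕ, (q : ℝ≥0∞) ^ n * poissonMeasure r {n} =
      ENNReal.ofReal (Real.exp (-r) * ((q * r : ℝ) ^ n / n.factorial)) := by
    intro n
    rw [poissonMeasure_singleton, ← ENNReal.ofReal_coe_nnreal, ← ENNReal.ofReal_pow q.coe_nonneg,
      ← ENNReal.ofReal_mul (by positivity)]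
    congr 1
    rw [mul_pow]
    ring
  have hs : HasSum (fun n : ℕ => Real.exp (-r) * ((q * r : ℝ) ^ n / n.factorial))
      (Real.exp (-r) * Real.exp (q * r)) := by
    have := NormedSpace.expSeries_div_hasSum_exp (q * r : ℝ)
    rw [← Real.exp_eq_exp_ℝ] at this
    exact this.mul_left _
  simp_rw [h1]
  rw [← ENNReal.ofReal_tsum_of_nonneg (fun n => by positivity) hs.summable, hs.tsum_eq,
    ← Real.exp_add]
  have h2 : ((1 : ℝ≥0∞) - q) * r = ENNReal.ofReal ((1 - q) * r) := by
    rw [ENNReal.ofReal_mul (by linarith), ENNReal.ofReal_sub _ q.coe_nonneg]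
    simp
  rw [h2, negExp_ofReal (mul_nonneg (by linarith) r.coe_nonneg)]
  congr 2
  ring

/-- The alternative `c = 0` is kept because the zero level set of a simple function usually has
infinite measure; there both sides equal 1. -/
lemma IsPoissonProcess.lintegral_negExp_pointCount (hX : IsPoissonProcess X m P) {A : Set E}
    (hA : MeasurableSet A) (c : ℝ≥0∞) (hmA : c = 0 ∨ m A < ∞) :
    ∫⁻ ω, negExp (c * (pointCount X A ω : ℕ∞)) ∂P = negExp ((1 - negExp c) * m A) := by
  rcases hmA with rfl | hmA
  · simp
  have hm := measurable_pointCount hX.measurable hA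
  have h := lintegral_map (μ := P) (f := fun x : ℕ∞ => negExp (c * x)) measurable_from_top hm
  rw [← h, hX.map_pointCount hA hmA, lintegral_map measurable_from_top measurable_from_top]
  simp only [ENat.toENNReal_coe, negExp_mul_natCast]
  rw [lintegral_pow_poissonMeasure _ (negExp_le_one c), ENNReal.coe_toNNReal hmA.ne]

/-- Grouping the points by the value of `φ` writes the sum as a combination of counts in disjoint
level sets. These are independent, so the expectation of the product splits. -/
lemma IsPoissonProcess.lintegral_negExp_tsum_simpleFunc (hX : IsPoissonProcess X m P)
    (φ : SimpleFunc E ℝ≥0∞) (hφ : ∀ c, c ≠ 0 → m (φ ⁻¹' {c}) < ∞) :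
    ∫⁻ ω, negExp (∑' j, φ (X j ω)) ∂P = negExp (∫⁻ x, (1 - negExp (φ x)) ∂m) := by
  classical
  have hsum : ∀ ω, ∑' j, φ (X j ω) =
      ∑ c ∈ φ.range, c * ((pointCount X (φ ⁻¹' {c}) ω : ℕ∞) : ℝ≥0∞) := by
    intro ω
    simp_rw [pointCount_eq_tsum, ← ENNReal.tsum_mul_left]
    rw [← Summable.tsum_finsetSum fun _ _ => ENNReal.summable]
    refine tsum_congr fun j => ?_
    rw [Finset.sum_eq_single (φ (X j ω))]
    · simp
    · intro b _ hb
      simp [Set.indicator, hb.symm]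
    · intro h
      exact absurd (φ.mem_range_self _) h
  have hint : ∫⁻ x, (1 - negExp (φ x)) ∂m =
      ∑ c ∈ φ.range, (1 - negExp c) * m (φ ⁻¹' {c}) := by
    have : ∀ x, 1 - negExp (φ x) = (φ.map fun c => 1 - negExp c) x := fun x => rfl
    simp_rw [this]
    rw [SimpleFunc.lintegral_eq_lintegral, SimpleFunc.map_lintegral]
  -- Independence of counts is stated for families indexed by `Fin k`, so the values of `φ` are
  -- enumerated.
  let e := φ.range.equivFin
  have hind : iIndepFun (fun i => pointCount X (φ ⁻¹' {((e.symm i : φ.range) : ℝ≥0∞)})) P := by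
    refine hX.count_indep _ _ (fun i => φ.measurableSet_fiber _) fun i j hij => ?_
    refine Disjoint.preimage _ ?_
    simp only [disjoint_singleton, ne_eq]
    exact fun h => hij (e.symm.injective (Subtype.ext h))
  have hind' := hind.comp (fun i x => negExp (((e.symm i : φ.range) : ℝ≥0∞) * (x : ℕ∞)))
    fun i => measurable_from_top
  have hprod : ∀ f : ℝ≥0∞ → ℝ≥0∞, ∏ c ∈ φ.range, f c =
      ∏ i, f ((e.symm i : φ.range) : ℝ≥0∞) := by
    intro f
    rw [← Finset.prod_coe_sort, ← e.symm.prod_comp]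
  simp_rw [hsum, negExp_sum]
  rw [hint, negExp_sum, hprod]
  simp_rw [hprod]
  have := lintegral_prod_eq_prod_lintegral_of_indepFun Finset.univ _ hind' fun i =>
    measurable_from_top.comp (measurable_pointCount hX.measurable (φ.measurableSet_fiber _))
  refine this.trans (Finset.prod_congr rfl fun i _ => ?_)
  refine hX.lintegral_negExp_pointCount (φ.measurableSet_fiber _) _ ?_
  by_cases h : ((e.symm i : φ.range) : ℝ≥0∞) = 0
  · exact Or.inl h
  · exact Or.inr (hφ _ h)

/-- The Laplace functional of a Poisson point process. -/
theorem IsPoissonProcess.lintegral_negExp_tsum [SigmaFinite m] (hX : IsPoissonProcess X m P)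
    {φ : E → ℝ≥0∞} (hφ : Measurable φ) :
    ∫⁻ ω, negExp (∑' j, φ (X j ω)) ∂P = negExp (∫⁻ x, (1 - negExp (φ x)) ∂m) := by
  -- Cutting off to sets of finite measure makes every nonzero level set of finite measure, as the
  -- simple-function case requires.
  let ψ : ℕ → SimpleFunc E ℝ≥0∞ := fun n =>
    (SimpleFunc.eapprox φ n).restrict (spanningSets m n)
  have hψ : ∀ n x, ψ n x = (spanningSets m n).indicator (SimpleFunc.eapprox φ n) x := fun n x =>
    SimpleFunc.restrict_apply _ (measurableSet_spanningSets m n) x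
  have hmono : ∀ x, Monotone fun n => ψ n x := by
    intro x a b hab
    simp only [hψ]
    refine (Set.indicator_le_indicator (SimpleFunc.monotone_eapprox φ hab x)).trans ?_
    exact Set.indicator_le_indicator_of_subset (monotone_spanningSets m hab) (fun _ => zero_le) x
  have hlim : ∀ x, Tendsto (fun n => ψ n x) atTop (𝓝 (φ x)) := by
    intro x
    have h1 : Tendsto (fun n => SimpleFunc.eapprox φ n x) atTop (𝓝 (φ x)) :=
      SimpleFunc.iSup_eapprox_apply hφ x ▸
        tendsto_atTop_iSup fun a b hab => SimpleFunc.monotone_eapprox φ hab x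
    refine h1.congr' ?_
    filter_upwards [eventually_ge_atTop (spanningSetsIndex m x)] with n hn
    rw [hψ, Set.indicator_of_mem]
    exact monotone_spanningSets m hn (mem_spanningSetsIndex m x)
  have hcase : ∀ n, ∫⁻ ω, negExp (∑' j, ψ n (X j ω)) ∂P =
      negExp (∫⁻ x, (1 - negExp (ψ n x)) ∂m) := by
    intro n
    refine hX.lintegral_negExp_tsum_simpleFunc _ fun c hc => ?_
    refine (measure_mono ?_).trans_lt (measure_spanningSets_lt_top m n)
    intro x hx
    by_contra hxs
    apply hc
    have : ψ n x = c := hx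
    rw [← this, hψ, Set.indicator_of_notMem hxs]
  have hL : Tendsto (fun n => ∫⁻ ω, negExp (∑' j, ψ n (X j ω)) ∂P) atTop
      (𝓝 (∫⁻ ω, negExp (∑' j, φ (X j ω)) ∂P)) := by
    refine tendsto_lintegral_of_dominated_convergence (fun _ => 1)
      (fun n => measurable_negExp.comp (Measurable.tsum fun j =>
        (ψ n).measurable.comp (hX.measurable j)))
      (fun n => ae_of_all _ fun ω => negExp_le_one _) (by simp) (ae_of_all _ fun ω => ?_)
    refine (continuous_negExp.tendsto _).comp ?_
    -- The sum over `j` is an integral for counting measure, so monotone convergence applies to it.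
    simp_rw [← lintegral_count]
    exact lintegral_tendsto_of_tendsto_of_monotone
      (fun n => (measurable_of_countable _).aemeasurable)
      (ae_of_all _ fun j => hmono (X j ω)) (ae_of_all _ fun j => hlim (X j ω))
  have hR : Tendsto (fun n => negExp (∫⁻ x, (1 - negExp (ψ n x)) ∂m)) atTop
      (𝓝 (negExp (∫⁻ x, (1 - negExp (φ x)) ∂m))) := by
    refine (continuous_negExp.tendsto _).comp ?_
    refine lintegral_tendsto_of_tendsto_of_monotone
      (fun n => (measurable_const.sub (measurable_negExp.comp (ψ n).measurable)).aemeasurable)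
      (ae_of_all _ fun x a b hab => tsub_le_tsub_left (negExp_antitone (hmono x hab)) 1)
      (ae_of_all _ fun x => ?_)
    exact ENNReal.Tendsto.sub tendsto_const_nhds ((continuous_negExp.tendsto _).comp (hlim x))
      (Or.inl ENNReal.one_ne_top)
  simp_rw [hcase] at hL
  exact tendsto_nhds_unique hL hR

/-- Induction on the number of marks. Integrating out the last one leaves a factor that depends only
on the positions and can be absorbed into `f`, which is why `f` is arbitrary and quantified inside
the induction. -/
lemma lintegral_prod_mark {M : Type*} [MeasurableSpace M] {Y : ℕ → Ω → M} {ν : Measure M}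
    [SFinite ν] (hX : ∀ j, Measurable (X j)) (hY : ∀ j, Measurable (Y j))
    (hlaw : ∀ j, P.map (Y j) = ν)
    (hind : ∀ n, IndepFun (fun ω => ((fun j => X j ω), fun i : Fin n => Y i ω)) (Y n) P)
    {k : E → M → ℝ≥0∞} (hk : Measurable (Function.uncurry k)) (n : ℕ) :
    ∀ f : (ℕ → E) → ℝ≥0∞, Measurable f →
      ∫⁻ ω, f (fun j => X j ω) * ∏ j ∈ Finset.range n, k (X j ω) (Y j ω) ∂P =
        ∫⁻ ω, f (fun j => X j ω) * ∏ j ∈ Finset.range n, ∫⁻ y, k (X j ω) y ∂ν ∂P := by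
  have hκ : Measurable fun x => ∫⁻ y, k x y ∂ν := hk.lintegral_prod_right
  have hXX : Measurable fun ω j => X j ω := measurable_pi_lambda _ hX
  induction n with
  | zero => simp
  | succ n ih =>
    intro f hf
    let g : (ℕ → E) × (Fin n → M) → ℝ≥0∞ := fun z => f z.1 * ∏ i : Fin n, k (z.1 i) (z.2 i)
    have hg : Measurable g := by
      refine (hf.comp measurable_fst).mul (Finset.measurable_prod _ fun i _ => ?_)
      exact hk.comp (by fun_prop : Measurable fun z : (ℕ → E) × (Fin n → M) => (z.1 i, z.2 i))
    have hZ : Measurable fun ω => ((fun j => X j ω), fun i : Fin n => Y i ω) :=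
      hXX.prodMk (measurable_pi_lambda _ fun i => hY i)
    have hmap := (indepFun_iff_map_prod_eq_prod_map_map hZ.aemeasurable
      (hY n).aemeasurable).1 (hind n)
    have hF : Measurable fun z : ((ℕ → E) × (Fin n → M)) × M => g z.1 * k (z.1.1 n) z.2 :=
      (hg.comp measurable_fst).mul
        (hk.comp (by fun_prop : Measurable fun z : ((ℕ → E) × (Fin n → M)) × M => (z.1.1 n, z.2)))
    calc _ = ∫⁻ ω, g ((fun j => X j ω), fun i : Fin n => Y i ω) * k (X n ω) (Y n ω) ∂P := by
          refine lintegral_congr fun ω => ?_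
          simp only [g]
          rw [Finset.prod_range_succ, ← mul_assoc, Finset.prod_range]
      _ = ∫⁻ z, g z.1 * k (z.1.1 n) z.2
            ∂(P.map fun ω => (((fun j => X j ω), fun i : Fin n => Y i ω), Y n ω)) := by
          rw [lintegral_map hF (hZ.prodMk (hY n))]
      _ = ∫⁻ z, g z * ∫⁻ y, k (z.1 n) y ∂ν
            ∂(P.map fun ω => ((fun j => X j ω), fun i : Fin n => Y i ω)) := by
          rw [hmap, hlaw, lintegral_prod _ hF.aemeasurable]
          refine lintegral_congr fun z => ?_
          exact lintegral_const_mul (g z) (f := fun y => k (z.1 n) y)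
            (hk.comp measurable_prodMk_left)
      _ = ∫⁻ ω, (f (fun j => X j ω) * ∫⁻ y, k (X n ω) y ∂ν) *
            ∏ j ∈ Finset.range n, k (X j ω) (Y j ω) ∂P := by
          rw [lintegral_map _ hZ]
          · refine lintegral_congr fun ω => ?_
            simp only [g]
            rw [Finset.prod_range]
            ring
          · exact hg.mul (hκ.comp (by fun_prop : Measurable fun z : (ℕ → E) × (Fin n → M) => z.1 n))
      _ = _ := by
          rw [ih (fun x => f x * ∫⁻ y, k (x n) y ∂ν)
            (hf.mul (hκ.comp (measurable_pi_apply n)))]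
          refine lintegral_congr fun ω => ?_
          rw [Finset.prod_range_succ]
          ring

/-- The Laplace functional of an independently marked Poisson point process. -/
theorem IsPoissonProcess.lintegral_negExp_tsum_mark [SigmaFinite m]
    (hX : IsPoissonProcess X m P) {M : Type*} [MeasurableSpace M] {Y : ℕ → Ω → M}
    {ν : Measure M} [IsProbabilityMeasure ν] (hY : ∀ j, Measurable (Y j))
    (hlaw : ∀ j, P.map (Y j) = ν)
    (hind : ∀ n, IndepFun (fun ω => ((fun j => X j ω), fun i : Fin n => Y i ω)) (Y n) P)
    {H : E → M → ℝ≥0∞} (hH : Measurable (Function.uncurry H)) :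
    ∫⁻ ω, negExp (∑' j, H (X j ω) (Y j ω)) ∂P =
      negExp (∫⁻ x, (1 - ∫⁻ y, negExp (H x y) ∂ν) ∂m) := by
  have hk : Measurable (Function.uncurry fun x y => negExp (H x y)) := measurable_negExp.comp hH
  let κ : E → ℝ≥0∞ := fun x => ∫⁻ y, negExp (H x y) ∂ν
  have hκ : Measurable κ := hk.lintegral_prod_right
  have hκ1 : ∀ x, κ x ≤ 1 := fun x => by
    calc κ x ≤ ∫⁻ y, 1 ∂ν := lintegral_mono fun y => negExp_le_one _
      _ = 1 := by simp
  have hprod1 : ∀ (n : ℕ) (f : ℕ → ℝ≥0∞), (∀ j, f j ≤ 1) → ∏ j ∈ Finset.range n, f j ≤ 1 :=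
    fun n f hf => Finset.prod_le_one' fun j _ => hf j
  have h1 : Tendsto (fun n => ∫⁻ ω, ∏ j ∈ Finset.range n, negExp (H (X j ω) (Y j ω)) ∂P) atTop
      (𝓝 (∫⁻ ω, negExp (∑' j, H (X j ω) (Y j ω)) ∂P)) := by
    refine tendsto_lintegral_of_dominated_convergence (fun _ => 1)
      (fun n => Finset.measurable_prod _ fun j _ => ?_)
      (fun n => ae_of_all _ fun ω => hprod1 _ _ fun j => negExp_le_one _) (by simp)
      (ae_of_all _ fun ω => tendsto_prod_negExp _)
    exact hk.comp ((hX.measurable j).prodMk (hY j))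
  -- Writing `κ` as `negExp (negLog κ)` turns the product of mean mark factors into the unmarked
  -- functional of `negLog ∘ κ`.
  have h2 : Tendsto (fun n => ∫⁻ ω, ∏ j ∈ Finset.range n, κ (X j ω) ∂P) atTop
      (𝓝 (∫⁻ ω, negExp (∑' j, negLog (κ (X j ω))) ∂P)) := by
    refine tendsto_lintegral_of_dominated_convergence (fun _ => 1)
      (fun n => Finset.measurable_prod _ fun j _ => hκ.comp (hX.measurable j))
      (fun n => ae_of_all _ fun ω => hprod1 _ _ fun j => hκ1 _) (by simp)
      (ae_of_all _ fun ω => ?_)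
    refine (tendsto_prod_negExp _).congr fun n => ?_
    exact Finset.prod_congr rfl fun j _ => negExp_negLog (hκ1 _)
  have h3 : ∀ n, ∫⁻ ω, ∏ j ∈ Finset.range n, negExp (H (X j ω) (Y j ω)) ∂P =
      ∫⁻ ω, ∏ j ∈ Finset.range n, κ (X j ω) ∂P := by
    intro n
    have := lintegral_prod_mark hX.measurable hY hlaw hind hk n (fun _ => 1) measurable_const
    simpa only [one_mul] using this
  simp_rw [h3] at h1
  refine (tendsto_nhds_unique h1 h2).trans
    ((hX.lintegral_negExp_tsum (measurable_negLog.comp hκ)).trans (congrArg negExp ?_))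
  exact lintegral_congr fun x => by rw [Function.comp_apply, negExp_negLog (hκ1 x)]

end Poisson

/-! ## Integrals -/

lemma lintegral_expMeasure_one {f : ℝ → ℝ≥0∞} (hf : Measurable f) :
    ∫⁻ h, f h ∂(expMeasure 1) = ∫⁻ h in Ioi (0 : ℝ), ENNReal.ofReal (Real.exp (-h)) * f h := by
  have hd : Measurable (exponentialPDF 1) := (measurable_exponentialPDFReal 1).ennreal_ofReal
  have h1 : expMeasure 1 = volume.withDensity (exponentialPDF 1) := rfl
  rw [h1, lintegral_withDensity_eq_lintegral_mul _ hd hf, restrict_Ioi_eq_restrict_Ici,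
    ← lintegral_indicator measurableSet_Ici]
  refine lintegral_congr fun x => ?_
  rw [Pi.mul_apply]
  by_cases hx : 0 ≤ x
  · rw [exponentialPDF_of_nonneg hx, indicator_of_mem (mem_Ici.2 hx)]
    simp
  · rw [exponentialPDF_of_neg (not_le.1 hx), indicator_of_notMem (by simpa using hx)]
    simp

lemma lintegral_exp_neg_mul_Ioi {a : ℝ} (ha : 0 < a) (b : ℝ) :
    ∫⁻ x in Ioi b, ENNReal.ofReal (Real.exp (-(a * x))) =
      ENNReal.ofReal (Real.exp (-(a * b)) / a) := by
  have h := integral_exp_mul_Ioi (neg_neg_of_pos ha) b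
  -- A Bochner integral with a nonzero value is that of an integrable function, so integrability
  -- follows from the closed form.
  have h0 : ∫ x in Ioi b, Real.exp (-a * x) ≠ 0 := by
    rw [h]
    have := Real.exp_pos (-a * b)
    rw [neg_div_neg_eq]
    positivity
  rw [neg_div_neg_eq] at h
  simp_rw [← neg_mul]
  rw [← h, ofReal_integral_eq_lintegral_ofReal (Integrable.of_integral_ne_zero h0)]
  exact ae_of_all _ fun x => (Real.exp_pos _).le

lemma lintegral_negExp_mul_expMeasure {c : ℝ} (hc : 0 ≤ c) :
    ∫⁻ h, negExp (ENNReal.ofReal (c * h)) ∂(expMeasure 1) = ENNReal.ofReal (1 / (1 + c)) := by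
  rw [lintegral_expMeasure_one (by fun_prop)]
  have : ∀ h ∈ Ioi (0 : ℝ), ENNReal.ofReal (Real.exp (-h)) * negExp (ENNReal.ofReal (c * h)) =
      ENNReal.ofReal (Real.exp (-((1 + c) * h))) := by
    intro h hh
    rw [negExp_ofReal (mul_nonneg hc (le_of_lt hh)), ← ENNReal.ofReal_mul (Real.exp_pos _).le,
      ← Real.exp_add]
    congr 2
    ring
  rw [setLIntegral_congr_fun measurableSet_Ioi this, lintegral_exp_neg_mul_Ioi (by linarith)]
  simp

lemma expMeasure_one_Ioi {x : ℝ} (hx : 0 ≤ x) :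
    expMeasure 1 (Ioi x) = ENNReal.ofReal (Real.exp (-x)) := by
  rw [← lintegral_indicator_one measurableSet_Ioi,
    lintegral_expMeasure_one (measurable_one.indicator measurableSet_Ioi)]
  have h2 : ∀ h, ENNReal.ofReal (Real.exp (-h)) * (Ioi x).indicator 1 h =
      (Ioi x).indicator (fun h => ENNReal.ofReal (Real.exp (-(1 * h)))) h := by
    intro h
    by_cases hh : h ∈ Ioi x <;> simp [hh]
  simp_rw [h2]
  rw [setLIntegral_indicator measurableSet_Ioi,
    inter_eq_left.2 (Ioi_subset_Ioi hx), lintegral_exp_neg_mul_Ioi one_pos]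
  simp

/-- Polar coordinates: the circle has length 2π, twice the area of the unit disc, and the radial
measure has density r. -/
lemma lintegral_plane_radial {f : ℝ → ℝ≥0∞} (hf : Measurable f) :
    ∫⁻ x : Plane, f ‖x‖ = ∫⁻ r in Ioi (0 : ℝ), ENNReal.ofReal (2 * Real.pi * r) * f r := by
  have hd : Module.finrank ℝ Plane = 2 := by simp
  let μ : Measure Plane := volume
  have hmp := μ.measurePreserving_homeomorphUnitSphereProd
  have h1 : ∫⁻ x : Plane, f ‖x‖ = ∫⁻ x : ({(0)}ᶜ : Set Plane), f ‖x.1‖ ∂(μ.comap (↑)) := by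
    rw [lintegral_subtype_comap (measurableSet_singleton _).compl fun x => f ‖x‖,
      restrict_compl_singleton]
  have h2 : ∫⁻ x : ({(0)}ᶜ : Set Plane), f ‖x.1‖ ∂(μ.comap (↑)) =
      ∫⁻ z, f z.2 ∂(μ.toSphere.prod (Measure.volumeIoiPow (Module.finrank ℝ Plane - 1))) := by
    rw [← hmp.lintegral_comp_emb (Homeomorph.measurableEmbedding _)]
    simp
  have h3 : ∀ r : Ioi (0 : ℝ), f r * μ.toSphere univ =
      μ.toSphere univ * f r := fun r => mul_comm _ _
  rw [h1, h2, lintegral_prod_symm' _ (by fun_prop)]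
  simp only [lintegral_const]
  simp_rw [h3]
  rw [lintegral_const_mul _ (by fun_prop), Measure.volumeIoiPow,
    lintegral_withDensity_eq_lintegral_mul _ (by fun_prop) (by fun_prop)]
  simp only [Pi.mul_apply]
  rw [lintegral_subtype_comap measurableSet_Ioi
    fun r : ℝ => ENNReal.ofReal (r ^ (Module.finrank ℝ Plane - 1)) * f r, hd,
    ← lintegral_const_mul _ (by fun_prop), Measure.toSphere_apply_univ, hd,
    EuclideanSpace.volume_ball_fin_two]
  refine setLIntegral_congr_fun measurableSet_Ioi fun r hr => ?_
  rw [ENNReal.ofReal_mul (by positivity), ENNReal.ofReal_mul (by positivity)]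
  simp [mul_assoc]

lemma lintegral_rpow_mul_exp_neg_mul_Ioi {a r : ℝ} (ha : 0 < a) (hr : 0 < r) :
    ∫⁻ t in Ioi (0 : ℝ), ENNReal.ofReal (t ^ (a - 1) * Real.exp (-(r * t))) =
      ENNReal.ofReal ((1 / r) ^ a * Real.Gamma a) := by
  have h := Real.integral_rpow_mul_exp_neg_mul_Ioi ha hr
  have hG := Real.Gamma_pos_of_pos ha
  have h0 : ∫ t in Ioi (0 : ℝ), t ^ (a - 1) * Real.exp (-(r * t)) ≠ 0 := by
    rw [h]; positivity
  rw [← h, ofReal_integral_eq_lintegral_ofReal (Integrable.of_integral_ne_zero h0)]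
  refine (ae_restrict_iff' measurableSet_Ioi).2 (ae_of_all _ fun t ht => ?_)
  have : 0 < t := ht
  simp only [Pi.zero_apply]
  positivity

/-- The Mellin transform of `1 / (1 + u)`. -/
lemma lintegral_rpow_div_one_add {a : ℝ} (ha : 0 < a) (ha1 : a < 1) :
    ∫⁻ u in Ioi (0 : ℝ), ENNReal.ofReal (u ^ (a - 1) / (1 + u)) =
      ENNReal.ofReal (Real.pi / Real.sin (Real.pi * a)) := by
  -- Writing 1 / (1 + u) as the integral of exp(-(1 + u)s) and exchanging integrals produces Γ(a)
  -- Γ(1 - a), which the reflection formula evaluates.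
  have h1 : ∀ u ∈ Ioi (0 : ℝ), ENNReal.ofReal (u ^ (a - 1) / (1 + u)) =
      ∫⁻ s in Ioi (0 : ℝ), ENNReal.ofReal (u ^ (a - 1) * Real.exp (-((1 + u) * s))) := by
    intro u hu
    have hu' : 0 < u := hu
    have := lintegral_exp_neg_mul_Ioi (a := 1 + u) (by positivity) 0
    simp_rw [ENNReal.ofReal_mul (Real.rpow_nonneg hu'.le (a - 1))]
    rw [lintegral_const_mul _ (by fun_prop), this, ← ENNReal.ofReal_mul (by positivity)]
    simp [div_eq_mul_inv]
  have h2 : ∀ s ∈ Ioi (0 : ℝ),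
      ∫⁻ u in Ioi (0 : ℝ), ENNReal.ofReal (u ^ (a - 1) * Real.exp (-((1 + u) * s))) =
      ENNReal.ofReal (Real.Gamma a) *
        ENNReal.ofReal (s ^ ((1 - a) - 1) * Real.exp (-(1 * s))) := by
    intro s hs
    have hs' : 0 < s := hs
    have h3 : ∀ u, ENNReal.ofReal (u ^ (a - 1) * Real.exp (-((1 + u) * s))) =
        ENNReal.ofReal (Real.exp (-s)) *
          ENNReal.ofReal (u ^ (a - 1) * Real.exp (-(s * u))) := by
      intro u
      rw [← ENNReal.ofReal_mul (Real.exp_pos _).le]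
      congr 1
      rw [mul_left_comm, ← Real.exp_add]
      congr 2
      ring
    simp_rw [h3]
    have hG := Real.Gamma_pos_of_pos ha
    rw [lintegral_const_mul _ (by fun_prop), lintegral_rpow_mul_exp_neg_mul_Ioi ha hs',
      ← ENNReal.ofReal_mul (Real.exp_pos _).le, ← ENNReal.ofReal_mul hG.le]
    congr 1
    rw [one_div, Real.inv_rpow hs'.le, ← Real.rpow_neg hs'.le]
    simp
    ring
  rw [setLIntegral_congr_fun measurableSet_Ioi h1, lintegral_lintegral_swap (by fun_prop),
    setLIntegral_congr_fun measurableSet_Ioi h2, lintegral_const_mul _ (by fun_prop),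
    lintegral_rpow_mul_exp_neg_mul_Ioi (by linarith) one_pos,
    ← ENNReal.ofReal_mul (Real.Gamma_pos_of_pos ha).le]
  simp [Real.Gamma_mul_Gamma_one_sub]

/-! ### Path-loss integrals over the exterior of a disc and over the plane. -/

section PathLoss

variable {η : ℝ}

/-- The substitution x = b t^(-1/η) makes the path loss x^(-η) linear in t. The set `S` is left free
so that (0, 1) serves for the exterior of a disc and (0, ∞) for the plane. -/
lemma lintegral_pathLoss_subst (hη : 2 < η) {b c : ℝ} (hb : 0 < b) (hc : 0 ≤ c) {S : Set ℝ}
    (hS : MeasurableSet S) (hS0 : S ⊆ Ioi 0) :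
    ∫⁻ x in (fun t : ℝ => b * t ^ (-(1 / η))) '' S,
        ENNReal.ofReal (2 * Real.pi * x) * ENNReal.ofReal (c * x ^ (-η) / (1 + c * x ^ (-η))) =
      ENNReal.ofReal (2 * Real.pi / η * (c * b ^ (2 - η))) *
        ∫⁻ t in S, ENNReal.ofReal (t ^ (-(2 / η)) / (1 + c * b ^ (-η) * t)) := by
  have hη0 : 0 < η := by linarith
  have hder : ∀ t ∈ S, HasDerivWithinAt (fun t : ℝ => b * t ^ (-(1 / η)))
      (b * (-(1 / η) * t ^ (-(1 / η) - 1))) S t := by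
    intro t ht
    exact ((Real.hasDerivAt_rpow_const (Or.inl (hS0 ht).ne')).const_mul b).hasDerivWithinAt
  have hinj : InjOn (fun t : ℝ => b * t ^ (-(1 / η))) S := by
    intro t ht u hu h
    have h1 : t ^ (-(1 / η)) = u ^ (-(1 / η)) := mul_left_cancel₀ hb.ne' h
    have hS0 : ∀ {t}, t ∈ S → 0 < t := fun h => hS0 h
    exact Real.rpow_left_injOn (by simp [hη0.ne']) (Set.mem_ofPred.2 (hS0 ht).le) (Set.mem_ofPred.2 (hS0 hu).le) h1
  rw [lintegral_image_eq_lintegral_abs_deriv_mul hS hder hinj, ← lintegral_const_mul _ (by fun_prop)]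
  refine setLIntegral_congr_fun hS fun t ht => ?_
  have ht0 : 0 < t := hS0 ht
  have hx : (b * t ^ (-(1 / η))) ^ (-η) = b ^ (-η) * t := by
    rw [Real.mul_rpow hb.le (by positivity), ← Real.rpow_mul ht0.le]
    have : -(1 / η) * -η = 1 := by field_simp
    rw [this, Real.rpow_one]
  rw [hx, abs_mul, abs_mul, abs_neg, abs_of_pos hb, abs_of_pos (by positivity : 0 < 1 / η),
    abs_of_pos (by positivity : 0 < t ^ (-(1 / η) - 1)), ← ENNReal.ofReal_mul (by positivity),
    ← ENNReal.ofReal_mul (by positivity), ← ENNReal.ofReal_mul (by positivity)]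
  congr 1
  have h1 : b ^ (2 - η) = b * b * b ^ (-η) := by
    rw [sub_eq_add_neg, Real.rpow_add hb, Real.rpow_two]; ring
  have h2 : t ^ (-(2 / η)) = t ^ (-(1 / η) - 1) * t ^ (-(1 / η)) * t := by
    rw [← Real.rpow_add ht0]
    nth_rewrite 3 [← Real.rpow_one t]
    rw [← Real.rpow_add ht0]
    congr 1
    ring
  have h3 : 0 < 1 + c * b ^ (-η) * t := by positivity
  rw [h1, h2, ← mul_assoc c]
  field_simp

/-- Here c - b = 1, so the weight (1 - t)^(c-b-1) in Euler's integral is trivial and the Gamma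
prefactor reduces to b = 1 - 2/η. -/
lemma hyp2F1_pathLoss (hη : 2 < η) (z : ℝ) :
    hyp2F1 1 (1 - 2 / η) (2 - 2 / η) z =
      (1 - 2 / η) * ∫ t in (0 : ℝ)..1, t ^ (-(2 / η)) / (1 - z * t) := by
  have hη0 : 0 < η := by linarith
  have h0 : 0 < 1 - 2 / η := by
    rw [sub_pos, div_lt_one hη0]; exact hη
  unfold hyp2F1
  have e1 : 2 - 2 / η - (1 - 2 / η) = 1 := by ring
  have e2 : (2 - 2 / η) = (1 - 2 / η) + 1 := by ring
  rw [e1, e2, Real.Gamma_add_one h0.ne', Real.Gamma_one, mul_one,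
    mul_div_cancel_right₀ _ (Real.Gamma_pos_of_pos h0).ne']
  congr 1
  refine intervalIntegral.integral_congr fun t _ => ?_
  simp only [sub_self, Real.rpow_zero, mul_one, Real.rpow_neg_one, div_eq_mul_inv]
  congr 2
  ring

lemma intervalIntegrable_pathLoss (hη : 2 < η) {k : ℝ} (hk : 0 ≤ k) :
    IntegrableOn (fun t : ℝ => t ^ (-(2 / η)) / (1 + k * t)) (Ioc 0 1) := by
  have hη0 : 0 < η := by linarith
  have h0 : -1 < -(2 / η) := by
    rw [neg_lt_neg_iff, div_lt_one hη0]; exact hη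
  have h1 : IntegrableOn (fun t : ℝ => t ^ (-(2 / η))) (Ioc 0 1) :=
    (intervalIntegrable_iff_integrableOn_Ioc_of_le zero_le_one).1
      (intervalIntegral.intervalIntegrable_rpow' h0)
  refine Integrable.mono' h1 (Measurable.aestronglyMeasurable (by fun_prop)) ?_
  refine (ae_restrict_iff' measurableSet_Ioc).2 (ae_of_all _ fun t ht => ?_)
  have ht0 : 0 < t := ht.1
  have : 1 ≤ 1 + k * t := by nlinarith [mul_nonneg hk ht0.le]
  rw [Real.norm_of_nonneg (by positivity)]
  exact div_le_self (by positivity) this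

lemma hyp2F1_pathLoss_nonneg (hη : 2 < η) {k : ℝ} (hk : 0 ≤ k) :
    0 ≤ hyp2F1 1 (1 - 2 / η) (2 - 2 / η) (-k) := by
  have hη0 : 0 < η := by linarith
  have h0 : 0 < 1 - 2 / η := by
    rw [sub_pos, div_lt_one hη0]; exact hη
  rw [hyp2F1_pathLoss hη]
  refine mul_nonneg h0.le (intervalIntegral.integral_nonneg zero_le_one fun t ht => ?_)
  have ht0 : 0 ≤ t := ht.1
  have : 0 < 1 - -k * t := by nlinarith [mul_nonneg hk ht0]
  positivity

/-- The mean field of the interferers outside a disc. -/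
lemma lintegral_pathLoss_Ioi (hη : 2 < η) {b c : ℝ} (hb : 0 < b) (hc : 0 ≤ c) :
    ∫⁻ x in Ioi b,
        ENNReal.ofReal (2 * Real.pi * x) * ENNReal.ofReal (c * x ^ (-η) / (1 + c * x ^ (-η))) =
      ENNReal.ofReal (2 * Real.pi / (η - 2) * b ^ (2 - η) * c *
        hyp2F1 1 (1 - 2 / η) (2 - 2 / η) (-(c * b ^ (-η)))) := by
  have hη0 : 0 < η := by linarith
  -- The substitution reverses the order and sends 1 to b and 0 to ∞.
  have himg : (fun t : ℝ => b * t ^ (-(1 / η))) '' Ioo 0 1 = Ioi b := by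
    ext x
    simp only [mem_image, mem_Ioo, mem_Ioi]
    constructor
    · rintro ⟨t, ⟨h0, h1⟩, rfl⟩
      have := Real.one_lt_rpow_of_pos_of_lt_one_of_neg h0 h1
        (neg_neg_of_pos (by positivity : 0 < 1 / η))
      nlinarith
    · intro hx
      have hx0 : 0 < x := hb.trans hx
      have hxb : 1 < x / b := (one_lt_div hb).2 hx
      refine ⟨(x / b) ^ (-η), ⟨by positivity,
        Real.rpow_lt_one_of_one_lt_of_neg hxb (by linarith)⟩, ?_⟩
      rw [← Real.rpow_mul (by positivity)]
      have : -η * -(1 / η) = 1 := by field_simp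
      rw [this, Real.rpow_one]
      field_simp
  have hk : 0 ≤ c * b ^ (-η) := by positivity
  rw [← himg, lintegral_pathLoss_subst hη hb hc measurableSet_Ioo (fun t ht => ht.1),
    hyp2F1_pathLoss hη, restrict_Ioo_eq_restrict_Ioc,
    ← ofReal_integral_eq_lintegral_ofReal (intervalIntegrable_pathLoss hη hk),
    ← ENNReal.ofReal_mul (by positivity), intervalIntegral.integral_of_le zero_le_one]
  · congr 1
    simp_rw [neg_mul, sub_neg_eq_add]
    have : η - 2 ≠ 0 := by linarith
    field_simp
  · refine (ae_restrict_iff' measurableSet_Ioc).2 (ae_of_all _ fun t ht => ?_)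
    have ht0 : 0 < t := ht.1
    simp only [Pi.zero_apply]
    positivity

/-- The mean field of the interferers in the whole plane. -/
lemma lintegral_pathLoss_Ioi_zero (hη : 2 < η) {c : ℝ} (hc : 0 ≤ c) :
    ∫⁻ x in Ioi (0 : ℝ),
        ENNReal.ofReal (2 * Real.pi * x) * ENNReal.ofReal (c * x ^ (-η) / (1 + c * x ^ (-η))) =
      ENNReal.ofReal (2 * Real.pi ^ 2 / η * c ^ (2 / η) * (Real.sin (2 * Real.pi / η))⁻¹) := by
  have hη0 : 0 < η := by linarith
  rcases hc.eq_or_lt with rfl | hc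
  · simp [Real.zero_rpow (by positivity : 2 / η ≠ 0)]
  -- This scale makes c b^(-η) = 1, so that what remains is the Mellin transform of 1 / (1 + t) at 1
  -- - 2/η, a point of (0, 1).
  let b : ℝ := c ^ (1 / η)
  have hb : 0 < b := by positivity
  have himg : (fun t : ℝ => b * t ^ (-(1 / η))) '' Ioi 0 = Ioi 0 := by
    ext x
    simp only [mem_image, mem_Ioi]
    constructor
    · rintro ⟨t, h0, rfl⟩
      positivity
    · intro hx0
      refine ⟨(x / b) ^ (-η), by positivity, ?_⟩
      rw [← Real.rpow_mul (by positivity)]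
      have : -η * -(1 / η) = 1 := by field_simp
      rw [this, Real.rpow_one]
      field_simp
  have hcb : c * b ^ (-η) = 1 := by
    simp only [b]
    rw [← Real.rpow_mul hc.le]
    have : 1 / η * -η = -1 := by field_simp
    rw [this, Real.rpow_neg_one]
    field_simp
  have hcb2 : c * b ^ (2 - η) = c ^ (2 / η) := by
    rw [sub_eq_neg_add, Real.rpow_add hb, ← mul_assoc, hcb, one_mul]
    simp only [b]
    rw [← Real.rpow_mul hc.le]
    congr 1
    ring
  have h2η : 2 / η < 1 := (div_lt_one hη0).2 hη
  have hM := lintegral_rpow_div_one_add (a := 1 - 2 / η) (by linarith)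
    (by linarith [(by positivity : 0 < 2 / η)])
  rw [sub_sub_cancel_left] at hM
  rw [← himg, lintegral_pathLoss_subst hη hb hc.le measurableSet_Ioi subset_rfl, hcb, hcb2]
  simp_rw [one_mul]
  rw [hM, ← ENNReal.ofReal_mul (by positivity)]
  congr 1
  have : Real.sin (Real.pi * (1 - 2 / η)) = Real.sin (2 * Real.pi / η) := by
    rw [← Real.sin_pi_sub]
    congr 1
    ring
  rw [this]
  ring

end PathLoss

/-- Fubini for the product law of independent variables. This is how each group of sources is
integrated out while the others stay frozen. -/
lemma lintegral_indepFun {Ω α β : Type*} [MeasurableSpace Ω] [MeasurableSpace α]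
    [MeasurableSpace β] {P : Measure Ω} [IsFiniteMeasure P] {Y : Ω → α} {Z : Ω → β}
    (h : IndepFun Y Z P) (hY : Measurable Y) (hZ : Measurable Z) {F : α → β → ℝ≥0∞}
    (hF : Measurable (Function.uncurry F)) :
    ∫⁻ ω, F (Y ω) (Z ω) ∂P = ∫⁻ ω, ∫⁻ z, F (Y ω) z ∂(P.map Z) ∂P := by
  have hmap := (indepFun_iff_map_prod_eq_prod_map_map hY.aemeasurable hZ.aemeasurable).1 h
  calc ∫⁻ ω, F (Y ω) (Z ω) ∂P
      = ∫⁻ z, Function.uncurry F z ∂(P.map fun ω => (Y ω, Z ω)) := by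
        rw [lintegral_map hF (hY.prodMk hZ)]; rfl
    _ = ∫⁻ y, ∫⁻ z, F y z ∂(P.map Z) ∂(P.map Y) := by
        rw [hmap, lintegral_prod _ hF.aemeasurable]; rfl
    _ = _ := by rw [lintegral_map hF.lintegral_prod_right hY]

/-- The σ-algebra on `Ω` is an implicit argument found by unification, so it may be one generated by
only some of the sources. -/
lemma measurable_pi {Ω ι α : Type*} {mΩ : MeasurableSpace Ω} [MeasurableSpace α] {f : ι → Ω → α}
    (h : ∀ i, Measurable (f i)) : Measurable fun ω i => f i ω :=
  measurable_pi_lambda _ h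

namespace Network

variable {Ω : Type*} {N : Network Ω}

/-! ## Measurability -/

lemma measurable_servingDist [MeasurableSpace Ω] (h : ∀ j, Measurable (N.bsPos j)) :
    Measurable N.servingDist :=
  Measurable.iInf fun j => (h j).norm

lemma servingDist_nonneg (ω : Ω) : 0 ≤ N.servingDist ω :=
  Real.iInf_nonneg fun _ => norm_nonneg _

/-- Identifies a tail event of the serving distance with the absence of base stations from an open
disc. -/
lemma le_servingDist_iff {a : ℝ} {ω : Ω} :
    a ≤ N.servingDist ω ↔ ∀ j, a ≤ ‖N.bsPos j ω‖ :=
  le_ciInf_iff ⟨0, by rintro _ ⟨j, rfl⟩; exact norm_nonneg _⟩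

/-- Trades a sum over a random index set for one over all of ℕ, whose terms can be checked for
measurability one by one. -/
lemma bsSum_eq_tsum_ite (p : Params) (J : Set ℕ) [DecidablePred (· ∈ J)] (ω : Ω) :
    N.bsSum p J ω = ∑' j, if j ∈ J then
      ENNReal.ofReal (p.Pd * N.bsGain j ω * ‖N.bsPos j ω‖ ^ (-p.η)) else 0 := by
  unfold bsSum
  rw [tsum_subtype J fun j => ENNReal.ofReal (p.Pd * N.bsGain j ω * ‖N.bsPos j ω‖ ^ (-p.η))]
  simp [indicator_apply]

lemma ueSum_eq_tsum_ite (p : Params) (ω : Ω) :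
    N.ueSum p ω = ∑' j, if N.ueDist j ω < ‖N.uePos j ω‖ then
      ENNReal.ofReal (uePower p (N.ueDist j ω) * N.ueGain j ω * ‖N.uePos j ω‖ ^ (-p.η))
      else 0 := by
  unfold ueSum
  rw [tsum_subtype {j : ℕ | N.ueDist j ω < ‖N.uePos j ω‖} fun j => ENNReal.ofReal
    (uePower p (N.ueDist j ω) * N.ueGain j ω * ‖N.uePos j ω‖ ^ (-p.η))]
  simp [indicator_apply]

lemma measurable_bsSum_serving [MeasurableSpace Ω] (p : Params)
    (h : ∀ j, Measurable (N.bsPos j)) (h' : ∀ j, Measurable (N.bsGain j)) :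
    Measurable fun ω => N.bsSum p {j | N.servingDist ω < ‖N.bsPos j ω‖} ω := by
  classical
  simp_rw [bsSum_eq_tsum_ite]
  refine Measurable.tsum fun j => Measurable.ite ?_ ?_ measurable_const
  · exact measurableSet_lt (measurable_servingDist h) (h j).norm
  · have := h j
    have := h' j
    fun_prop

lemma measurable_bsSum_univ [MeasurableSpace Ω] (p : Params)
    (h : ∀ j, Measurable (N.bsPos j)) (h' : ∀ j, Measurable (N.bsGain j)) :
    Measurable fun ω => N.bsSum p univ ω := by
  classical
  simp_rw [bsSum_eq_tsum_ite]
  refine Measurable.tsum fun j => Measurable.ite (by simp) ?_ measurable_const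
  have := h j
  have := h' j
  fun_prop

lemma measurable_ueSum [MeasurableSpace Ω] (p : Params)
    (h : ∀ j, Measurable (N.uePos j)) (h' : ∀ j, Measurable (N.ueGain j))
    (h'' : ∀ j, Measurable (N.ueDist j)) :
    Measurable fun ω => N.ueSum p ω := by
  classical
  simp_rw [ueSum_eq_tsum_ite]
  refine Measurable.tsum fun j => Measurable.ite ?_ ?_ measurable_const
  · exact measurableSet_lt (h'' j) (h j).norm
  · have := h j
    have := h' j
    have := h'' j
    unfold uePower
    fun_prop

/-! ## Independence -/

/-- The σ-algebra generated by a set of sources of randomness. -/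
@[reducible]
def sigmaOf (N : Network Ω) (S : Set Source) : MeasurableSpace Ω := ⨆ s ∈ S, N.sigma s

lemma sigma_le_sigmaOf {S : Set Source} {s : Source} (hs : s ∈ S) : N.sigma s ≤ N.sigmaOf S :=
  le_iSup₂_of_le s hs le_rfl

lemma measurable_bsPos_sigmaOf {S : Set Source} (hs : Source.bsPos ∈ S) (j : ℕ) :
    Measurable[N.sigmaOf S] (N.bsPos j) := by
  refine Measurable.mono ?_ (sigma_le_sigmaOf hs) le_rfl
  have h : Measurable[N.sigma .bsPos] fun ω j => N.bsPos j ω := comap_measurable _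
  exact (measurable_pi_apply j).comp h

lemma measurable_uePos_sigmaOf {S : Set Source} (hs : Source.uePos ∈ S) (j : ℕ) :
    Measurable[N.sigmaOf S] (N.uePos j) := by
  refine Measurable.mono ?_ (sigma_le_sigmaOf hs) le_rfl
  have h : Measurable[N.sigma .uePos] fun ω j => N.uePos j ω := comap_measurable _
  exact (measurable_pi_apply j).comp h

lemma measurable_sigmaOf_of_comap {S : Set Source} {s : Source} (hs : s ∈ S) {f : Ω → ℝ}
    (h : N.sigma s = MeasurableSpace.comap f inferInstance) : Measurable[N.sigmaOf S] f :=
  Measurable.mono (h ▸ comap_measurable f) (sigma_le_sigmaOf hs) le_rfl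

variable [MeasurableSpace Ω] {P : Measure Ω} {p : Params}

lemma IsModel.measurable_bsPos (hN : N.IsModel p P) (j : ℕ) : Measurable (N.bsPos j) :=
  hN.bs_poisson.measurable j

lemma IsModel.measurable_uePos (hN : N.IsModel p P) (j : ℕ) : Measurable (N.uePos j) :=
  hN.ue_poisson.measurable j

lemma IsModel.sigma_le (hN : N.IsModel p P) (s : Source) : N.sigma s ≤ ‹MeasurableSpace Ω› := by
  cases s with
  | bsPos => exact (measurable_pi_lambda _ hN.measurable_bsPos).comap_le
  | uePos => exact (measurable_pi_lambda _ hN.measurable_uePos).comap_le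
  | bsGain j => exact (hN.measurable_bsGain j).comap_le
  | ueGain j => exact (hN.measurable_ueGain j).comap_le
  | ueDist j => exact (hN.measurable_ueDist j).comap_le
  | desiredGain => exact hN.measurable_desiredGain.comap_le
  | siGain => exact hN.measurable_siGain.comap_le
  | ulDist => exact hN.measurable_ulDist.comap_le
  | mateDist => exact hN.measurable_mateDist.comap_le
  | mateAngle => exact hN.measurable_mateAngle.comap_le
  | mateGain => exact hN.measurable_mateGain.comap_le

/-- Reduces every later independence claim to bookkeeping: two variables are independent once they
are measurable for disjoint sets of sources. -/
lemma IsModel.indepFun_sources (hN : N.IsModel p P) {α β : Type*} [MeasurableSpace α]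
    [MeasurableSpace β] (S T : Set Source) (hST : Disjoint S T) {Y : Ω → α} {Z : Ω → β}
    (hY : Measurable[N.sigmaOf S] Y) (hZ : Measurable[N.sigmaOf T] Z) : IndepFun Y Z P :=
  (IndepFun_iff_Indep Y Z P).2 <| indep_of_indep_of_le_left
    (indep_of_indep_of_le_right (indep_iSup_of_disjoint hN.sigma_le hN.indep hST) hZ.comap_le)
    hY.comap_le

lemma IsModel.indepFun_bsMarks (hN : N.IsModel p P) (n : ℕ) :
    IndepFun (fun ω => ((fun j => N.bsPos j ω), fun i : Fin n => N.bsGain i ω)) (N.bsGain n) P := by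
  refine hN.indepFun_sources ({.bsPos} ∪ {s | ∃ i < n, s = .bsGain i}) {.bsGain n} ?_ ?_ ?_
  · simp
  · refine Measurable.prodMk (measurable_pi fun j => measurable_bsPos_sigmaOf (by simp) j)
      (measurable_pi fun i => measurable_sigmaOf_of_comap (s := .bsGain i) ?_ rfl)
    simp
  · exact measurable_sigmaOf_of_comap (mem_singleton _) rfl

lemma IsModel.indepFun_ueMarks (hN : N.IsModel p P) (n : ℕ) :
    IndepFun (fun ω => ((fun j => N.uePos j ω), fun i : Fin n => (N.ueDist i ω, N.ueGain i ω)))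
      (fun ω => (N.ueDist n ω, N.ueGain n ω)) P := by
  refine hN.indepFun_sources ({.uePos} ∪ {s | ∃ i < n, s = .ueDist i ∨ s = .ueGain i})
    {.ueDist n, .ueGain n} ?_ ?_ ?_
  · simp
  · refine Measurable.prodMk (measurable_pi fun j => measurable_uePos_sigmaOf (by simp) j)
      (measurable_pi fun i => Measurable.prodMk
        (measurable_sigmaOf_of_comap (s := .ueDist i) ?_ rfl)
        (measurable_sigmaOf_of_comap (s := .ueGain i) ?_ rfl)) <;> simp
  · exact Measurable.prodMk (measurable_sigmaOf_of_comap (s := .ueDist n) (by simp) rfl)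
      (measurable_sigmaOf_of_comap (s := .ueGain n) (by simp) rfl)

lemma IsModel.map_ueMark [IsProbabilityMeasure P] (hN : N.IsModel p P) (n : ℕ) :
    P.map (fun ω => (N.ueDist n ω, N.ueGain n ω)) = (N.linkDistLaw p P).prod (expMeasure 1) := by
  have h : IndepFun (N.ueDist n) (N.ueGain n) P :=
    hN.indepFun_sources {.ueDist n} {.ueGain n} (by simp)
      (measurable_sigmaOf_of_comap (mem_singleton _) rfl)
      (measurable_sigmaOf_of_comap (mem_singleton _) rfl)
  rw [(indepFun_iff_map_prod_eq_prod_map_map (hN.measurable_ueDist n).aemeasurable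
    (hN.measurable_ueGain n).aemeasurable).1 h, hN.law_ueDist, hN.law_ueGain]

end Network

/-! ### Empty discs, the far field and the law of the contact distance. -/

lemma one_sub_ofReal_one_div_one_add {u : ℝ} (hu : 0 ≤ u) :
    1 - ENNReal.ofReal (1 / (1 + u)) = ENNReal.ofReal (u / (1 + u)) := by
  rw [← ENNReal.ofReal_one, ← ENNReal.ofReal_sub _ (by positivity)]
  congr 1
  field_simp
  ring

instance (l : ℝ) : SigmaFinite (ENNReal.ofReal l • (volume : Measure Plane)) :=
  inferInstanceAs (SigmaFinite (l.toNNReal • (volume : Measure Plane)))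

lemma lintegral_ofReal_lam_smul {f : Plane → ℝ≥0∞} (l : ℝ) :
    ∫⁻ x, f x ∂(ENNReal.ofReal l • (volume : Measure Plane)) =
      ENNReal.ofReal l * ∫⁻ x, f x := by
  rw [lintegral_smul_measure, smul_eq_mul]

namespace Network

variable {Ω : Type*} {N : Network Ω} [MeasurableSpace Ω] {P : Measure Ω} [IsProbabilityMeasure P]
  {p : Params}

instance : IsProbabilityMeasure (expMeasure 1) := isProbabilityMeasure_expMeasure one_pos

/-- Received power from the base stations at distance at least `b`. -/
def farSum (N : Network Ω) (p : Params) (b : ℝ) (ω : Ω) : ℝ≥0∞ :=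
  ∑' j, if b ≤ ‖N.bsPos j ω‖ then
    ENNReal.ofReal (p.Pd * N.bsGain j ω * ‖N.bsPos j ω‖ ^ (-p.η)) else 0

/-- Joint Laplace transform of the void event of a disc and of the interference from outside a
larger disc. -/
lemma IsModel.lintegral_void_farSum (hN : N.IsModel p P) {a b c : ℝ} (hab : a ≤ b) (hc : 0 ≤ c) :
    ∫⁻ ω in {ω | a ≤ N.servingDist ω}, negExp (ENNReal.ofReal c * N.farSum p b ω) ∂P =
      negExp (ENNReal.ofReal p.lam * (ENNReal.ofReal a ^ 2 * ENNReal.ofReal Real.pi)) *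
      negExp (ENNReal.ofReal p.lam * ∫⁻ x in Ici b ∩ Ioi 0, ENNReal.ofReal (2 * Real.pi * x) *
        ENNReal.ofReal (c * p.Pd * x ^ (-p.η) / (1 + c * p.Pd * x ^ (-p.η)))) := by
  classical
  have hPd := p.Pd_pos
  -- The value ∞ inside the disc of radius `a` encodes the void event: a single point there makes
  -- the sum infinite and its negative exponential zero. One Laplace functional thus carries both
  -- the event and the far field.
  let H : Plane → ℝ → ℝ≥0∞ := fun x h => (if a ≤ ‖x‖ then 0 else ∞) +
    (if b ≤ ‖x‖ then ENNReal.ofReal (c * p.Pd * ‖x‖ ^ (-p.η) * h) else 0)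
  have hH : Measurable (Function.uncurry H) := by
    have h1 : MeasurableSet {z : Plane × ℝ | a ≤ ‖z.1‖} :=
      measurableSet_le measurable_const (by fun_prop)
    have h2 : MeasurableSet {z : Plane × ℝ | b ≤ ‖z.1‖} :=
      measurableSet_le measurable_const (by fun_prop)
    exact (Measurable.ite h1 measurable_const measurable_const).add
      (Measurable.ite h2 (by fun_prop) measurable_const)
  have hL : ∀ ω, {ω | a ≤ N.servingDist ω}.indicator
      (fun ω => negExp (ENNReal.ofReal c * N.farSum p b ω)) ω =
      negExp (∑' j, H (N.bsPos j ω) (N.bsGain j ω)) := by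
    intro ω
    simp only [H]
    rw [ENNReal.tsum_add]
    by_cases hω : a ≤ N.servingDist ω
    · rw [indicator_of_mem (show ω ∈ {ω | a ≤ N.servingDist ω} from hω)]
      have := le_servingDist_iff.1 hω
      simp only [this, if_true, tsum_zero, zero_add, farSum]
      rw [← ENNReal.tsum_mul_left]
      congr 1
      refine tsum_congr fun j => ?_
      split_ifs with h
      · rw [← ENNReal.ofReal_mul hc]
        congr 1
        ring
      · simp
    · rw [indicator_of_notMem (show ω ∉ {ω | a ≤ N.servingDist ω} from hω)]
      rw [le_servingDist_iff] at hω
      push Not at hω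
      obtain ⟨j, hj⟩ := hω
      have : ∑' j, (if a ≤ ‖N.bsPos j ω‖ then (0 : ℝ≥0∞) else ∞) = ∞ :=
        ENNReal.tsum_eq_top_of_eq_top ⟨j, by simp [hj]⟩
      rw [this]
      simp
  let φ : ℝ → ℝ≥0∞ := (Ici b).indicator fun x =>
    ENNReal.ofReal (c * p.Pd * x ^ (-p.η) / (1 + c * p.Pd * x ^ (-p.η)))
  have hφ : Measurable φ := Measurable.indicator (by fun_prop) measurableSet_Ici
  -- As a ≤ b, the disc and the far region are disjoint, so the intensity integral is the disc's
  -- area plus the far-field part, and its exponential factorises.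
  have hinner : ∀ x : Plane, 1 - ∫⁻ h, negExp (H x h) ∂(expMeasure 1) =
      (Metric.ball 0 a).indicator (fun _ => 1) x + φ ‖x‖ := by
    intro x
    simp only [H, negExp_add, φ]
    by_cases ha : a ≤ ‖x‖
    · have hx : x ∉ Metric.ball (0 : Plane) a := by simpa using ha
      rw [indicator_of_notMem hx]
      simp only [ha, if_true, negExp_zero, one_mul, zero_add]
      by_cases hb : b ≤ ‖x‖
      · have hu : 0 ≤ c * p.Pd * ‖x‖ ^ (-p.η) := by positivity
        simp only [hb, if_true]
        rw [lintegral_negExp_mul_expMeasure hu, one_sub_ofReal_one_div_one_add hu,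
          indicator_of_mem (mem_Ici.2 hb)]
      · simp [hb]
    · have hx : x ∈ Metric.ball (0 : Plane) a := by simpa using ha
      have hb : ¬ b ≤ ‖x‖ := fun h => ha (hab.trans h)
      rw [indicator_of_mem hx]
      simp [ha, hb]
  have hmeas : MeasurableSet {ω | a ≤ N.servingDist ω} :=
    measurableSet_le measurable_const (measurable_servingDist hN.measurable_bsPos)
  rw [← lintegral_indicator hmeas]
  simp_rw [hL]
  rw [hN.bs_poisson.lintegral_negExp_tsum_mark hN.measurable_bsGain hN.law_bsGain
    hN.indepFun_bsMarks hH, lintegral_ofReal_lam_smul]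
  simp_rw [hinner]
  rw [lintegral_add_left (measurable_const.indicator measurableSet_ball),
    lintegral_plane_radial hφ, ← negExp_add, ← mul_add]
  congr 3
  · rw [lintegral_indicator measurableSet_ball]
    simp [EuclideanSpace.volume_ball_fin_two]
  · have : ∀ x, ENNReal.ofReal (2 * Real.pi * x) * φ x = (Ici b).indicator
        (fun x => ENNReal.ofReal (2 * Real.pi * x) * ENNReal.ofReal (c * p.Pd * x ^ (-p.η) /
          (1 + c * p.Pd * x ^ (-p.η)))) x := by
      intro x
      by_cases h : x ∈ Ici b
      · simp only [φ, indicator_of_mem h]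
      · simp only [φ, indicator_of_notMem h, mul_zero]
    simp_rw [this]
    rw [setLIntegral_indicator measurableSet_Ici]

lemma IsModel.measure_void (hN : N.IsModel p P) (a : ℝ) :
    P {ω | a ≤ N.servingDist ω} =
      negExp (ENNReal.ofReal p.lam * (ENNReal.ofReal a ^ 2 * ENNReal.ofReal Real.pi)) := by
  have h := hN.lintegral_void_farSum (le_refl a) (le_refl (0 : ℝ))
  simpa only [ENNReal.ofReal_zero, zero_mul, negExp_zero, lintegral_one, zero_div, mul_zero,
    lintegral_zero, Measure.restrict_apply_univ, mul_one] using h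

/-- The tail of the contact distance. -/
lemma IsModel.measure_le_servingDist (hN : N.IsModel p P) {a : ℝ} (ha : 0 ≤ a) :
    P {ω | a ≤ N.servingDist ω} = ENNReal.ofReal (Real.exp (-(Real.pi * p.lam * a ^ 2))) := by
  have hl := p.lam_pos
  rw [hN.measure_void, ← ENNReal.ofReal_pow ha, ← ENNReal.ofReal_mul (by positivity),
    ← ENNReal.ofReal_mul hl.le, negExp_ofReal (by positivity)]
  congr 3
  ring

/-- The law of the contact distance. -/
lemma IsModel.map_servingDist (hN : N.IsModel p P) :
    P.map N.servingDist = (volume.restrict (Ioi 0)).withDensity fun r =>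
      ENNReal.ofReal (2 * Real.pi * p.lam * r * Real.exp (-(Real.pi * p.lam * r ^ 2))) := by
  have hl := p.lam_pos
  have hm := measurable_servingDist hN.measurable_bsPos
  have : IsProbabilityMeasure (P.map N.servingDist) :=
    Measure.isProbabilityMeasure_map hm.aemeasurable
  -- The density is the derivative of -exp(-πλr²), so its tail integral is the void probability. A
  -- probability law on ℝ is determined by its values on the half-lines `Ici a`.
  have key : ∀ a : ℝ, 0 ≤ a → ∫⁻ r in Ioi a,
      ENNReal.ofReal (2 * Real.pi * p.lam * r * Real.exp (-(Real.pi * p.lam * r ^ 2))) =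
      ENNReal.ofReal (Real.exp (-(Real.pi * p.lam * a ^ 2))) := by
    intro a ha
    have hder : ∀ x ∈ Ici a, HasDerivAt (fun r => -Real.exp (-(Real.pi * p.lam * r ^ 2)))
        (2 * Real.pi * p.lam * x * Real.exp (-(Real.pi * p.lam * x ^ 2))) x := by
      intro x _
      have h1 : HasDerivAt (fun r => -(Real.pi * p.lam * r ^ 2)) (-(Real.pi * p.lam * (2 * x))) x := by
        have h2 := ((hasDerivAt_pow 2 x).const_mul (Real.pi * p.lam)).fun_neg
        refine h2.congr_deriv ?_
        simp
      refine h1.exp.fun_neg.congr_deriv ?_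
      ring
    have hpos : ∀ x ∈ Ioi a,
        0 ≤ 2 * Real.pi * p.lam * x * Real.exp (-(Real.pi * p.lam * x ^ 2)) := by
      intro x hx
      have : 0 ≤ x := ha.trans (le_of_lt hx)
      positivity
    have hlim : Tendsto (fun r => -Real.exp (-(Real.pi * p.lam * r ^ 2))) atTop (𝓝 0) := by
      rw [← neg_zero]
      refine (Real.tendsto_exp_neg_atTop_nhds_zero.comp ?_).neg
      exact (tendsto_pow_atTop two_ne_zero).const_mul_atTop (by positivity)
    rw [← ofReal_integral_eq_lintegral_ofReal
      (integrableOn_Ioi_deriv_of_nonneg' hder hpos hlim)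
      ((ae_restrict_iff' measurableSet_Ioi).2 (ae_of_all _ hpos)),
      integral_Ioi_of_hasDerivAt_of_nonneg' hder hpos hlim]
    simp
  have hneg : ∀ a : ℝ, a ≤ 0 → P.map N.servingDist (Ici a) = 1 := by
    intro a ha
    rw [Measure.map_apply hm measurableSet_Ici, ← measure_univ (μ := P)]
    congr 1
    ext ω
    simpa using ha.trans (servingDist_nonneg ω)
  refine Measure.ext_of_Ici _ _ fun a => ?_
  rw [withDensity_apply _ measurableSet_Ici, Measure.restrict_restrict measurableSet_Ici]
  rcases le_or_gt a 0 with ha | ha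
  · rw [hneg a ha, inter_eq_right.2 (Ioi_subset_Ici ha), key 0 le_rfl]
    simp
  · rw [inter_eq_left.2 (Ici_subset_Ioi.2 ha), ← restrict_Ioi_eq_restrict_Ici, key a ha.le,
      Measure.map_apply hm measurableSet_Ici]
    exact hN.measure_le_servingDist ha.le

lemma IsModel.lintegral_servingDist (hN : N.IsModel p P) {f : ℝ → ℝ≥0∞} (hf : Measurable f) :
    ∫⁻ ω, f (N.servingDist ω) ∂P = ∫⁻ r in Ioi (0 : ℝ),
      ENNReal.ofReal (2 * Real.pi * p.lam * r * Real.exp (-(Real.pi * p.lam * r ^ 2))) * f r := by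
  rw [← lintegral_map hf (measurable_servingDist hN.measurable_bsPos), hN.map_servingDist,
    lintegral_withDensity_eq_lintegral_mul _ (by fun_prop) hf]
  rfl

lemma IsModel.ae_servingDist_pos (hN : N.IsModel p P) : ∀ᵐ ω ∂P, 0 < N.servingDist ω := by
  have hm := measurable_servingDist hN.measurable_bsPos
  have h : ∀ᵐ r ∂(P.map N.servingDist), 0 < r := by
    rw [hN.map_servingDist]
    exact (withDensity_absolutelyContinuous _ _).ae_le (ae_restrict_mem measurableSet_Ioi)
  exact ae_of_ae_map hm.aemeasurable h

end Network

/-! ### Dyadic discretisation of the serving distance. -/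

/-- The right end of the dyadic interval of order `n` and index `k`. -/
def dyadicEnd (n k : ℕ) : ℝ := (k + 1) / 2 ^ n

/-- The index of the dyadic interval of order `n` that contains `r`. -/
def dyadicIndex (n : ℕ) (r : ℝ) : ℕ := ⌊r * 2 ^ n⌋₊

lemma measurable_dyadicIndex (n : ℕ) : Measurable (dyadicIndex n) :=
  Nat.measurable_floor.comp (by fun_prop)

lemma dyadicEnd_pos (n k : ℕ) : 0 < dyadicEnd n k := by unfold dyadicEnd; positivity

lemma dyadicIndex_eq_iff {n k : ℕ} {r : ℝ} (hr : 0 ≤ r) :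
    dyadicIndex n r = k ↔ (k : ℝ) / 2 ^ n ≤ r ∧ r < dyadicEnd n k := by
  unfold dyadicIndex dyadicEnd
  rw [Nat.floor_eq_iff (by positivity), div_le_iff₀ (by positivity), lt_div_iff₀ (by positivity)]

lemma tendsto_dyadicEnd {r : ℝ} (hr : 0 ≤ r) :
    Tendsto (fun n => dyadicEnd n (dyadicIndex n r)) atTop (𝓝 r) := by
  have h0 : Tendsto (fun n : ℕ => r + (1 / 2 : ℝ) ^ n) atTop (𝓝 (r + 0)) :=
    tendsto_const_nhds.add (tendsto_pow_atTop_nhds_zero_of_lt_one (by norm_num) (by norm_num))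
  rw [add_zero] at h0
  refine tendsto_of_tendsto_of_tendsto_of_le_of_le tendsto_const_nhds h0 (fun n => ?_) fun n => ?_
  · exact ((dyadicIndex_eq_iff hr).1 rfl).2.le
  · have := ((dyadicIndex_eq_iff (n := n) hr).1 rfl).1
    simp only [dyadicEnd, add_div, one_div, inv_pow] at this ⊢
    linarith

lemma tendsto_dyadicStart {r : ℝ} (hr : 0 ≤ r) :
    Tendsto (fun n => (dyadicIndex n r : ℝ) / 2 ^ n) atTop (𝓝 r) := by
  have h0 : Tendsto (fun n : ℕ => dyadicEnd n (dyadicIndex n r) - (1 / 2 : ℝ) ^ n) atTop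
      (𝓝 (r - 0)) := (tendsto_dyadicEnd hr).sub
        (tendsto_pow_atTop_nhds_zero_of_lt_one (by norm_num) (by norm_num))
  rw [sub_zero] at h0
  refine h0.congr fun n => ?_
  simp only [dyadicEnd, add_div, one_div, inv_pow]
  ring

namespace Network

variable {Ω : Type*} {N : Network Ω} {p : Params}

/-- A station strictly farther than the serving one lies beyond the right dyadic end once the grid
is fine enough, and one that is not never does. Restricting to strictly larger norms therefore gives
exactly the limit. -/
lemma tendsto_farSum_dyadicEnd (ω : Ω) :
    Tendsto (fun n => N.farSum p (dyadicEnd n (dyadicIndex n (N.servingDist ω))) ω) atTop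
      (𝓝 (N.bsSum p {j | N.servingDist ω < ‖N.bsPos j ω‖} ω)) := by
  classical
  have hr := servingDist_nonneg (N := N) ω
  set r := N.servingDist ω
  rw [bsSum_eq_tsum_ite]
  unfold farSum
  simp_rw [← lintegral_count]
  have hlim : ∀ j, Tendsto (fun n => if dyadicEnd n (dyadicIndex n r) ≤ ‖N.bsPos j ω‖ then
      ENNReal.ofReal (p.Pd * N.bsGain j ω * ‖N.bsPos j ω‖ ^ (-p.η)) else 0) atTop
      (𝓝 (if j ∈ {j | r < ‖N.bsPos j ω‖} then
        ENNReal.ofReal (p.Pd * N.bsGain j ω * ‖N.bsPos j ω‖ ^ (-p.η)) else 0)) := by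
    intro j
    by_cases h : r < ‖N.bsPos j ω‖
    · refine tendsto_const_nhds.congr' ?_
      filter_upwards [(tendsto_dyadicEnd hr).eventually_le_const h] with n hn
      simp [h, hn]
    · refine tendsto_const_nhds.congr fun n => ?_
      have : ¬ dyadicEnd n (dyadicIndex n r) ≤ ‖N.bsPos j ω‖ := fun h' =>
        h (((dyadicIndex_eq_iff hr).1 rfl).2.trans_le h')
      simp [h, this]
  -- Fatou's lemma gives the lower bound. For the upper bound each approximating sum is termwise at
  -- most the limit; this needs no finiteness of the interference.
  refine tendsto_of_le_liminf_of_limsup_le ?_ ?_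
  · refine le_trans (lintegral_mono fun j => ?_) (lintegral_liminf_le fun n => measurable_of_countable _)
    exact (hlim j).liminf_eq.ge
  · refine limsup_le_of_le (h := Eventually.of_forall fun n => lintegral_mono fun j => ?_)
    by_cases h : dyadicEnd n (dyadicIndex n r) ≤ ‖N.bsPos j ω‖
    · have : r < ‖N.bsPos j ω‖ := ((dyadicIndex_eq_iff hr).1 rfl).2.trans_le h
      simp [h, this]
    · simp [h]

variable [MeasurableSpace Ω] {P : Measure Ω}

/-- The exponent of the Laplace transform of the interference from the non-serving base
stations. -/
def servingExponent (p : Params) (g : ℝ) : ℝ :=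
  2 * Real.pi * p.lam / (p.η - 2) * g * p.F (-g)

lemma measurable_farSum (hN : N.IsModel p P) (b : ℝ) : Measurable (N.farSum p b) := by
  refine Measurable.tsum fun j => Measurable.ite ?_ ?_ measurable_const
  · exact measurableSet_le measurable_const (hN.measurable_bsPos j).norm
  · have := hN.measurable_bsPos j
    have := hN.measurable_bsGain j
    fun_prop

variable [IsProbabilityMeasure P]

/-- The event is {a ≤ R} minus {b ≤ R}. On both of these the void probability factorises from the
same field beyond b, so their difference inherits the factorisation. -/
lemma IsModel.setLIntegral_dyadic_farSum (hN : N.IsModel p P) {g : ℝ} (hg : 0 < g) (n k : ℕ) :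
    ∫⁻ ω in {ω | dyadicIndex n (N.servingDist ω) = k},
      negExp (ENNReal.ofReal (g * dyadicEnd n k ^ p.η / p.Pd) * N.farSum p (dyadicEnd n k) ω) ∂P =
    ENNReal.ofReal (Real.exp (-(servingExponent p g * dyadicEnd n k ^ 2))) *
      P {ω | dyadicIndex n (N.servingDist ω) = k} := by
  have hPd := p.Pd_pos
  have hl := p.lam_pos
  have hη := p.two_lt_η
  have hη2 : 0 < p.η - 2 := by linarith
  set b := dyadicEnd n k with hb_def
  have hb : 0 < b := dyadicEnd_pos n k
  set a : ℝ := (k : ℝ) / 2 ^ n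
  have hab : a ≤ b := by
    simp only [a, b, dyadicEnd]
    gcongr
    linarith
  have hm := measurable_servingDist hN.measurable_bsPos
  have hF : 0 ≤ p.F (-g) := hyp2F1_pathLoss_nonneg hη hg.le
  -- With this argument a station at distance b has mean exponent g, so the far-field factor is
  -- exp(-κ b²) with κ depending on g alone.
  set c := g * b ^ p.η / p.Pd with hc_def
  have hc : 0 ≤ c := by positivity
  have hM : negExp (ENNReal.ofReal p.lam * ∫⁻ x in Ici b ∩ Ioi 0, ENNReal.ofReal (2 * Real.pi * x) *
        ENNReal.ofReal (c * p.Pd * x ^ (-p.η) / (1 + c * p.Pd * x ^ (-p.η)))) =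
      ENNReal.ofReal (Real.exp (-(servingExponent p g * b ^ 2))) := by
    have e1 : c * p.Pd = g * b ^ p.η := by rw [hc_def]; field_simp
    have e2 : g * b ^ p.η * b ^ (-p.η) = g := by
      rw [mul_assoc, ← Real.rpow_add hb]; simp
    have e3 : b ^ (2 - p.η) * (g * b ^ p.η) = g * b ^ 2 := by
      rw [mul_left_comm, ← Real.rpow_add hb]; simp
    rw [inter_eq_left.2 (Ici_subset_Ioi.2 hb), ← restrict_Ioi_eq_restrict_Ici,
      lintegral_pathLoss_Ioi hη hb (by positivity), e1, e2, ← ENNReal.ofReal_mul hl.le,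
      mul_assoc (2 * Real.pi / (p.η - 2)), e3]
    change negExp (ENNReal.ofReal (p.lam * (2 * Real.pi / (p.η - 2) * (g * b ^ 2) * p.F (-g)))) = _
    rw [negExp_ofReal (by positivity)]
    congr 3
    unfold servingExponent
    ring
  have hset : {ω | dyadicIndex n (N.servingDist ω) = k} =
      {ω | a ≤ N.servingDist ω} \ {ω | b ≤ N.servingDist ω} := by
    ext ω
    simp only [mem_ofPred_eq, Set.mem_sdiff, not_le]
    exact dyadicIndex_eq_iff (servingDist_nonneg ω)
  have hinter : {ω | a ≤ N.servingDist ω} ∩ {ω | b ≤ N.servingDist ω} =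
      {ω | b ≤ N.servingDist ω} := inter_eq_right.2 fun ω h => hab.trans h
  have hB : MeasurableSet {ω | b ≤ N.servingDist ω} := measurableSet_le measurable_const hm
  have h1 := lintegral_inter_add_sdiff (μ := P)
    (fun ω => negExp (ENNReal.ofReal c * N.farSum p b ω)) {ω | a ≤ N.servingDist ω} hB
  have h2 := measure_inter_add_sdiff (μ := P) {ω | a ≤ N.servingDist ω} hB
  rw [hinter, hN.lintegral_void_farSum hab hc, hN.lintegral_void_farSum le_rfl hc, hM,
    ← hN.measure_void, ← hN.measure_void, ← h2, hinter, add_mul] at h1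
  rw [hset, mul_comm]
  -- Subtraction in [0, ∞] is a cancellation, legitimate because the common term is finite.
  exact (ENNReal.add_right_inj (ENNReal.mul_ne_top (measure_ne_top _ _) ENNReal.ofReal_ne_top)).1 h1

lemma IsModel.lintegral_dyadic_farSum (hN : N.IsModel p P) {g : ℝ} (hg : 0 < g) (n : ℕ)
    (φ : ℕ → ℝ≥0∞) :
    ∫⁻ ω, φ (dyadicIndex n (N.servingDist ω)) *
      negExp (ENNReal.ofReal (g * dyadicEnd n (dyadicIndex n (N.servingDist ω)) ^ p.η / p.Pd) *
        N.farSum p (dyadicEnd n (dyadicIndex n (N.servingDist ω))) ω) ∂P =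
    ∫⁻ ω, φ (dyadicIndex n (N.servingDist ω)) * ENNReal.ofReal (Real.exp
      (-(servingExponent p g * dyadicEnd n (dyadicIndex n (N.servingDist ω)) ^ 2))) ∂P := by
  have hm := (measurable_dyadicIndex n).comp (measurable_servingDist hN.measurable_bsPos)
  let S : ℕ → Set Ω := fun k => {ω | dyadicIndex n (N.servingDist ω) = k}
  have hS : ∀ k, MeasurableSet (S k) := fun k => hm (measurableSet_singleton k)
  have hSd : Pairwise (Function.onFun Disjoint S) := by
    intro i j hij
    rw [Function.onFun, Set.disjoint_left]
    exact fun ω hi hj => hij (hi.symm.trans hj)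
  have hSu : ⋃ k, S k = univ := by
    ext ω
    simp [S]
  rw [← setLIntegral_univ, ← hSu, lintegral_iUnion hS hSd, ← setLIntegral_univ (μ := P), ← hSu,
    lintegral_iUnion hS hSd]
  refine tsum_congr fun k => ?_
  have e1 := setLIntegral_congr_fun (μ := P) (hS k) (f := fun ω =>
      φ (dyadicIndex n (N.servingDist ω)) *
      negExp (ENNReal.ofReal (g * dyadicEnd n (dyadicIndex n (N.servingDist ω)) ^ p.η / p.Pd) *
        N.farSum p (dyadicEnd n (dyadicIndex n (N.servingDist ω))) ω))
      (g := fun ω => φ k * negExp (ENNReal.ofReal (g * dyadicEnd n k ^ p.η / p.Pd) *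
        N.farSum p (dyadicEnd n k) ω)) fun ω hω => by
          have : dyadicIndex n (N.servingDist ω) = k := hω
          simp only [this]
  have e2 := setLIntegral_congr_fun (μ := P) (hS k) (f := fun ω =>
      φ (dyadicIndex n (N.servingDist ω)) * ENNReal.ofReal (Real.exp
        (-(servingExponent p g * dyadicEnd n (dyadicIndex n (N.servingDist ω)) ^ 2))))
      (g := fun _ => φ k * ENNReal.ofReal (Real.exp
        (-(servingExponent p g * dyadicEnd n k ^ 2)))) fun ω hω => by
          have : dyadicIndex n (N.servingDist ω) = k := hω
          simp only [this]
  have hmf : Measurable fun ω => negExp (ENNReal.ofReal (g * dyadicEnd n k ^ p.η / p.Pd) *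
      N.farSum p (dyadicEnd n k) ω) :=
    measurable_negExp.comp ((measurable_farSum hN _).const_mul _)
  rw [e1, e2, lintegral_const_mul _ hmf, hN.setLIntegral_dyadic_farSum hg, setLIntegral_const,
    mul_assoc]

/-- The conditional Laplace transform, given the distance to the nearest base station, of the
interference from all other base stations. -/
theorem IsModel.lintegral_negExp_bsSum_serving (hN : N.IsModel p P) {g : ℝ} (hg : 0 < g)
    {f : ℝ → ℝ≥0∞} (hf : Measurable f) :
    ∫⁻ ω, f (N.servingDist ω) * negExp (ENNReal.ofReal (g * N.servingDist ω ^ p.η / p.Pd) *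
      N.bsSum p {j | N.servingDist ω < ‖N.bsPos j ω‖} ω) ∂P =
    ∫⁻ ω, f (N.servingDist ω) *
      ENNReal.ofReal (Real.exp (-(servingExponent p g * N.servingDist ω ^ 2))) ∂P := by
  have hPd := p.Pd_pos
  have hl := p.lam_pos
  have hη := p.two_lt_η
  have hη2 : 0 < p.η - 2 := by linarith
  have hF : 0 ≤ p.F (-g) := hyp2F1_pathLoss_nonneg hη hg.le
  have hκ : 0 ≤ servingExponent p g := by unfold servingExponent; positivity
  have hm := measurable_servingDist hN.measurable_bsPos
  let G : Ω → ℝ≥0∞ := fun ω => negExp (ENNReal.ofReal (g * N.servingDist ω ^ p.η / p.Pd) *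
      N.bsSum p {j | N.servingDist ω < ‖N.bsPos j ω‖} ω)
  have hG : Measurable G := measurable_negExp.comp (Measurable.mul (by fun_prop)
    (measurable_bsSum_serving p hN.measurable_bsPos hN.measurable_bsGain))
  let L : Ω → ℝ≥0∞ := fun ω =>
    ENNReal.ofReal (Real.exp (-(servingExponent p g * N.servingDist ω ^ 2)))
  have hL : Measurable L := by fun_prop
  have hL1 : ∀ x : ℝ, ENNReal.ofReal (Real.exp (-(servingExponent p g * x ^ 2))) ≤ 1 := by
    intro x
    rw [← ENNReal.ofReal_one]
    refine ENNReal.ofReal_le_ofReal (Real.exp_le_one_iff.2 ?_)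
    have : 0 ≤ servingExponent p g * x ^ 2 := by positivity
    linarith
  -- Testing on the events {R ≤ A} suffices: below, the images under R of the measures with
  -- densities `G` and `L` agree on half-lines, hence everywhere.
  have key : ∀ A : ℝ, ∫⁻ ω in {ω | N.servingDist ω ≤ A}, G ω ∂P =
      ∫⁻ ω in {ω | N.servingDist ω ≤ A}, L ω ∂P := by
    intro A
    -- The left dyadic end never exceeds R and converges to it, so this indicator tends to that of
    -- {R ≤ A} at every point, including R = A.
    let φ : ℕ → ℕ → ℝ≥0∞ := fun n k => if (k : ℝ) / 2 ^ n ≤ A then 1 else 0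
    have hφ1 : ∀ n k, φ n k ≤ 1 := by
      intro n k
      simp only [φ]
      split_ifs <;> simp
    have hφlim : ∀ ω, Tendsto (fun n => φ n (dyadicIndex n (N.servingDist ω))) atTop
        (𝓝 ({ω | N.servingDist ω ≤ A}.indicator 1 ω)) := by
      intro ω
      have hr := servingDist_nonneg (N := N) ω
      by_cases h : N.servingDist ω ≤ A
      · refine tendsto_const_nhds.congr fun n => ?_
        have := ((dyadicIndex_eq_iff (n := n) hr).1 rfl).1.trans h
        simp [φ, h, this]
      · refine tendsto_const_nhds.congr' ?_
        filter_upwards [(tendsto_dyadicStart hr).eventually_const_lt (not_le.1 h)] with n hn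
        simp [φ, h, hn]
    have hA : MeasurableSet {ω | N.servingDist ω ≤ A} := measurableSet_le hm measurable_const
    have hmi : ∀ n, Measurable fun ω => dyadicIndex n (N.servingDist ω) := fun n =>
      (measurable_dyadicIndex n).comp hm
    have hmφ : ∀ n, Measurable fun ω => φ n (dyadicIndex n (N.servingDist ω)) := fun n =>
      (measurable_from_top (f := φ n)).comp (hmi n)
    have hmb : ∀ n, Measurable fun ω => dyadicEnd n (dyadicIndex n (N.servingDist ω)) := fun n =>
      (measurable_from_top (f := dyadicEnd n)).comp (hmi n)
    have hmfar : ∀ n, Measurable fun ω =>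
        N.farSum p (dyadicEnd n (dyadicIndex n (N.servingDist ω))) ω := by
      intro n
      refine Measurable.tsum fun j => Measurable.ite ?_ ?_ measurable_const
      · exact measurableSet_le (hmb n) (hN.measurable_bsPos j).norm
      · have := hN.measurable_bsPos j
        have := hN.measurable_bsGain j
        fun_prop
    have h1 : Tendsto (fun n => ∫⁻ ω, φ n (dyadicIndex n (N.servingDist ω)) *
        negExp (ENNReal.ofReal (g * dyadicEnd n (dyadicIndex n (N.servingDist ω)) ^ p.η / p.Pd) *
          N.farSum p (dyadicEnd n (dyadicIndex n (N.servingDist ω))) ω) ∂P) atTop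
        (𝓝 (∫⁻ ω, {ω | N.servingDist ω ≤ A}.indicator 1 ω * G ω ∂P)) := by
      refine tendsto_lintegral_of_dominated_convergence (fun _ => 1) (fun n => ?_)
        (fun n => ae_of_all _ fun ω => mul_le_one' (hφ1 _ _) (negExp_le_one _)) (by simp) ?_
      · refine (hmφ n).mul (measurable_negExp.comp (Measurable.mul ?_ (hmfar n)))
        have := hmb n
        fun_prop
      -- Positivity of R keeps the limiting coefficient away from 0. Multiplication in [0, ∞] is not
      -- continuous at (0, ∞), and the interference is not known to be finite.
      · filter_upwards [hN.ae_servingDist_pos] with ω hω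
        have hc : Tendsto (fun n => ENNReal.ofReal
            (g * dyadicEnd n (dyadicIndex n (N.servingDist ω)) ^ p.η / p.Pd)) atTop
            (𝓝 (ENNReal.ofReal (g * N.servingDist ω ^ p.η / p.Pd))) := by
          refine ENNReal.tendsto_ofReal ?_
          refine (Tendsto.const_mul g ?_).div_const _
          exact (tendsto_dyadicEnd hω.le).rpow_const (Or.inl hω.ne')
        refine ENNReal.Tendsto.mul (hφlim ω)
          (Or.inr (negExp_ne_top _)) ((continuous_negExp.tendsto _).comp
          (ENNReal.Tendsto.mul hc (Or.inl ?_) (tendsto_farSum_dyadicEnd ω)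
            (Or.inr ENNReal.ofReal_ne_top))) (Or.inr ?_)
        · exact (ENNReal.ofReal_pos.2 (by positivity)).ne'
        · simp only [indicator]
          split_ifs <;> simp
    have h2 : Tendsto (fun n => ∫⁻ ω, φ n (dyadicIndex n (N.servingDist ω)) *
        ENNReal.ofReal (Real.exp (-(servingExponent p g *
          dyadicEnd n (dyadicIndex n (N.servingDist ω)) ^ 2))) ∂P) atTop
        (𝓝 (∫⁻ ω, {ω | N.servingDist ω ≤ A}.indicator 1 ω * L ω ∂P)) := by
      refine tendsto_lintegral_of_dominated_convergence (fun _ => 1) (fun n => ?_)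
        (fun n => ae_of_all _ fun ω => mul_le_one' (hφ1 _ _) (hL1 _)) (by simp)
        (ae_of_all _ fun ω => ?_)
      · refine (hmφ n).mul ?_
        have := hmb n
        fun_prop
      · refine ENNReal.Tendsto.mul (hφlim ω) (Or.inr ENNReal.ofReal_ne_top) ?_ (Or.inr ?_)
        · refine ENNReal.tendsto_ofReal ((Real.continuous_exp.tendsto _).comp ?_)
          exact (((tendsto_dyadicEnd (servingDist_nonneg ω)).pow 2).const_mul _).neg
        · simp only [indicator]
          split_ifs <;> simp
    simp_rw [fun n => hN.lintegral_dyadic_farSum hg n (φ n)] at h1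
    have h3 := tendsto_nhds_unique h1 h2
    have e : ∀ (u : Ω → ℝ≥0∞), ∫⁻ ω, {ω | N.servingDist ω ≤ A}.indicator 1 ω * u ω ∂P =
        ∫⁻ ω in {ω | N.servingDist ω ≤ A}, u ω ∂P := by
      intro u
      rw [← lintegral_indicator hA]
      refine lintegral_congr fun ω => ?_
      by_cases h : ω ∈ {ω | N.servingDist ω ≤ A}
      · simp only [indicator_of_mem h, Pi.one_apply, one_mul]
      · simp only [indicator_of_notMem h, zero_mul]
    rw [e, e] at h3
    exact h3
  have hGfin : ∫⁻ ω, G ω ∂P ≠ ∞ := by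
    refine ((lintegral_mono fun ω => negExp_le_one _).trans_lt (b := ∫⁻ _, 1 ∂P) ?_).ne
    simp
  have hmeas : (P.withDensity G).map N.servingDist = (P.withDensity L).map N.servingDist := by
    have : IsFiniteMeasure (P.withDensity G) := isFiniteMeasure_withDensity hGfin
    refine Measure.ext_of_Iic _ _ fun A => ?_
    have hA : MeasurableSet {ω | N.servingDist ω ≤ A} := measurableSet_le hm measurable_const
    have e : N.servingDist ⁻¹' Iic A = {ω | N.servingDist ω ≤ A} := rfl
    rw [Measure.map_apply hm measurableSet_Iic, Measure.map_apply hm measurableSet_Iic, e,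
      withDensity_apply _ hA, withDensity_apply _ hA, key A]
  have h := congrArg (fun μ => ∫⁻ x, f x ∂μ) hmeas
  simp only [lintegral_map hf hm] at h
  have hfm : Measurable fun ω => f (N.servingDist ω) := hf.comp hm
  rw [lintegral_withDensity_eq_lintegral_mul _ hG hfm,
    lintegral_withDensity_eq_lintegral_mul _ hL hfm] at h
  simp only [Pi.mul_apply, mul_comm (G _), mul_comm (L _)] at h
  exact h

end Network

/-! ### The truncated link-distance law and the remaining Poisson factors. -/

namespace Params

variable (p : Params)

lemma RM_pos : 0 < p.RM := Real.rpow_pos_of_pos (div_pos p.PuMax_pos p.ρ_pos) _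

lemma truncation_pos : 0 < 1 - Real.exp (-(Real.pi * p.lam * p.RM ^ 2)) := by
  have hl := p.lam_pos
  have hR := p.RM_pos
  rw [sub_pos, Real.exp_lt_one_iff]
  have : 0 < Real.pi * p.lam * p.RM ^ 2 := by positivity
  linarith

lemma fR_nonneg {r : ℝ} (hr : 0 ≤ r) : 0 ≤ p.fR r := by
  have hl := p.lam_pos
  have := p.truncation_pos
  unfold fR
  positivity

@[fun_prop]
lemma continuous_fR : Continuous p.fR := by
  unfold fR
  fun_prop

lemma uePower_le_iff {r : ℝ} (hr : 0 ≤ r) : p.ρ * r ^ p.η ≤ p.PuMax ↔ r ≤ p.RM := by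
  have hη : 0 < p.η := by linarith [p.two_lt_η]
  have hρ := p.ρ_pos
  have hP := p.PuMax_pos
  unfold RM
  rw [one_div, Real.le_rpow_inv_iff_of_pos hr (by positivity) hη, le_div_iff₀ hρ, mul_comm]

/-- The substitution t = πλr². Up to ρ^(2/η), the moment of the transmit power is the second moment
of the link distance. -/
lemma integral_fR_mul_sq :
    ∫ r in (0 : ℝ)..p.RM, p.fR r * r ^ 2 =
      lowerGamma 2 (Real.pi * p.lam * p.RM ^ 2) /
        (Real.pi * p.lam * (1 - Real.exp (-(Real.pi * p.lam * p.RM ^ 2)))) := by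
  have hl := p.lam_pos
  have ht := p.truncation_pos
  have h := intervalIntegral.integral_comp_mul_deriv (a := 0) (b := p.RM)
    (f := fun r => Real.pi * p.lam * r ^ 2) (f' := fun r => Real.pi * p.lam * (2 * r))
    (g := fun t => t ^ ((2 : ℝ) - 1) * Real.exp (-t))
    (fun x _ => by simpa using (hasDerivAt_pow 2 x).const_mul (Real.pi * p.lam))
    (by fun_prop)
    (by
      have : (2 : ℝ) - 1 = 1 := by norm_num
      simp only [this, Real.rpow_one]
      fun_prop)
  unfold lowerGamma
  rw [show Real.pi * p.lam * 0 ^ 2 = 0 by simp] at h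
  rw [← h, ← intervalIntegral.integral_div]
  refine intervalIntegral.integral_congr fun r _ => ?_
  have : (2 : ℝ) - 1 = 1 := by norm_num
  simp only [fR, Function.comp, this, Real.rpow_one]
  field_simp

end Params

namespace Network

variable {Ω : Type*} {N : Network Ω} {p : Params}

lemma mem_active_iff {ω : Ω} : ω ∈ N.active p ↔ N.servingDist ω ≤ p.RM :=
  p.uePower_le_iff (servingDist_nonneg ω)

variable [MeasurableSpace Ω] {P : Measure Ω}

lemma lintegral_cond_active (F : Ω → ℝ≥0∞) :
    ∫⁻ ω, F ω ∂(cond P (N.active p)) = (P (N.active p))⁻¹ * ∫⁻ ω in N.active p, F ω ∂P := by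
  rw [ProbabilityTheory.cond, lintegral_smul_measure, smul_eq_mul]

lemma IsModel.measurableSet_active (hN : N.IsModel p P) : MeasurableSet (N.active p) := by
  have : N.active p = {ω | N.servingDist ω ≤ p.RM} := by
    ext ω
    exact mem_active_iff
  rw [this]
  exact measurableSet_le (measurable_servingDist hN.measurable_bsPos) measurable_const

variable [IsProbabilityMeasure P]

/-- The tail formula concerns R ≥ R_M and activity means R ≤ R_M; the overlap R = R_M is null
because the contact distance has a density. -/
lemma IsModel.measure_active (hN : N.IsModel p P) :
    P (N.active p) = ENNReal.ofReal (1 - Real.exp (-(Real.pi * p.lam * p.RM ^ 2))) := by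
  have hm := measurable_servingDist hN.measurable_bsPos
  have h0 : P {ω | N.servingDist ω = p.RM} = 0 := by
    have : (P.map N.servingDist) {p.RM} = 0 := by
      rw [hN.map_servingDist]
      exact withDensity_absolutelyContinuous _ _
        (Measure.restrict_le_self.absolutelyContinuous (by simp))
    rwa [Measure.map_apply hm (measurableSet_singleton _)] at this
  have h1 : P (N.active p) = P {ω | p.RM ≤ N.servingDist ω}ᶜ := by
    refine measure_congr ?_
    have : ∀ᵐ ω ∂P, N.servingDist ω ≠ p.RM := by
      rw [ae_iff]
      simpa using h0
    filter_upwards [this] with ω hω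
    refine propext ?_
    change ω ∈ N.active p ↔ ¬ p.RM ≤ N.servingDist ω
    rw [mem_active_iff, not_le]
    exact ⟨fun h => lt_of_le_of_ne h hω, le_of_lt⟩
  rw [h1, prob_compl_eq_one_sub (measurableSet_le measurable_const hm),
    hN.measure_le_servingDist p.RM_pos.le, ← ENNReal.ofReal_one,
    ← ENNReal.ofReal_sub _ (Real.exp_pos _).le]

lemma IsModel.measure_active_ne_zero (hN : N.IsModel p P) : P (N.active p) ≠ 0 := by
  rw [hN.measure_active]
  exact (ENNReal.ofReal_pos.2 p.truncation_pos).ne'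

/-- The law of the serving distance given no truncation outage has density `fR`. -/
lemma IsModel.lintegral_active_servingDist (hN : N.IsModel p P) {f : ℝ → ℝ≥0∞}
    (hf : Measurable f) :
    (P (N.active p))⁻¹ * ∫⁻ ω in N.active p, f (N.servingDist ω) ∂P =
      ∫⁻ r in Ioc 0 p.RM, ENNReal.ofReal (p.fR r) * f r := by
  have h1 : ∫⁻ ω in N.active p, f (N.servingDist ω) ∂P =
      ∫⁻ ω, (Iic p.RM).indicator f (N.servingDist ω) ∂P := by
    rw [← lintegral_indicator hN.measurableSet_active]
    refine lintegral_congr fun ω => ?_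
    by_cases h : N.servingDist ω ≤ p.RM
    · rw [indicator_of_mem (mem_active_iff.2 h), indicator_of_mem (mem_Iic.2 h)]
    · rw [indicator_of_notMem (mt mem_active_iff.1 h), indicator_of_notMem (by simpa using h)]
  have h2 : ∀ r, ENNReal.ofReal
      (2 * Real.pi * p.lam * r * Real.exp (-(Real.pi * p.lam * r ^ 2))) *
      (Iic p.RM).indicator f r = (Iic p.RM).indicator (fun r => ENNReal.ofReal
      (2 * Real.pi * p.lam * r * Real.exp (-(Real.pi * p.lam * r ^ 2))) * f r) r := by
    intro r
    by_cases h : r ∈ Iic p.RM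
    · simp only [indicator_of_mem h]
    · simp only [indicator_of_notMem h, mul_zero]
  rw [h1, hN.lintegral_servingDist (hf.indicator measurableSet_Iic)]
  simp_rw [h2]
  rw [setLIntegral_indicator measurableSet_Iic, inter_comm, Ioi_inter_Iic,
    ← lintegral_const_mul _ (by fun_prop), hN.measure_active]
  refine lintegral_congr fun r => ?_
  rw [← mul_assoc, ← ENNReal.ofReal_inv_of_pos p.truncation_pos,
    ← ENNReal.ofReal_mul (inv_nonneg.2 p.truncation_pos.le)]
  congr 2
  unfold Params.fR
  rw [div_eq_inv_mul]

lemma IsModel.lintegral_linkDistLaw (hN : N.IsModel p P) {f : ℝ → ℝ≥0∞} (hf : Measurable f) :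
    ∫⁻ d, f d ∂(N.linkDistLaw p P) = ∫⁻ r in Ioc 0 p.RM, ENNReal.ofReal (p.fR r) * f r := by
  unfold linkDistLaw
  rw [lintegral_map hf (measurable_servingDist hN.measurable_bsPos), lintegral_cond_active,
    hN.lintegral_active_servingDist hf]

lemma IsModel.isProbabilityMeasure_cond_active (hN : N.IsModel p P) :
    IsProbabilityMeasure (cond P (N.active p)) :=
  cond_isProbabilityMeasure hN.measure_active_ne_zero

lemma IsModel.isProbabilityMeasure_linkDistLaw (hN : N.IsModel p P) :
    IsProbabilityMeasure (N.linkDistLaw p P) :=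
  have := hN.isProbabilityMeasure_cond_active
  Measure.isProbabilityMeasure_map (measurable_servingDist hN.measurable_bsPos).aemeasurable

/-- Excludes d = 0, where the cancellation d^η d^(-η) = 1 behind channel inversion fails. -/
lemma IsModel.ae_linkDistLaw_pos (hN : N.IsModel p P) : ∀ᵐ d ∂(N.linkDistLaw p P), 0 < d := by
  unfold linkDistLaw
  rw [ae_map_iff (measurable_servingDist hN.measurable_bsPos).aemeasurable measurableSet_Ioi]
  exact cond_absolutelyContinuous.ae_le hN.ae_servingDist_pos

lemma IsModel.lintegral_linkDistLaw_sq (hN : N.IsModel p P) :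
    ∫⁻ d, ENNReal.ofReal (d ^ 2) ∂(N.linkDistLaw p P) =
      ENNReal.ofReal (lowerGamma 2 (Real.pi * p.lam * p.RM ^ 2) /
        (Real.pi * p.lam * (1 - Real.exp (-(Real.pi * p.lam * p.RM ^ 2))))) := by
  rw [hN.lintegral_linkDistLaw (by fun_prop), ← p.integral_fR_mul_sq,
    intervalIntegral.integral_of_le p.RM_pos.le, ofReal_integral_eq_lintegral_ofReal]
  · refine setLIntegral_congr_fun measurableSet_Ioc fun r hr => ?_
    rw [ENNReal.ofReal_mul (p.fR_nonneg hr.1.le)]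
  · exact (Continuous.integrableOn_Icc (by fun_prop)).mono_set Ioc_subset_Icc_self
  · refine (ae_restrict_iff' measurableSet_Ioc).2 (ae_of_all _ fun r hr => ?_)
    exact mul_nonneg (p.fR_nonneg hr.1.le) (sq_nonneg r)

/-- Laplace transform of the interference from the users of other cells. -/
theorem IsModel.lintegral_negExp_ueSum (hN : N.IsModel p P) {c : ℝ} (hc : 0 ≤ c) :
    ∫⁻ ω, negExp (ENNReal.ofReal c * N.ueSum p ω) ∂P =
      ENNReal.ofReal (Real.exp (-(2 * Real.pi * p.lam * p.ρ ^ (1 - 2 / p.η)) / (p.η - 2) *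
        p.powerMoment * c * p.F (-(p.ρ * c)))) := by
  classical
  have hρ := p.ρ_pos
  have hl := p.lam_pos
  have hη := p.two_lt_η
  have hη2 : 0 < p.η - 2 := by linarith
  have hF : 0 ≤ p.F (-(p.ρ * c)) := hyp2F1_pathLoss_nonneg hη (by positivity)
  have := hN.isProbabilityMeasure_linkDistLaw
  let H : Plane → ℝ × ℝ → ℝ≥0∞ := fun x y =>
    if y.1 < ‖x‖ then ENNReal.ofReal (c * (p.ρ * y.1 ^ p.η) * ‖x‖ ^ (-p.η) * y.2) else 0
  have hH : Measurable (Function.uncurry H) := by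
    have h1 : MeasurableSet {z : Plane × ℝ × ℝ | z.2.1 < ‖z.1‖} :=
      measurableSet_lt (by fun_prop) (by fun_prop)
    exact Measurable.ite h1 (by fun_prop) measurable_const
  have hL : ∀ ω, ENNReal.ofReal c * N.ueSum p ω =
      ∑' j, H (N.uePos j ω) (N.ueDist j ω, N.ueGain j ω) := by
    intro ω
    rw [ueSum_eq_tsum_ite, ← ENNReal.tsum_mul_left]
    refine tsum_congr fun j => ?_
    simp only [H]
    split_ifs with h
    · rw [← ENNReal.ofReal_mul hc]
      congr 1
      unfold uePower
      ring
    · simp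
  simp_rw [hL]
  rw [hN.ue_poisson.lintegral_negExp_tsum_mark
    (fun j => (hN.measurable_ueDist j).prodMk (hN.measurable_ueGain j)) hN.map_ueMark
    hN.indepFun_ueMarks hH, lintegral_ofReal_lam_smul]
  let K : Plane → ℝ → ℝ≥0∞ := fun x d => if d < ‖x‖ then
    ENNReal.ofReal (c * (p.ρ * d ^ p.η) * ‖x‖ ^ (-p.η) /
      (1 + c * (p.ρ * d ^ p.η) * ‖x‖ ^ (-p.η))) else 0
  have hK : Measurable (Function.uncurry K) := by
    have h1 : MeasurableSet {z : Plane × ℝ | z.2 < ‖z.1‖} :=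
      measurableSet_lt (by fun_prop) (by fun_prop)
    exact Measurable.ite h1 (by fun_prop) measurable_const
  have hinner : ∀ x : Plane, 1 - ∫⁻ y, negExp (H x y) ∂((N.linkDistLaw p P).prod (expMeasure 1)) =
      ∫⁻ d, K x d ∂(N.linkDistLaw p P) := by
    intro x
    have hHx : Measurable fun y => negExp (H x y) :=
      measurable_negExp.comp (hH.comp measurable_prodMk_left)
    have hle : ∀ d, ∫⁻ h, negExp (H x (d, h)) ∂(expMeasure 1) ≤ 1 := fun d => by
      calc _ ≤ ∫⁻ _, 1 ∂(expMeasure 1) := lintegral_mono fun h => negExp_le_one _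
        _ = 1 := by simp
    have hfin : ∫⁻ d, ∫⁻ h, negExp (H x (d, h)) ∂(expMeasure 1) ∂(N.linkDistLaw p P) ≠ ∞ := by
      refine ((lintegral_mono hle).trans_lt ?_).ne
      simp
    have h1 : (1 : ℝ≥0∞) = ∫⁻ _, 1 ∂(N.linkDistLaw p P) := by simp
    rw [lintegral_prod _ hHx.aemeasurable]
    -- Viewing 1 as the mean of 1 over the link distance brings the complement 1 - (·) inside that
    -- mean.
    nth_rewrite 1 [h1]
    rw [← lintegral_sub hHx.lintegral_prod_right' hfin (ae_of_all _ hle)]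
    refine lintegral_congr_ae ?_
    filter_upwards [hN.ae_linkDistLaw_pos] with d hd
    simp only [H, K]
    by_cases h : d < ‖x‖
    · have hu : 0 ≤ c * (p.ρ * d ^ p.η) * ‖x‖ ^ (-p.η) := by positivity
      simp only [h, if_true]
      rw [lintegral_negExp_mul_expMeasure hu, one_sub_ofReal_one_div_one_add hu]
    · simp [h]
  simp_rw [hinner]
  -- At the edge of the excluded disc the mean received power is ρ whatever d is. The hypergeometric
  -- argument is therefore independent of d and only the scale d² of the area remains.
  have hd : ∀ d, 0 < d → ∫⁻ x, K x d = ENNReal.ofReal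
      (2 * Real.pi / (p.η - 2) * (c * p.ρ) * p.F (-(p.ρ * c))) * ENNReal.ofReal (d ^ 2) := by
    intro d hd
    let φ : ℝ → ℝ≥0∞ := (Ioi d).indicator fun x => ENNReal.ofReal (c * (p.ρ * d ^ p.η) *
      x ^ (-p.η) / (1 + c * (p.ρ * d ^ p.η) * x ^ (-p.η)))
    have hφ : Measurable φ := Measurable.indicator (by fun_prop) measurableSet_Ioi
    have h1 : ∀ x : Plane, K x d = φ ‖x‖ := by
      intro x
      simp only [K, φ, indicator_apply, mem_Ioi]
    have h2 : ∀ x, ENNReal.ofReal (2 * Real.pi * x) * φ x = (Ioi d).indicator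
        (fun x => ENNReal.ofReal (2 * Real.pi * x) * ENNReal.ofReal (c * (p.ρ * d ^ p.η) *
          x ^ (-p.η) / (1 + c * (p.ρ * d ^ p.η) * x ^ (-p.η)))) x := by
      intro x
      by_cases h : x ∈ Ioi d
      · simp only [φ, indicator_of_mem h]
      · simp only [φ, indicator_of_notMem h, mul_zero]
    have e2 : c * (p.ρ * d ^ p.η) * d ^ (-p.η) = p.ρ * c := by
      rw [← mul_assoc, mul_assoc, ← Real.rpow_add hd]; simp [mul_comm]
    have e3 : d ^ (2 - p.η) * (c * (p.ρ * d ^ p.η)) = c * p.ρ * d ^ 2 := by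
      rw [← mul_assoc c, mul_left_comm, ← Real.rpow_add hd]; simp
    simp_rw [h1]
    rw [lintegral_plane_radial hφ]
    simp_rw [h2]
    rw [setLIntegral_indicator measurableSet_Ioi, inter_eq_left.2 (Ioi_subset_Ioi hd.le),
      lintegral_pathLoss_Ioi hη hd (by positivity), e2, mul_assoc (2 * Real.pi / (p.η - 2)), e3,
      ← ENNReal.ofReal_mul (by positivity)]
    congr 1
    unfold Params.F
    ring
  rw [lintegral_lintegral_swap hK.aemeasurable,
    lintegral_congr_ae (hN.ae_linkDistLaw_pos.mono fun d h => hd d h),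
    lintegral_const_mul _ (by fun_prop), hN.lintegral_linkDistLaw_sq,
    ← ENNReal.ofReal_mul (by positivity), ← ENNReal.ofReal_mul hl.le]
  have hmom : p.ρ ^ (1 - 2 / p.η) * p.powerMoment = p.ρ *
      (lowerGamma 2 (Real.pi * p.lam * p.RM ^ 2) /
        (Real.pi * p.lam * (1 - Real.exp (-(Real.pi * p.lam * p.RM ^ 2))))) := by
    unfold Params.powerMoment
    rw [mul_div_assoc, ← mul_assoc, ← Real.rpow_add hρ]
    simp
  have hsq : 0 ≤ lowerGamma 2 (Real.pi * p.lam * p.RM ^ 2) /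
        (Real.pi * p.lam * (1 - Real.exp (-(Real.pi * p.lam * p.RM ^ 2)))) := by
    rw [← p.integral_fR_mul_sq]
    exact intervalIntegral.integral_nonneg p.RM_pos.le fun r hr =>
      mul_nonneg (p.fR_nonneg hr.1) (sq_nonneg r)
  rw [negExp_ofReal (by positivity)]
  congr 2
  have e : -(2 * Real.pi * p.lam * p.ρ ^ (1 - 2 / p.η)) / (p.η - 2) * p.powerMoment * c *
      p.F (-(p.ρ * c)) = -(2 * Real.pi * p.lam / (p.η - 2) * c * p.F (-(p.ρ * c))) *
      (p.ρ ^ (1 - 2 / p.η) * p.powerMoment) := by ring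
  rw [e, hmom]
  ring

/-- Laplace transform of the interference from all base stations. -/
theorem IsModel.lintegral_negExp_bsSum_univ (hN : N.IsModel p P) {c : ℝ} (hc : 0 ≤ c) :
    ∫⁻ ω, negExp (ENNReal.ofReal c * N.bsSum p univ ω) ∂P =
      ENNReal.ofReal (Real.exp (-(2 * Real.pi ^ 2 * p.lam / p.η) * (c * p.Pd) ^ (2 / p.η) *
        (Real.sin (2 * Real.pi / p.η))⁻¹)) := by
  classical
  have hPd := p.Pd_pos
  have hl := p.lam_pos
  have hη := p.two_lt_η
  have h := hN.lintegral_void_farSum (le_refl (0 : ℝ)) hc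
  have hu : {ω | 0 ≤ N.servingDist ω} = univ := by
    ext ω
    simpa using servingDist_nonneg ω
  have hfar : ∀ ω, N.farSum p 0 ω = N.bsSum p univ ω := by
    intro ω
    rw [bsSum_eq_tsum_ite]
    simp [farSum]
  have hsin : 0 ≤ Real.sin (2 * Real.pi / p.η) := by
    have hpi := Real.pi_pos
    refine Real.sin_nonneg_of_nonneg_of_le_pi (by positivity) ?_
    rw [div_le_iff₀ (by linarith)]
    nlinarith
  rw [hu, Measure.restrict_univ, inter_eq_right.2 Ioi_subset_Ici_self,
    lintegral_pathLoss_Ioi_zero hη (by positivity), ← ENNReal.ofReal_mul hl.le,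
    negExp_ofReal (by positivity)] at h
  simp_rw [hfar] at h
  rw [h]
  simp only [ENNReal.ofReal_zero, ne_eq, OfNat.ofNat_ne_zero, not_false_eq_true, zero_pow,
    zero_mul, mul_zero, negExp_zero, one_mul]
  congr 2
  ring

end Network

/-! ## Positivity of the intra-mode factor -/

@[fun_prop]
lemma continuous_nsinc : Continuous nsinc := by
  unfold nsinc
  exact Real.continuous_sinc.comp (by fun_prop)

@[simp] lemma nsinc_zero : nsinc 0 = 1 := by simp [nsinc]

/-- Adding sinc² y ≤ 1 and (y sinc y)² ≤ 1 gives (1 + y²) sinc² y ≤ 2, an integrable bound. -/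
lemma nsinc_sq_le (x : ℝ) : nsinc x ^ 2 ≤ 2 * (1 + (Real.pi * x) ^ 2)⁻¹ := by
  unfold nsinc
  set y := Real.pi * x
  rw [← div_eq_mul_inv, le_div_iff₀ (by positivity)]
  have h1 : Real.sinc y ^ 2 ≤ 1 := by
    rw [sq_le_one_iff_abs_le_one]
    exact abs_le.2 ⟨Real.neg_one_le_sinc y, Real.sinc_le_one y⟩
  have h2 : (Real.sinc y * y) ^ 2 ≤ 1 := by
    by_cases hy : y = 0
    · simp [hy]
    · rw [Real.sinc_of_ne_zero hy, div_mul_cancel₀ _ hy]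
      exact Real.sin_sq_le_one y
  nlinarith

lemma integrable_nsinc_sq {W : ℝ} (hW : 0 < W) :
    Integrable fun x : ℝ => nsinc (2 * x / W) ^ 2 := by
  have h0 : Integrable fun x : ℝ => 2 * (1 + (2 * Real.pi / W * x) ^ 2)⁻¹ :=
    (integrable_inv_one_add_sq.comp_mul_left' (by positivity : 2 * Real.pi / W ≠ 0)).const_mul 2
  refine h0.mono' (Continuous.aestronglyMeasurable (by fun_prop)) (ae_of_all _ fun x => ?_)
  rw [Real.norm_of_nonneg (sq_nonneg _)]
  refine (nsinc_sq_le _).trans_eq ?_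
  congr 4
  ring

lemma integrable_nsinc_pow_four {W : ℝ} (hW : 0 < W) :
    Integrable fun x : ℝ => nsinc (2 * x / W) ^ 4 := by
  refine (integrable_nsinc_sq hW).mono' (Continuous.aestronglyMeasurable (by fun_prop))
    (ae_of_all _ fun x => ?_)
  rw [Real.norm_of_nonneg (by positivity)]
  have h1 : nsinc (2 * x / W) ^ 2 ≤ 1 := by
    rw [sq_le_one_iff_abs_le_one]
    exact abs_le.2 ⟨Real.neg_one_le_sinc _, Real.sinc_le_one _⟩
  nlinarith [sq_nonneg (nsinc (2 * x / W))]

lemma integral_pos_of_continuous {f : ℝ → ℝ} (hf : Continuous f) (hi : Integrable f)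
    (h0 : ∀ x, 0 ≤ f x) {x : ℝ} (hx : f x ≠ 0) : 0 < ∫ x, f x := by
  rw [integral_pos_iff_support_of_nonneg h0 hi]
  exact hf.isOpen_support.measure_pos _ ⟨x, hx⟩

lemma continuous_pulseFT (W : ℝ) (b : Pulse) : Continuous fun f => pulseFT f W b := by
  cases b <;> (unfold pulseFT; fun_prop)

/-- Integrability of the squared spectrum is essential: the integral of a non-integrable function is
0 by convention, and the normalised pulse would then vanish. -/
lemma pulseFT_zero_pos {W : ℝ} (hW : 0 < W) (b : Pulse) : 0 < pulseFT 0 W b := by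
  cases b with
  | rectangular =>
    have := integral_pos_of_continuous (by fun_prop) (integrable_nsinc_sq hW)
      (fun x => by positivity) (x := 0) (by simp)
    simp only [pulseFT, mul_zero, zero_div, nsinc_zero]
    positivity
  | triangular =>
    have := integral_pos_of_continuous (by fun_prop) (integrable_nsinc_pow_four hW)
      (fun x => by positivity) (x := 0) (by simp)
    simp only [pulseFT, mul_zero, zero_div, nsinc_zero]
    positivity

namespace Params

variable (p : Params)

lemma bw_pos (v : Direction) : 0 < p.bw v := by
  have h1 := p.bwHD_pos v
  have h2 : 0 < p.bwMin := lt_min (p.bwHD_pos .dl) (p.bwHD_pos .ul)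
  have h3 := p.α_nonneg
  have h4 := p.ε_nonneg
  unfold bw
  positivity

/-- The integrand is a continuous square that does not vanish at the centre frequency. Positivity is
what allows division by |𝓘|² in the SINR threshold. -/
lemma intra_pos (v : Direction) : 0 < p.intra v := by
  have hW := p.bw_pos v
  have hc := continuous_pulseFT (p.bw v) (p.pulse v)
  refine intervalIntegral.integral_pos (by linarith) (hc.mul hc).continuousOn
    (fun x _ => mul_self_nonneg _) ⟨0, ⟨by linarith, by linarith⟩, ?_⟩
  exact mul_self_pos.2 (pulseFT_zero_pos hW _).ne'

/-! ## Measurability of the closed forms -/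

@[fun_prop]
lemma measurable_F : Measurable p.F := by
  unfold F hyp2F1
  simp_rw [intervalIntegral.integral_of_le zero_le_one]
  refine measurable_const.mul (StronglyMeasurable.measurable ?_)
  refine StronglyMeasurable.integral_prod_right (f := fun z t : ℝ =>
    t ^ (1 - 2 / p.η - 1) * (1 - t) ^ (2 - 2 / p.η - (1 - 2 / p.η) - 1) * (1 - z * t) ^ (-1 : ℝ)) ?_
  refine Measurable.stronglyMeasurable ?_
  unfold Function.uncurry
  fun_prop

lemma measurable_U1 (τ : NodeTopology) : Measurable fun q : ℝ × ℝ => p.U1 q.1 q.2 τ := by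
  cases τ with
  | twoNode => exact measurable_const
  | threeNode =>
    simp only [U1]
    simp_rw [intervalIntegral.integral_of_le p.RM_pos.le,
      intervalIntegral.integral_of_le Real.pi_pos.le]
    refine StronglyMeasurable.measurable ?_
    refine StronglyMeasurable.integral_prod_right (f := fun (q : ℝ × ℝ) (x : ℝ) =>
      ∫ θ in Ioc 0 Real.pi, p.fR x / (Real.pi + Real.pi * q.2 * |p.cross .dl| ^ 2 * p.ρ *
          (1 + (q.1 / x) ^ 2 - 2 * (q.1 / x) * Real.cos θ) ^ (-p.η / 2))) ?_
    refine StronglyMeasurable.integral_prod_right (f := fun (q : (ℝ × ℝ) × ℝ) (θ : ℝ) =>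
      p.fR q.2 / (Real.pi + Real.pi * q.1.2 * |p.cross .dl| ^ 2 * p.ρ *
          (1 + (q.1.1 / q.2) ^ 2 - 2 * (q.1.1 / q.2) * Real.cos θ) ^ (-p.η / 2))) ?_
    refine Measurable.stronglyMeasurable ?_
    have := p.continuous_fR.measurable
    unfold Function.uncurry
    fun_prop

lemma measurable_U2 (τ : NodeTopology) : Measurable fun q : ℝ × ℝ => p.U2 q.1 q.2 τ := by
  have := p.siLaw_prob
  cases τ with
  | twoNode =>
    simp only [U2]
    refine StronglyMeasurable.measurable ?_
    refine StronglyMeasurable.integral_prod_right (f := fun (q : ℝ × ℝ) (h : ℝ) =>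
      Real.exp (-(p.β .dl * q.2 * h * p.ρ * q.1 ^ p.η * |p.cross .dl| ^ 2))) ?_
    refine Measurable.stronglyMeasurable ?_
    unfold Function.uncurry
    fun_prop
  | threeNode => exact measurable_const

@[fun_prop]
lemma measurable_U3 : Measurable p.U3 := by
  have := p.siLaw_prob
  unfold U3
  refine StronglyMeasurable.measurable ?_
  refine StronglyMeasurable.integral_prod_right (f := fun (s h : ℝ) =>
    Real.exp (-(p.β .ul * s * h * p.Pd * |p.cross .ul| ^ 2))) ?_
  refine Measurable.stronglyMeasurable ?_
  unfold Function.uncurry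
  fun_prop

lemma measurable_ulIntegrand : Measurable p.ulIntegrand := by
  unfold ulIntegrand LIu
  fun_prop

lemma measurable_LId (τ : NodeTopology) : Measurable fun q : ℝ × ℝ => p.LId τ q.1 q.2 := by
  have h1 := p.measurable_U1 τ
  have h2 := p.measurable_U2 τ
  unfold LId
  fun_prop

lemma measurable_dlIntegrand (τ : NodeTopology) :
    Measurable fun q : ℝ × ℝ => p.dlIntegrand τ q.1 q.2 := by
  have h := (p.measurable_LId τ).comp (g := fun q : ℝ × ℝ => p.LId τ q.1 q.2)
    (f := fun q : ℝ × ℝ => (q.2, q.1 / (p.Pd * q.2 ^ (-p.η) * |p.intra .dl| ^ 2))) (by fun_prop)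
  have h' := p.continuous_fR.measurable
  unfold dlIntegrand
  refine Measurable.mul ?_ h
  fun_prop

end Params

/-! ## From tail probabilities to rates -/

/-- Layer-cake formula: the weight is the derivative of B log₂(1 + g), which vanishes at g = 0. -/
lemma lintegral_logb_one_add {Ω : Type*} [MeasurableSpace Ω] (μ : Measure Ω) {X : Ω → ℝ}
    (hX : Measurable X) (hX0 : ∀ ω, 0 ≤ X ω) {B : ℝ} (hB : 0 ≤ B) :
    ∫⁻ ω, ENNReal.ofReal (B * Real.logb 2 (1 + X ω)) ∂μ =
      ∫⁻ g in Ioi (0 : ℝ), μ {ω | g < X ω} * ENNReal.ofReal (B / ((g + 1) * Real.log 2)) := by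
  have hl : 0 < Real.log 2 := Real.log_pos one_lt_two
  have hcont : ∀ t : ℝ, 0 ≤ t →
      ContinuousOn (fun g : ℝ => B / ((g + 1) * Real.log 2)) (uIcc 0 t) := by
    intro t ht
    refine ContinuousOn.div continuousOn_const (by fun_prop) fun x hx => ?_
    rw [uIcc_of_le ht] at hx
    have : 0 < x + 1 := by linarith [hx.1]
    positivity
  rw [← lintegral_comp_eq_lintegral_meas_lt_mul μ (ae_of_all _ hX0) hX.aemeasurable
    (fun t ht => (hcont t ht.le).intervalIntegrable)]
  · refine lintegral_congr fun ω => ?_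
    congr 1
    have hder : ∀ x ∈ uIcc 0 (X ω), HasDerivAt (fun g => B * Real.logb 2 (1 + g))
        (B / ((x + 1) * Real.log 2)) x := by
      intro x hx
      rw [uIcc_of_le (hX0 ω)] at hx
      have hx1 : 1 + x ≠ 0 := by linarith [hx.1]
      have h1 : HasDerivAt (fun g : ℝ => 1 + g) 1 x := (hasDerivAt_id x).const_add 1
      refine ((h1.log hx1).div_const (Real.log 2)).const_mul B |>.congr_deriv ?_
      rw [div_div, mul_one_div, add_comm 1 x]
    rw [intervalIntegral.integral_eq_sub_of_hasDerivAt hder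
      ((hcont _ (hX0 ω)).intervalIntegrable)]
    simp
  · refine (ae_restrict_iff' measurableSet_Ioi).2 (ae_of_all _ fun g hg => ?_)
    have : 0 < g := hg
    positivity

lemma lt_toReal_div_iff {q h g : ℝ} {J : ℝ≥0∞} (hq : 0 < q) (hg : 0 < g) (hJ : J ≠ 0)
    (hJ' : J ≠ ∞) : g < (ENNReal.ofReal (q * h) / J).toReal ↔ g / q * J.toReal < h := by
  have hJ0 := ENNReal.toReal_pos hJ hJ'
  rw [ENNReal.toReal_div, ENNReal.toReal_ofReal', lt_div_iff₀ hJ0, lt_max_iff]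
  have : ¬ g * J.toReal < 0 := not_lt.2 (by positivity)
  simp only [this, or_false]
  rw [div_mul_eq_mul_div, div_lt_iff₀ hq, mul_comm q]

/-- For finite `J` this is the exponential tail exp(-x) at x = gJ/q. For infinite `J` the quotient
is 0 and never exceeds g, in agreement with exp(-∞) = 0. -/
lemma expMeasure_lt_toReal_div {q g : ℝ} {J : ℝ≥0∞} (hq : 0 < q) (hg : 0 < g) (hJ : J ≠ 0) :
    expMeasure 1 {h | g < (ENNReal.ofReal (q * h) / J).toReal} =
      negExp (ENNReal.ofReal (g / q) * J) := by
  by_cases hJ' : J = ∞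
  · have h1 : {h | g < (ENNReal.ofReal (q * h) / J).toReal} = ∅ := by
      ext h
      simp [hJ', hg.le]
    have h2 : ENNReal.ofReal (g / q) ≠ 0 := (ENNReal.ofReal_pos.2 (by positivity)).ne'
    rw [h1, hJ', ENNReal.mul_top h2]
    simp
  · have h1 : {h | g < (ENNReal.ofReal (q * h) / J).toReal} = Ioi (g / q * J.toReal) := by
      ext h
      exact lt_toReal_div_iff hq hg hJ hJ'
    have hJ0 := ENNReal.toReal_nonneg (a := J)
    rw [h1, expMeasure_one_Ioi (by positivity)]
    nth_rewrite 2 [← ENNReal.ofReal_toReal hJ']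
    rw [← ENNReal.ofReal_mul (by positivity), negExp_ofReal (by positivity)]

/-- Coverage probability for an exponential gain `D` of the intended channel. -/
lemma measure_lt_sinr {Ω : Type*} [MeasurableSpace Ω] {P : Measure Ω} [IsFiniteMeasure P]
    {R D : Ω → ℝ} {J : Ω → ℝ≥0∞} (hR : Measurable R) (hD : Measurable D) (hJ : Measurable J)
    (hlaw : P.map D = expMeasure 1) (hind : IndepFun (fun ω => (R ω, J ω)) D P)
    {S : Set ℝ} (hS : MeasurableSet S) {Q : ℝ → ℝ} (hQ : Measurable Q)
    (hQ0 : ∀ᵐ ω ∂P, 0 < Q (R ω)) (hJ0 : ∀ ω, J ω ≠ 0) {g : ℝ} (hg : 0 < g) :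
    P {ω | R ω ∈ S ∧ g < (ENNReal.ofReal (Q (R ω) * D ω) / J ω).toReal} =
      ∫⁻ ω, S.indicator 1 (R ω) * negExp (ENNReal.ofReal (g / Q (R ω)) * J ω) ∂P := by
  classical
  -- The coverage event as a set in the joint space of (R, J) and the gain, so that the gain can be
  -- integrated out first.
  let A : Set ((ℝ × ℝ≥0∞) × ℝ) :=
    {z | z.1.1 ∈ S ∧ g < (ENNReal.ofReal (Q z.1.1 * z.2) / z.1.2).toReal}
  have hA : MeasurableSet A := by
    have hsplit : A = {z | z.1.1 ∈ S} ∩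
      {z | g < (ENNReal.ofReal (Q z.1.1 * z.2) / z.1.2).toReal} := rfl
    rw [hsplit]
    refine MeasurableSet.inter (measurable_fst.fst hS) (measurableSet_lt measurable_const ?_)
    refine Measurable.ennreal_toReal (Measurable.div ?_ measurable_fst.snd)
    exact ((hQ.comp measurable_fst.fst).mul measurable_snd).ennreal_ofReal
  have h := lintegral_indepFun hind (hR.prodMk hJ) hD
    (F := fun y h => A.indicator 1 (y, h)) (measurable_one.indicator hA)
  rw [hlaw] at h
  have h1 : P {ω | R ω ∈ S ∧ g < (ENNReal.ofReal (Q (R ω) * D ω) / J ω).toReal} =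
      ∫⁻ ω, A.indicator 1 ((R ω, J ω), D ω) ∂P := by
    have hm : Measurable fun ω => ((R ω, J ω), D ω) := (hR.prodMk hJ).prodMk hD
    exact (lintegral_indicator_one (μ := P) (hm hA)).symm
  rw [h1, h]
  refine lintegral_congr_ae ?_
  filter_upwards [hQ0] with ω hω
  by_cases hs : R ω ∈ S
  · rw [indicator_of_mem hs, Pi.one_apply, one_mul, ← expMeasure_lt_toReal_div hω hg (hJ0 ω)]
    have hm : MeasurableSet {h | g < (ENNReal.ofReal (Q (R ω) * h) / J ω).toReal} :=
      measurableSet_lt measurable_const (by fun_prop)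
    rw [← lintegral_indicator_one hm]
    refine lintegral_congr fun h => ?_
    simp only [indicator_apply, A, mem_ofPred_eq, hs, true_and, Pi.one_apply]
  · rw [indicator_of_notMem hs, zero_mul]
    simp [A, hs]

namespace Network

variable {Ω : Type*} {N : Network Ω} [MeasurableSpace Ω] {P : Measure Ω} {p : Params}

/-! ## Self-interference and the user of the same cell -/

lemma lintegral_negExp_siGain (hN : N.IsModel p P) {b : ℝ} (hb : 0 ≤ b) :
    ∫⁻ ω, negExp (ENNReal.ofReal (b * N.siGain ω)) ∂P =
      ENNReal.ofReal (∫ h, Real.exp (-(b * h)) ∂p.siLaw) := by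
  have := p.siLaw_prob
  have h1 := lintegral_map (μ := P) (f := fun h => negExp (ENNReal.ofReal (b * h)))
    (by fun_prop) hN.measurable_siGain
  rw [← h1, hN.law_siGain, ofReal_integral_eq_lintegral_ofReal]
  · refine lintegral_congr_ae ?_
    filter_upwards [p.siLaw_nonneg] with h hh
    rw [negExp_ofReal (by positivity)]
  · refine Integrable.of_bound (C := 1) (Continuous.aestronglyMeasurable (by fun_prop)) ?_
    filter_upwards [p.siLaw_nonneg] with h hh
    rw [Real.norm_of_nonneg (Real.exp_pos _).le, Real.exp_le_one_iff]
    have : 0 ≤ b * h := by positivity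
    linarith
  · exact ae_of_all _ fun h => (Real.exp_pos _).le

/-- Squared distance between two users of the same cell relative to the squared link distance of
one of them. -/
def relSep (r d θ : ℝ) : ℝ := 1 + (r / d) ^ 2 - 2 * (r / d) * Real.cos θ

/-- The quantity equals (r/d - cos θ)² + sin² θ. -/
lemma relSep_nonneg (r d θ : ℝ) : 0 ≤ relSep r d θ := by
  unfold relSep
  nlinarith [sq_nonneg (r / d - Real.cos θ), Real.sin_sq_add_cos_sq θ, sq_nonneg (Real.sin θ)]

/-- Factoring d² out of the law of cosines, the power d^η of channel inversion cancels and only the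
ratio r/d is left, as in `U1`. -/
lemma rpow_mul_sqrt_rpow {r d θ η : ℝ} (hd : 0 < d) :
    d ^ η * Real.sqrt (r ^ 2 + d ^ 2 - 2 * r * d * Real.cos θ) ^ (-η) =
      relSep r d θ ^ (-η / 2) := by
  have h : r ^ 2 + d ^ 2 - 2 * r * d * Real.cos θ = d ^ 2 * relSep r d θ := by
    unfold relSep
    field_simp
    ring
  rw [h, Real.sqrt_mul (sq_nonneg d), Real.sqrt_sq hd.le,
    Real.mul_rpow hd.le (Real.sqrt_nonneg _), ← mul_assoc, ← Real.rpow_add hd, add_neg_cancel,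
    Real.rpow_zero, one_mul, Real.sqrt_eq_rpow, ← Real.rpow_mul (relSep_nonneg _ _ _)]
  congr 1
  ring

lemma lintegral_cond_Icc_pi {f : ℝ → ℝ} (hf : Measurable f) (hf0 : ∀ θ, 0 ≤ f θ)
    (hf1 : ∀ θ, f θ ≤ 1) :
    ∫⁻ θ, ENNReal.ofReal (f θ) ∂(ProbabilityTheory.cond volume (Icc 0 Real.pi)) =
      ENNReal.ofReal (Real.pi⁻¹ * ∫ θ in (0 : ℝ)..Real.pi, f θ) := by
  have hpi := Real.pi_pos
  have hint : IntegrableOn f (Icc 0 Real.pi) :=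
    Measure.integrableOn_of_bounded (M := 1) (by simp) hf.aestronglyMeasurable
      (ae_of_all _ fun θ => by rw [Real.norm_of_nonneg (hf0 θ)]; exact hf1 θ)
  rw [ProbabilityTheory.cond, lintegral_smul_measure, smul_eq_mul,
    ← ofReal_integral_eq_lintegral_ofReal hint (ae_of_all _ hf0),
    intervalIntegral.integral_of_le hpi.le, integral_Icc_eq_integral_Ioc, Real.volume_Icc,
    sub_zero, ← ENNReal.ofReal_inv_of_pos hpi, ← ENNReal.ofReal_mul (by positivity)]

lemma intervalIntegral_one_div_one_add_mem {f : ℝ → ℝ} (hf : Measurable f) (hf0 : ∀ θ, 0 ≤ f θ) :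
    Real.pi⁻¹ * ∫ θ in (0 : ℝ)..Real.pi, 1 / (1 + f θ) ∈ Icc (0 : ℝ) 1 := by
  have hpi := Real.pi_pos
  have h1 : ∀ θ, 1 / (1 + f θ) ≤ 1 := fun θ =>
    div_le_one_of_le₀ (by linarith [hf0 θ]) (by linarith [hf0 θ])
  have h0 : ∀ θ, 0 ≤ 1 / (1 + f θ) := fun θ => by
    have := hf0 θ
    positivity
  refine ⟨mul_nonneg (by positivity) (intervalIntegral.integral_nonneg hpi.le fun θ _ => h0 θ), ?_⟩
  have hint : IntervalIntegrable (fun θ => 1 / (1 + f θ)) volume 0 Real.pi := by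
    rw [intervalIntegrable_iff_integrableOn_Ioc_of_le hpi.le]
    exact Measure.integrableOn_of_bounded (M := 1) (by simp)
      (Measurable.aestronglyMeasurable (by fun_prop))
      (ae_of_all _ fun θ => by rw [Real.norm_of_nonneg (h0 θ)]; exact h1 θ)
  have := intervalIntegral.integral_mono_on hpi.le hint intervalIntegrable_const fun θ _ => h1 θ
  simp only [intervalIntegral.integral_const, sub_zero, smul_eq_mul, mul_one] at this
  rw [inv_mul_le_iff₀ hpi]
  linarith

variable [IsProbabilityMeasure P]

/-- The gain is integrated first and gives 1 / (1 + v); then the uniform angle, with density 1/π on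
[0, π]; the link distance remains. -/
lemma lintegral_negExp_mateGain (hN : N.IsModel p P) {v : ℝ → ℝ → ℝ} (hv : ∀ d θ, 0 ≤ v d θ)
    (hvm : Measurable fun z : ℝ × ℝ => v z.1 z.2) :
    ∫⁻ ω, negExp (ENNReal.ofReal (v (N.mateDist ω) (N.mateAngle ω) * N.mateGain ω)) ∂P =
      ∫⁻ d, ENNReal.ofReal (Real.pi⁻¹ * ∫ θ in (0 : ℝ)..Real.pi, 1 / (1 + v d θ))
        ∂(N.linkDistLaw p P) := by
  have hd := hN.measurable_mateDist
  have hθ := hN.measurable_mateAngle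
  have hh := hN.measurable_mateGain
  have hind1 : IndepFun (fun ω => (N.mateDist ω, N.mateAngle ω)) N.mateGain P := by
    refine hN.indepFun_sources {.mateDist, .mateAngle} {.mateGain} (by simp) ?_
      (measurable_sigmaOf_of_comap (mem_singleton _) rfl)
    exact Measurable.prodMk (measurable_sigmaOf_of_comap (s := .mateDist) (by simp) rfl)
      (measurable_sigmaOf_of_comap (s := .mateAngle) (by simp) rfl)
  have hind2 : IndepFun N.mateDist N.mateAngle P :=
    hN.indepFun_sources {.mateDist} {.mateAngle} (by simp)
      (measurable_sigmaOf_of_comap (mem_singleton _) rfl)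
      (measurable_sigmaOf_of_comap (mem_singleton _) rfl)
  have h2 := lintegral_indepFun hind1 (hd.prodMk hθ) hh
    (F := fun y h => negExp (ENNReal.ofReal (v y.1 y.2 * h))) (by
      have : Measurable fun z : (ℝ × ℝ) × ℝ => v z.1.1 z.1.2 := hvm.comp measurable_fst
      unfold Function.uncurry
      fun_prop)
  have h3F : Measurable (Function.uncurry fun d θ => ENNReal.ofReal (1 / (1 + v d θ))) := by
    unfold Function.uncurry
    fun_prop
  have h3 := lintegral_indepFun hind2 hd hθ h3F
  have hvθ : ∀ d, Measurable fun θ => 1 / (1 + v d θ) := fun d => by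
    have : Measurable fun θ => v d θ := hvm.comp measurable_prodMk_left
    fun_prop
  have h4 : ∀ d, ∫⁻ θ, ENNReal.ofReal (1 / (1 + v d θ))
      ∂(ProbabilityTheory.cond volume (Icc 0 Real.pi)) =
      ENNReal.ofReal (Real.pi⁻¹ * ∫ θ in (0 : ℝ)..Real.pi, 1 / (1 + v d θ)) := fun d =>
    lintegral_cond_Icc_pi (hvθ d) (fun θ => by have := hv d θ; positivity) fun θ =>
      div_le_one_of_le₀ (by linarith [hv d θ]) (by linarith [hv d θ])
  rw [h2, hN.law_mateGain]
  simp_rw [lintegral_negExp_mul_expMeasure (hv _ _)]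
  rw [h3, hN.law_mateAngle, ← hN.law_mateDist, lintegral_map _ hd]
  · simp_rw [h4]
  · simp_rw [← h4]
    exact h3F.lintegral_prod_right

lemma lintegral_negExp_mate (hN : N.IsModel p P) {s r : ℝ} (hs : 0 ≤ s) :
    ∫⁻ ω, negExp (ENNReal.ofReal (s * (uePower p (N.mateDist ω) * N.mateGain ω *
      Real.sqrt (r ^ 2 + N.mateDist ω ^ 2 - 2 * r * N.mateDist ω * Real.cos (N.mateAngle ω)) ^
        (-p.η) * |p.cross .dl| ^ 2))) ∂P = ENNReal.ofReal (p.U1 r s .threeNode) := by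
  have hρ := p.ρ_pos
  have hpi := Real.pi_pos
  have hdpos : ∀ᵐ ω ∂P, 0 < N.mateDist ω :=
    ae_of_ae_map hN.measurable_mateDist.aemeasurable (hN.law_mateDist ▸ hN.ae_linkDistLaw_pos)
  obtain ⟨v, hv_def⟩ : ∃ v : ℝ → ℝ → ℝ, v = fun d θ =>
    s * |p.cross .dl| ^ 2 * p.ρ * relSep r d θ ^ (-p.η / 2) := ⟨_, rfl⟩
  have hv : ∀ d θ, 0 ≤ v d θ := fun d θ => by
    have := relSep_nonneg r d θ
    rw [hv_def]
    positivity
  have hvm : Measurable fun z : ℝ × ℝ => v z.1 z.2 := by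
    simp only [hv_def, relSep]
    fun_prop
  have h1 : ∫⁻ ω, negExp (ENNReal.ofReal (s * (uePower p (N.mateDist ω) * N.mateGain ω *
      Real.sqrt (r ^ 2 + N.mateDist ω ^ 2 - 2 * r * N.mateDist ω * Real.cos (N.mateAngle ω)) ^
        (-p.η) * |p.cross .dl| ^ 2))) ∂P =
      ∫⁻ ω, negExp (ENNReal.ofReal (v (N.mateDist ω) (N.mateAngle ω) * N.mateGain ω)) ∂P := by
    refine lintegral_congr_ae ?_
    filter_upwards [hdpos] with ω hω
    simp only [hv_def]
    rw [← rpow_mul_sqrt_rpow hω]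
    congr 2
    unfold uePower
    ring
  obtain ⟨A, hA_def⟩ : ∃ A : ℝ → ℝ, A = fun d =>
    Real.pi⁻¹ * ∫ θ in (0 : ℝ)..Real.pi, 1 / (1 + v d θ) := ⟨_, rfl⟩
  have hA : Measurable A := by
    simp_rw [hA_def, intervalIntegral.integral_of_le hpi.le]
    refine measurable_const.mul (StronglyMeasurable.measurable ?_)
    refine StronglyMeasurable.integral_prod_right (f := fun d θ : ℝ => 1 / (1 + v d θ)) ?_
    exact Measurable.stronglyMeasurable (by unfold Function.uncurry; fun_prop)
  have hA01 : ∀ d, A d ∈ Icc (0 : ℝ) 1 := fun d => by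
    rw [hA_def]
    exact intervalIntegral_one_div_one_add_mem (hvm.comp measurable_prodMk_left) (hv d)
  have h5 : p.U1 r s .threeNode = ∫ x in Ioc 0 p.RM, p.fR x * A x := by
    simp only [Params.U1]
    rw [intervalIntegral.integral_of_le p.RM_pos.le]
    refine setIntegral_congr_fun measurableSet_Ioc fun x _ => ?_
    simp only [hA_def]
    rw [← intervalIntegral.integral_const_mul, ← intervalIntegral.integral_const_mul]
    refine intervalIntegral.integral_congr fun θ _ => ?_
    have := hv x θ
    have e : Real.pi + Real.pi * s * |p.cross .dl| ^ 2 * p.ρ *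
        (1 + (r / x) ^ 2 - 2 * (r / x) * Real.cos θ) ^ (-p.η / 2) = Real.pi * (1 + v x θ) := by
      simp only [hv_def, relSep]
      ring
    simp only [e]
    field_simp
  have hfi : IntegrableOn (fun x => p.fR x * A x) (Ioc 0 p.RM) := by
    have h0 : IntegrableOn p.fR (Ioc 0 p.RM) :=
      (Continuous.integrableOn_Icc (by fun_prop)).mono_set Ioc_subset_Icc_self
    have hfm := p.continuous_fR.measurable
    refine Integrable.mono' h0 (Measurable.aestronglyMeasurable (by fun_prop)) ?_
    refine (ae_restrict_iff' measurableSet_Ioc).2 (ae_of_all _ fun x hx => ?_)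
    have := p.fR_nonneg hx.1.le
    rw [Real.norm_of_nonneg (mul_nonneg this (hA01 x).1)]
    exact mul_le_of_le_one_right this (hA01 x).2
  have h6 : ∫⁻ ω, negExp (ENNReal.ofReal (v (N.mateDist ω) (N.mateAngle ω) * N.mateGain ω)) ∂P =
      ∫⁻ d, ENNReal.ofReal (A d) ∂(N.linkDistLaw p P) := by
    rw [hA_def]
    exact lintegral_negExp_mateGain hN hv hvm
  rw [h1, h6, hN.lintegral_linkDistLaw (by fun_prop), h5, ofReal_integral_eq_lintegral_ofReal hfi]
  · refine setLIntegral_congr_fun measurableSet_Ioc fun x hx => ?_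
    rw [ENNReal.ofReal_mul (p.fR_nonneg hx.1.le)]
  · exact (ae_restrict_iff' measurableSet_Ioc).2 (ae_of_all _ fun x hx =>
      mul_nonneg (p.fR_nonneg hx.1.le) (hA01 x).1)

end Network

/-! ### Signs of the closed forms and the disturbance at the test receiver. -/

lemma lintegral_negExp_le_one {Ω : Type*} [MeasurableSpace Ω] {P : Measure Ω}
    [IsProbabilityMeasure P] (f : Ω → ℝ≥0∞) : ∫⁻ ω, negExp (f ω) ∂P ≤ 1 :=
  (lintegral_mono fun ω => negExp_le_one (f ω)).trans (by simp)

namespace Params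

variable (p : Params)

lemma noise_pos (v : Direction) : 0 < p.noise v := by
  have h1 := p.N0_pos
  have h2 := abs_pos.2 (p.intra_pos v).ne'
  unfold noise
  positivity

lemma U1_nonneg {r s : ℝ} (hs : 0 ≤ s) (τ : NodeTopology) : 0 ≤ p.U1 r s τ := by
  cases τ with
  | twoNode => exact zero_le_one
  | threeNode =>
    have hρ := p.ρ_pos
    have hpi := Real.pi_pos
    refine intervalIntegral.integral_nonneg p.RM_pos.le fun x hx =>
      intervalIntegral.integral_nonneg hpi.le fun θ _ => ?_
    have h1 := p.fR_nonneg hx.1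
    have h2 := Network.relSep_nonneg r x θ
    unfold Network.relSep at h2
    positivity

lemma U2_nonneg (r s : ℝ) (τ : NodeTopology) : 0 ≤ p.U2 r s τ := by
  cases τ with
  | twoNode => exact integral_nonneg fun _ => (Real.exp_pos _).le
  | threeNode => exact zero_le_one

lemma U3_nonneg (s : ℝ) : 0 ≤ p.U3 s := integral_nonneg fun _ => (Real.exp_pos _).le

lemma LId_nonneg {r s : ℝ} (hs : 0 ≤ s) (τ : NodeTopology) : 0 ≤ p.LId τ r s := by
  have h1 := p.U1_nonneg (r := r) hs τ
  have h2 := p.U2_nonneg r s τ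
  unfold LId
  positivity

lemma LIu_nonneg (s : ℝ) : 0 ≤ p.LIu s := by
  have h1 := p.U3_nonneg s
  unfold LIu
  positivity

end Params

namespace Network

variable {Ω : Type*} {N : Network Ω} {p : Params}

/-- Contribution of the test user's cell to the downlink interference as a function of the serving
distance and of the self-interference gain, link distance, angle and gain of the uplink user. -/
def ownCell (p : Params) (r : ℝ) (w : ℝ × ℝ × ℝ × ℝ) : NodeTopology → ℝ
  | .twoNode => p.β .dl * w.1 * uePower p r * |p.cross .dl| ^ 2
  | .threeNode => uePower p w.2.1 * w.2.2.2 *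
      Real.sqrt (r ^ 2 + w.2.1 ^ 2 - 2 * r * w.2.1 * Real.cos w.2.2.1) ^ (-p.η) *
      |p.cross .dl| ^ 2

/-- The random variables of the test user's cell. -/
def cellVars (N : Network Ω) (ω : Ω) : ℝ × ℝ × ℝ × ℝ :=
  (N.siGain ω, N.mateDist ω, N.mateAngle ω, N.mateGain ω)

lemma dlOwnCell_eq (τ : NodeTopology) (ω : Ω) :
    N.dlOwnCell p ω τ = ownCell p (N.servingDist ω) (N.cellVars ω) τ := by
  cases τ <;> rfl

lemma measurable_ownCell (p : Params) (τ : NodeTopology) :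
    Measurable fun z : ℝ × ℝ × ℝ × ℝ × ℝ => ownCell p z.1 z.2 τ := by
  cases τ <;> (simp only [ownCell, uePower]; fun_prop)

lemma dl_signal_eq (ω : Ω) : N.signal p ω .dl =
    p.Pd * N.servingDist ω ^ (-p.η) * |p.intra .dl| ^ 2 * N.desiredGain ω := by
  simp only [signal]
  ring

/-- Channel inversion cancels the path loss, so the uplink signal does not depend on the link
distance. -/
lemma ul_signal_eq {ω : Ω} (h : 0 < N.ulDist ω) :
    N.signal p ω .ul = p.ρ * |p.intra .ul| ^ 2 * N.desiredGain ω := by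
  simp only [signal, uePower]
  rw [mul_assoc p.ρ, ← Real.rpow_add h, add_neg_cancel, Real.rpow_zero]
  ring

/-- Total interference and noise power. -/
def disturbance (N : Network Ω) (p : Params) (τ : NodeTopology) (v : Direction) (ω : Ω) : ℝ≥0∞ :=
  N.interference p τ ω v + ENNReal.ofReal (p.noise v)

/-- Noise excludes a zero denominator, for which the quotient could be ∞ and its `toReal` would
misleadingly be 0. -/
lemma disturbance_ne_zero (τ : NodeTopology) (v : Direction) (ω : Ω) :
    N.disturbance p τ v ω ≠ 0 := by
  have := ENNReal.ofReal_pos.2 (p.noise_pos v)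
  unfold disturbance
  exact (this.trans_le le_add_self).ne'

lemma SINR_eq (τ : NodeTopology) (v : Direction) (ω : Ω) : N.SINR p τ v ω =
    (ENNReal.ofReal (N.signal p ω v) / N.disturbance p τ v ω).toReal := rfl

lemma measurable_cellVars [MeasurableSpace Ω] (h1 : Measurable N.siGain)
    (h2 : Measurable N.mateDist) (h3 : Measurable N.mateAngle) (h4 : Measurable N.mateGain) :
    Measurable N.cellVars :=
  h1.prodMk (h2.prodMk (h3.prodMk h4))

/-! ## Independence of the groups of sources -/

/-- Sources of the interference from base stations. -/
def bsSources : Set Source := {s | s = .bsPos ∨ ∃ j, s = .bsGain j}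

/-- Sources of the interference from users of other cells. -/
def ueSources : Set Source := {s | s = .uePos ∨ ∃ j, s = .ueGain j ∨ s = .ueDist j}

/-- Sources of the interference within the test cell. -/
def cellSources : Set Source := {.siGain, .mateDist, .mateAngle, .mateGain}

lemma measurable_cellVars_sigmaOf {S : Set Source} (hS : cellSources ⊆ S) :
    Measurable[N.sigmaOf S] N.cellVars :=
  @Network.measurable_cellVars Ω N (N.sigmaOf S)
    (measurable_sigmaOf_of_comap (s := .siGain) (hS (by simp [cellSources])) rfl)
    (measurable_sigmaOf_of_comap (s := .mateDist) (hS (by simp [cellSources])) rfl)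
    (measurable_sigmaOf_of_comap (s := .mateAngle) (hS (by simp [cellSources])) rfl)
    (measurable_sigmaOf_of_comap (s := .mateGain) (hS (by simp [cellSources])) rfl)

lemma measurable_bsPos_sources {S : Set Source} (hS : bsSources ⊆ S) (j : ℕ) :
    Measurable[N.sigmaOf S] (N.bsPos j) :=
  measurable_bsPos_sigmaOf (hS (by simp [bsSources])) j

lemma measurable_bsGain_sources {S : Set Source} (hS : bsSources ⊆ S) (j : ℕ) :
    Measurable[N.sigmaOf S] (N.bsGain j) :=
  measurable_sigmaOf_of_comap (s := .bsGain j) (hS (by simp [bsSources])) rfl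

lemma measurable_uePos_sources {S : Set Source} (hS : ueSources ⊆ S) (j : ℕ) :
    Measurable[N.sigmaOf S] (N.uePos j) :=
  measurable_uePos_sigmaOf (hS (by simp [ueSources])) j

lemma measurable_ueGain_sources {S : Set Source} (hS : ueSources ⊆ S) (j : ℕ) :
    Measurable[N.sigmaOf S] (N.ueGain j) :=
  measurable_sigmaOf_of_comap (s := .ueGain j) (hS (by simp [ueSources])) rfl

lemma measurable_ueDist_sources {S : Set Source} (hS : ueSources ⊆ S) (j : ℕ) :
    Measurable[N.sigmaOf S] (N.ueDist j) :=
  measurable_sigmaOf_of_comap (s := .ueDist j) (hS (by simp [ueSources])) rfl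

lemma measurable_ueSum_sources {S : Set Source} (hS : ueSources ⊆ S) :
    Measurable[N.sigmaOf S] fun ω => N.ueSum p ω :=
  @measurable_ueSum Ω N (N.sigmaOf S) p (measurable_uePos_sources hS)
    (measurable_ueGain_sources hS) (measurable_ueDist_sources hS)

lemma measurable_servingDist_sources {S : Set Source} (hS : bsSources ⊆ S) :
    Measurable[N.sigmaOf S] N.servingDist :=
  @measurable_servingDist Ω N (N.sigmaOf S) (measurable_bsPos_sources hS)

lemma measurable_bsSum_serving_sources {S : Set Source} (hS : bsSources ⊆ S) :
    Measurable[N.sigmaOf S] fun ω => N.bsSum p {j | N.servingDist ω < ‖N.bsPos j ω‖} ω :=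
  @measurable_bsSum_serving Ω N (N.sigmaOf S) p (measurable_bsPos_sources hS)
    (measurable_bsGain_sources hS)

lemma measurable_bsSum_univ_sources {S : Set Source} (hS : bsSources ⊆ S) :
    Measurable[N.sigmaOf S] fun ω => N.bsSum p univ ω :=
  @measurable_bsSum_univ Ω N (N.sigmaOf S) p (measurable_bsPos_sources hS)
    (measurable_bsGain_sources hS)

lemma disjoint_ueSources_bsSources : Disjoint bsSources ueSources := by
  rw [Set.disjoint_left]
  rintro s (rfl | ⟨j, rfl⟩) <;> simp [ueSources]

lemma disjoint_cellSources : Disjoint (bsSources ∪ ueSources) cellSources := by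
  rw [Set.disjoint_left]
  rintro s ((rfl | ⟨j, rfl⟩) | (rfl | ⟨j, rfl | rfl⟩)) <;> simp [cellSources]

lemma disjoint_desiredGain :
    Disjoint ((bsSources ∪ ueSources) ∪ cellSources) {.desiredGain} := by
  rw [Set.disjoint_singleton_right]
  simp [bsSources, ueSources, cellSources]

variable [MeasurableSpace Ω] {P : Measure Ω}

lemma IsModel.measurable_cellVars (hN : N.IsModel p P) : Measurable N.cellVars :=
  Network.measurable_cellVars hN.measurable_siGain hN.measurable_mateDist hN.measurable_mateAngle
    hN.measurable_mateGain

lemma measurable_dl_disturbance (p : Params) (τ : NodeTopology) (h1 : ∀ j, Measurable (N.bsPos j))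
    (h2 : ∀ j, Measurable (N.bsGain j)) (h3 : ∀ j, Measurable (N.uePos j))
    (h4 : ∀ j, Measurable (N.ueGain j)) (h5 : ∀ j, Measurable (N.ueDist j))
    (h6 : Measurable N.cellVars) : Measurable (N.disturbance p τ .dl) := by
  have e1 := measurable_bsSum_serving p h1 h2
  have e2 := measurable_ueSum p h3 h4 h5
  have e3 : Measurable fun ω => N.dlOwnCell p ω τ := by
    simp_rw [dlOwnCell_eq]
    exact (measurable_ownCell p τ).comp ((measurable_servingDist h1).prodMk h6)
  unfold disturbance interference
  exact (((e1.const_mul _).add (e2.const_mul _)).add e3.ennreal_ofReal).add measurable_const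

lemma measurable_ul_disturbance (p : Params) (τ : NodeTopology) (h1 : ∀ j, Measurable (N.bsPos j))
    (h2 : ∀ j, Measurable (N.bsGain j)) (h3 : ∀ j, Measurable (N.uePos j))
    (h4 : ∀ j, Measurable (N.ueGain j)) (h5 : ∀ j, Measurable (N.ueDist j))
    (h6 : Measurable N.siGain) : Measurable (N.disturbance p τ .ul) := by
  have e1 := measurable_bsSum_univ p h1 h2
  have e2 := measurable_ueSum p h3 h4 h5
  unfold disturbance interference
  refine (((e2.const_mul _).add (e1.const_mul _)).add ?_).add measurable_const
  fun_prop

lemma IsModel.measurable_SINR (hN : N.IsModel p P) (τ : NodeTopology) (v : Direction) :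
    Measurable (N.SINR p τ v) := by
  have hD := hN.measurable_desiredGain
  cases v with
  | dl =>
    have h1 := measurable_dl_disturbance p τ hN.measurable_bsPos hN.measurable_bsGain
      hN.measurable_uePos hN.measurable_ueGain hN.measurable_ueDist hN.measurable_cellVars
    have h2 : Measurable fun ω => N.signal p ω .dl := by
      have := measurable_servingDist hN.measurable_bsPos
      simp_rw [dl_signal_eq]
      fun_prop
    exact (h2.ennreal_ofReal.div h1).ennreal_toReal
  | ul =>
    have h1 := measurable_ul_disturbance p τ hN.measurable_bsPos hN.measurable_bsGain
      hN.measurable_uePos hN.measurable_ueGain hN.measurable_ueDist hN.measurable_siGain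
    have h2 : Measurable fun ω => N.signal p ω .ul := by
      have := hN.measurable_ulDist
      simp only [signal, uePower]
      fun_prop
    exact (h2.ennreal_ofReal.div h1).ennreal_toReal

lemma IsModel.indepFun_dl_desiredGain (hN : N.IsModel p P) (τ : NodeTopology) :
    IndepFun (fun ω => (N.servingDist ω, N.disturbance p τ .dl ω)) N.desiredGain P := by
  have hb : bsSources ⊆ (bsSources ∪ ueSources) ∪ cellSources := fun s h => Or.inl (Or.inl h)
  have hu : ueSources ⊆ (bsSources ∪ ueSources) ∪ cellSources := fun s h => Or.inl (Or.inr h)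
  refine hN.indepFun_sources _ _ disjoint_desiredGain (Measurable.prodMk
    (measurable_servingDist_sources hb) (@measurable_dl_disturbance Ω N (N.sigmaOf _) p τ
      (measurable_bsPos_sources hb) (measurable_bsGain_sources hb) (measurable_uePos_sources hu)
      (measurable_ueGain_sources hu) (measurable_ueDist_sources hu)
      (measurable_cellVars_sigmaOf fun s h => Or.inr h)))
    (measurable_sigmaOf_of_comap (mem_singleton _) rfl)

/-- The constant 0 fills the slot of the serving distance, so that `measure_lt_sinr` covers both
directions. -/
lemma IsModel.indepFun_ul_desiredGain (hN : N.IsModel p P) (τ : NodeTopology) :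
    IndepFun (fun ω => ((0 : ℝ), N.disturbance p τ .ul ω)) N.desiredGain P := by
  have hb : bsSources ⊆ (bsSources ∪ ueSources) ∪ cellSources := fun s h => Or.inl (Or.inl h)
  have hu : ueSources ⊆ (bsSources ∪ ueSources) ∪ cellSources := fun s h => Or.inl (Or.inr h)
  refine hN.indepFun_sources _ _ disjoint_desiredGain (Measurable.prodMk
    measurable_const (@measurable_ul_disturbance Ω N (N.sigmaOf _) p τ
      (measurable_bsPos_sources hb) (measurable_bsGain_sources hb) (measurable_uePos_sources hu)
      (measurable_ueGain_sources hu) (measurable_ueDist_sources hu)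
      (measurable_sigmaOf_of_comap (s := .siGain) (Or.inr (by simp [cellSources])) rfl)))
    (measurable_sigmaOf_of_comap (mem_singleton _) rfl)

lemma IsModel.indepFun_serving_ueSum (hN : N.IsModel p P) :
    IndepFun (fun ω => (N.servingDist ω,
      N.bsSum p {j | N.servingDist ω < ‖N.bsPos j ω‖} ω)) (fun ω => N.ueSum p ω) P :=
  hN.indepFun_sources _ _ disjoint_ueSources_bsSources (Measurable.prodMk
    (measurable_servingDist_sources subset_rfl) (measurable_bsSum_serving_sources subset_rfl))
    (measurable_ueSum_sources subset_rfl)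

lemma IsModel.indepFun_bsSum_ueSum (hN : N.IsModel p P) :
    IndepFun (fun ω => N.bsSum p univ ω) (fun ω => N.ueSum p ω) P :=
  hN.indepFun_sources _ _ disjoint_ueSources_bsSources (measurable_bsSum_univ_sources subset_rfl)
    (measurable_ueSum_sources subset_rfl)

lemma IsModel.indepFun_serving_ueSum_cellVars (hN : N.IsModel p P) :
    IndepFun (fun ω => ((N.servingDist ω,
      N.bsSum p {j | N.servingDist ω < ‖N.bsPos j ω‖} ω), N.ueSum p ω)) N.cellVars P :=
  hN.indepFun_sources _ _ disjoint_cellSources (Measurable.prodMk (Measurable.prodMk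
    (measurable_servingDist_sources subset_union_left)
    (measurable_bsSum_serving_sources subset_union_left))
    (measurable_ueSum_sources subset_union_right)) (measurable_cellVars_sigmaOf subset_rfl)

lemma IsModel.indepFun_bsSum_ueSum_siGain (hN : N.IsModel p P) :
    IndepFun (fun ω => (N.bsSum p univ ω, N.ueSum p ω)) N.siGain P :=
  hN.indepFun_sources _ _ disjoint_cellSources (Measurable.prodMk
    (measurable_bsSum_univ_sources subset_union_left)
    (measurable_ueSum_sources subset_union_right))
    (measurable_sigmaOf_of_comap (s := .siGain) (by simp [cellSources]) rfl)

end Network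

/-! ### Coverage probabilities in the two directions. -/

namespace Network

variable {Ω : Type*} {N : Network Ω} {p : Params}

lemma servingExponent_nonneg (p : Params) {g : ℝ} (hg : 0 ≤ g) : 0 ≤ servingExponent p g := by
  have hl := p.lam_pos
  have hη : 0 < p.η - 2 := by linarith [p.two_lt_η]
  have hF : 0 ≤ p.F (-g) := hyp2F1_pathLoss_nonneg p.two_lt_η hg
  unfold servingExponent
  positivity

/-- The downlink argument of the Laplace transform for the SINR threshold `g`. -/
def dlArg (p : Params) (g r : ℝ) : ℝ := g / (p.Pd * r ^ (-p.η) * |p.intra .dl| ^ 2)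

lemma dlArg_nonneg {g r : ℝ} (hg : 0 ≤ g) (hr : 0 ≤ r) : 0 ≤ dlArg p g r := by
  have := p.Pd_pos
  unfold dlArg
  positivity

lemma dlArg_mul_intra {g r : ℝ} (hr : 0 < r) :
    dlArg p g r * |p.intra .dl| ^ 2 = g * r ^ p.η / p.Pd := by
  have h1 := p.Pd_pos
  have h2 := abs_pos.2 (p.intra_pos .dl).ne'
  have h3 : 0 < r ^ p.η := by positivity
  unfold dlArg
  rw [Real.rpow_neg hr.le]
  field_simp

/-- The factor of the Laplace transform of the interference from users of other cells. -/
def ueFactor (p : Params) (c : ℝ) : ℝ :=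
  Real.exp (-(2 * Real.pi * p.lam * p.ρ ^ (1 - 2 / p.η)) / (p.η - 2) * p.powerMoment * c *
    p.F (-(p.ρ * c)))

@[fun_prop]
lemma measurable_ueFactor : Measurable (ueFactor p) := by
  unfold ueFactor
  fun_prop

/-- At this argument the mean exponent of a station at the serving distance is g, so the
hypergeometric argument becomes -g and the base-station factor exp(-κ(g) r²), as in the dyadic
limit. -/
lemma LId_dlArg (τ : NodeTopology) {g r : ℝ} (hr : 0 < r) :
    p.LId τ r (dlArg p g r) = Real.exp (-(servingExponent p g * r ^ 2)) *
      ueFactor p (dlArg p g r * |p.cross .dl| ^ 2) *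
      (p.U1 r (dlArg p g r) τ * p.U2 r (dlArg p g r) τ) := by
  have h1 := p.Pd_pos
  have h := dlArg_mul_intra (p := p) (g := g) hr
  have hg : r ^ (-p.η) * p.Pd * |p.intra .dl| ^ 2 * dlArg p g r = g := by
    have : r ^ (-p.η) * r ^ p.η = 1 := by rw [← Real.rpow_add hr]; simp
    rw [mul_assoc, mul_comm (|p.intra .dl| ^ 2), h, mul_assoc, mul_div_cancel₀ _ h1.ne',
      mul_left_comm, this, mul_one]
  have hr2 : r ^ (2 - p.η) = r ^ 2 * r ^ (-p.η) := by
    rw [sub_eq_add_neg, Real.rpow_add hr, Real.rpow_two]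
  unfold Params.LId ueFactor servingExponent
  rw [hg, ← mul_assoc]
  congr 4
  · rw [hr2]
    calc _ = -(2 * Real.pi * p.lam) / (p.η - 2) * r ^ 2 *
          (r ^ (-p.η) * p.Pd * |p.intra .dl| ^ 2 * dlArg p g r) * p.F (-g) := by ring
      _ = _ := by rw [hg]; ring
  · have e : p.ρ * |p.cross .dl| ^ 2 * dlArg p g r = p.ρ * (dlArg p g r * |p.cross .dl| ^ 2) := by
      ring
    rw [e]
    ring

lemma negExp_dl_disturbance (τ : NodeTopology) {g : ℝ} (hg : 0 ≤ g) {ω : Ω}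
    (hr : 0 < N.servingDist ω) :
    negExp (ENNReal.ofReal (dlArg p g (N.servingDist ω)) * N.disturbance p τ .dl ω) =
      negExp (ENNReal.ofReal (g * N.servingDist ω ^ p.η / p.Pd) *
        N.bsSum p {j | N.servingDist ω < ‖N.bsPos j ω‖} ω) *
      negExp (ENNReal.ofReal (dlArg p g (N.servingDist ω) * |p.cross .dl| ^ 2) * N.ueSum p ω) *
      negExp (ENNReal.ofReal
        (dlArg p g (N.servingDist ω) * ownCell p (N.servingDist ω) (N.cellVars ω) τ)) *
      ENNReal.ofReal (Real.exp (-(p.N0 * g / (p.Pd * N.servingDist ω ^ (-p.η))))) := by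
  have hPd := p.Pd_pos
  have hN0 := p.N0_pos
  set r := N.servingDist ω
  have hs : 0 ≤ dlArg p g r := dlArg_nonneg hg hr.le
  have h2 := abs_pos.2 (p.intra_pos .dl).ne'
  have hnoise : dlArg p g r * p.noise .dl = p.N0 * g / (p.Pd * r ^ (-p.η)) := by
    unfold dlArg Params.noise
    field_simp
  unfold disturbance
  simp only [interference]
  rw [dlOwnCell_eq, mul_add, mul_add, mul_add, ← mul_assoc, ← mul_assoc, ← ENNReal.ofReal_mul hs,
    ← ENNReal.ofReal_mul hs, ← ENNReal.ofReal_mul hs, ← ENNReal.ofReal_mul hs, negExp_add,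
    negExp_add, negExp_add, dlArg_mul_intra hr, hnoise,
    negExp_ofReal (x := p.N0 * g / (p.Pd * r ^ (-p.η))) (by positivity)]

variable [MeasurableSpace Ω] {P : Measure Ω}

lemma IsModel.lintegral_negExp_siGain_ul (hN : N.IsModel p P) {s : ℝ} (hs : 0 ≤ s) :
    ∫⁻ ω, negExp (ENNReal.ofReal
      (s * (p.β .ul * N.siGain ω * p.Pd * |p.cross .ul| ^ 2))) ∂P =
      ENNReal.ofReal (p.U3 s) := by
  have hPd := p.Pd_pos
  have hβ := p.β_nonneg .ul
  have h := lintegral_negExp_siGain hN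
    (b := s * (p.β .ul * p.Pd * |p.cross .ul| ^ 2)) (by positivity)
  unfold Params.U3
  convert h using 5
  · ring
  · ring_nf

variable [IsProbabilityMeasure P]

lemma IsModel.lintegral_negExp_ownCell (hN : N.IsModel p P) (τ : NodeTopology) {s r : ℝ}
    (hs : 0 ≤ s) (hr : 0 ≤ r) :
    ∫⁻ w, negExp (ENNReal.ofReal (s * ownCell p r w τ)) ∂(P.map N.cellVars) =
      ENNReal.ofReal (p.U1 r s τ * p.U2 r s τ) := by
  have hm : Measurable fun w => ownCell p r w τ := (measurable_ownCell p τ).comp measurable_prodMk_left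
  rw [lintegral_map (by fun_prop) hN.measurable_cellVars]
  cases τ with
  | twoNode =>
    have hρ := p.ρ_pos
    have hβ := p.β_nonneg .dl
    have h := lintegral_negExp_siGain hN
      (b := s * (p.β .dl * (p.ρ * r ^ p.η) * |p.cross .dl| ^ 2)) (by positivity)
    simp only [Params.U1, Params.U2, one_mul, ownCell, cellVars, uePower]
    convert h using 5
    · ring
    · ring_nf
  | threeNode =>
    simp only [Params.U2, mul_one]
    exact lintegral_negExp_mate hN hs

/-- The product is the Laplace transform of the own-cell interference, so the bound needs no
estimate of the integrals. -/
lemma IsModel.ofReal_U1_mul_U2_le_one (hN : N.IsModel p P) (τ : NodeTopology) {s r : ℝ}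
    (hs : 0 ≤ s) (hr : 0 ≤ r) : ENNReal.ofReal (p.U1 r s τ * p.U2 r s τ) ≤ 1 := by
  rw [← hN.lintegral_negExp_ownCell τ hs hr]
  have : IsProbabilityMeasure (P.map N.cellVars) :=
    Measure.isProbabilityMeasure_map hN.measurable_cellVars.aemeasurable
  exact lintegral_negExp_le_one _

/-- Integrating out the test cell and the users of other cells, given the base stations. -/
lemma IsModel.lintegral_serving_mul (hN : N.IsModel p P) {k V w : ℝ → ℝ≥0∞} {b u : ℝ → ℝ≥0∞ → ℝ≥0∞}
    {o : ℝ → ℝ × ℝ × ℝ × ℝ → ℝ≥0∞} (hk : Measurable k) (hV : Measurable V)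
    (hb : Measurable fun z : ℝ × ℝ≥0∞ => b z.1 z.2) (hu : Measurable fun z : ℝ × ℝ≥0∞ => u z.1 z.2)
    (ho : Measurable fun z : ℝ × ℝ × ℝ × ℝ × ℝ => o z.1 z.2)
    (hoV : ∀ r, 0 < r → ∫⁻ x, o r x ∂(P.map N.cellVars) = V r)
    (huw : ∀ r, 0 < r → ∫⁻ ω, u r (N.ueSum p ω) ∂P = w r) :
    ∫⁻ ω, k (N.servingDist ω) * b (N.servingDist ω)
        (N.bsSum p {j | N.servingDist ω < ‖N.bsPos j ω‖} ω) *
        u (N.servingDist ω) (N.ueSum p ω) * o (N.servingDist ω) (N.cellVars ω) ∂P =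
      ∫⁻ ω, (k (N.servingDist ω) * V (N.servingDist ω) * w (N.servingDist ω)) *
        b (N.servingDist ω) (N.bsSum p {j | N.servingDist ω < ‖N.bsPos j ω‖} ω) ∂P := by
  have hR := measurable_servingDist hN.measurable_bsPos
  have hBs := measurable_bsSum_serving p hN.measurable_bsPos hN.measurable_bsGain
  have hUe := measurable_ueSum p hN.measurable_uePos hN.measurable_ueGain hN.measurable_ueDist
  -- The own-cell variables are integrated first and the users of other cells next. The serving
  -- distance and the base-station field stay together, as they are dependent.
  have hint1 := lintegral_indepFun hN.indepFun_serving_ueSum_cellVars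
    ((hR.prodMk hBs).prodMk hUe) hN.measurable_cellVars
    (F := fun y w => k y.1.1 * b y.1.1 y.1.2 * u y.1.1 y.2 * o y.1.1 w) (by
      have e1 : Measurable fun z : ((ℝ × ℝ≥0∞) × ℝ≥0∞) × ℝ × ℝ × ℝ × ℝ => b z.1.1.1 z.1.1.2 :=
        hb.comp measurable_fst.fst
      have e2 : Measurable fun z : ((ℝ × ℝ≥0∞) × ℝ≥0∞) × ℝ × ℝ × ℝ × ℝ => u z.1.1.1 z.1.2 :=
        hu.comp (measurable_fst.fst.fst.prodMk measurable_fst.snd)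
      have e3 : Measurable fun z : ((ℝ × ℝ≥0∞) × ℝ≥0∞) × ℝ × ℝ × ℝ × ℝ => o z.1.1.1 z.2 :=
        ho.comp (measurable_fst.fst.fst.prodMk measurable_snd)
      have e4 : Measurable fun z : ((ℝ × ℝ≥0∞) × ℝ≥0∞) × ℝ × ℝ × ℝ × ℝ => k z.1.1.1 :=
        hk.comp measurable_fst.fst.fst
      exact ((e4.mul e1).mul e2).mul e3)
  have hV' : ∀ᵐ ω ∂P, ∫⁻ x, k (N.servingDist ω) * b (N.servingDist ω)
        (N.bsSum p {j | N.servingDist ω < ‖N.bsPos j ω‖} ω) *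
        u (N.servingDist ω) (N.ueSum p ω) * o (N.servingDist ω) x ∂(P.map N.cellVars) =
      k (N.servingDist ω) * V (N.servingDist ω) * b (N.servingDist ω)
        (N.bsSum p {j | N.servingDist ω < ‖N.bsPos j ω‖} ω) *
        u (N.servingDist ω) (N.ueSum p ω) := by
    filter_upwards [hN.ae_servingDist_pos] with ω hω
    have hox : Measurable fun x => o (N.servingDist ω) x := ho.comp measurable_prodMk_left
    rw [lintegral_const_mul _ hox, hoV _ hω]
    ring
  have hint2 := lintegral_indepFun hN.indepFun_serving_ueSum (hR.prodMk hBs) hUe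
    (F := fun y x => k y.1 * V y.1 * b y.1 y.2 * u y.1 x) (by
      have e1 : Measurable fun z : (ℝ × ℝ≥0∞) × ℝ≥0∞ => b z.1.1 z.1.2 := hb.comp measurable_fst
      have e2 : Measurable fun z : (ℝ × ℝ≥0∞) × ℝ≥0∞ => u z.1.1 z.2 :=
        hu.comp (measurable_fst.fst.prodMk measurable_snd)
      have e4 : Measurable fun z : (ℝ × ℝ≥0∞) × ℝ≥0∞ => k z.1.1 * V z.1.1 :=
        (hk.mul hV).comp measurable_fst.fst
      exact (e4.mul e1).mul e2)
  rw [hint1, lintegral_congr_ae hV', hint2]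
  refine lintegral_congr_ae ?_
  filter_upwards [hN.ae_servingDist_pos] with ω hω
  have hux : Measurable fun x => u (N.servingDist ω) x := hu.comp measurable_prodMk_left
  rw [lintegral_const_mul _ hux, lintegral_map hux hUe, huw _ hω]
  ring

lemma measurable_LId_dlArg (p : Params) (τ : NodeTopology) (g : ℝ) :
    Measurable fun r => p.LId τ r (dlArg p g r) := by
  have hsm : Measurable (dlArg p g) := by
    unfold dlArg
    fun_prop
  obtain ⟨a, ha⟩ : ∃ a, a = dlArg p g := ⟨_, rfl⟩
  have h := p.measurable_LId τ
  obtain ⟨f, hf⟩ : ∃ f, f = p.LId τ := ⟨_, rfl⟩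
  rw [← ha] at hsm ⊢
  rw [← hf] at h ⊢
  exact h.comp (measurable_id.prodMk hsm)

lemma IsModel.lintegral_dl_disturbance (hN : N.IsModel p P) (τ : NodeTopology) {g : ℝ}
    (hg : 0 < g) :
    ∫⁻ ω, (Iic p.RM).indicator 1 (N.servingDist ω) *
      negExp (ENNReal.ofReal (dlArg p g (N.servingDist ω)) * N.disturbance p τ .dl ω) ∂P =
    ∫⁻ ω, (Iic p.RM).indicator 1 (N.servingDist ω) *
      ENNReal.ofReal (Real.exp (-(p.N0 * g / (p.Pd * N.servingDist ω ^ (-p.η)))) *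
        p.LId τ (N.servingDist ω) (dlArg p g (N.servingDist ω))) ∂P := by
  have hsm : Measurable (dlArg p g) := by
    unfold dlArg
    fun_prop
  obtain ⟨n, hn⟩ : ∃ n : ℝ → ℝ≥0∞, n = fun r =>
    ENNReal.ofReal (Real.exp (-(p.N0 * g / (p.Pd * r ^ (-p.η))))) := ⟨_, rfl⟩
  have hnm : Measurable n := by rw [hn]; fun_prop
  obtain ⟨i, hi⟩ : ∃ i : ℝ → ℝ≥0∞, i = (Iic p.RM).indicator 1 := ⟨_, rfl⟩
  have him : Measurable i := by rw [hi]; exact measurable_one.indicator measurableSet_Iic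
  have e : Measurable fun r => (r, dlArg p g r) := measurable_id.prodMk hsm
  have hV : Measurable fun r =>
      ENNReal.ofReal (p.U1 r (dlArg p g r) τ * p.U2 r (dlArg p g r) τ) :=
    (((p.measurable_U1 τ).comp e).mul ((p.measurable_U2 τ).comp e)).ennreal_ofReal
  have how := measurable_ownCell p τ
  have hsplit := hN.lintegral_serving_mul (k := fun r => i r * n r)
    (V := fun r => ENNReal.ofReal (p.U1 r (dlArg p g r) τ * p.U2 r (dlArg p g r) τ))
    (w := fun r => ENNReal.ofReal (ueFactor p (dlArg p g r * |p.cross .dl| ^ 2)))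
    (b := fun r x => negExp (ENNReal.ofReal (g * r ^ p.η / p.Pd) * x))
    (u := fun r x => negExp (ENNReal.ofReal (dlArg p g r * |p.cross .dl| ^ 2) * x))
    (o := fun r x => negExp (ENNReal.ofReal (dlArg p g r * ownCell p r x τ)))
    (him.mul hnm) hV (by fun_prop) (by fun_prop) (by fun_prop)
    (fun r hr => hN.lintegral_negExp_ownCell τ (dlArg_nonneg hg.le hr.le) hr.le)
    (fun r hr => hN.lintegral_negExp_ueSum
      (mul_nonneg (dlArg_nonneg hg.le hr.le) (sq_nonneg _)))
  -- All other factors are by now functions of the serving distance, so they form the test function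
  -- in the base-station identity.
  have hserv := hN.lintegral_negExp_bsSum_serving hg (f := fun r => i r * n r *
      ENNReal.ofReal (p.U1 r (dlArg p g r) τ * p.U2 r (dlArg p g r) τ) *
      ENNReal.ofReal (ueFactor p (dlArg p g r * |p.cross .dl| ^ 2)))
    (((him.mul hnm).mul hV).mul (by fun_prop))
  rw [← hi]
  have h1 : ∀ᵐ ω ∂P, i (N.servingDist ω) * negExp (ENNReal.ofReal
      (dlArg p g (N.servingDist ω)) * N.disturbance p τ .dl ω) =
      i (N.servingDist ω) * n (N.servingDist ω) *
      negExp (ENNReal.ofReal (g * N.servingDist ω ^ p.η / p.Pd) *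
        N.bsSum p {j | N.servingDist ω < ‖N.bsPos j ω‖} ω) *
      negExp (ENNReal.ofReal (dlArg p g (N.servingDist ω) * |p.cross .dl| ^ 2) * N.ueSum p ω) *
      negExp (ENNReal.ofReal
        (dlArg p g (N.servingDist ω) * ownCell p (N.servingDist ω) (N.cellVars ω) τ)) := by
    filter_upwards [hN.ae_servingDist_pos] with ω hω
    rw [negExp_dl_disturbance τ hg.le hω, hn]
    ring
  rw [lintegral_congr_ae h1, hsplit, hserv]
  refine lintegral_congr_ae ?_
  filter_upwards [hN.ae_servingDist_pos] with ω hω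
  have hue : 0 ≤ ueFactor p (dlArg p g (N.servingDist ω) * |p.cross .dl| ^ 2) :=
    (Real.exp_pos _).le
  rw [LId_dlArg τ hω, ENNReal.ofReal_mul (Real.exp_pos _).le,
    ENNReal.ofReal_mul (mul_nonneg (Real.exp_pos _).le hue), ENNReal.ofReal_mul (Real.exp_pos _).le,
    hn]
  ring

/-- Downlink coverage probability. -/
theorem IsModel.measure_lt_dl_SINR (hN : N.IsModel p P) (τ : NodeTopology) {g : ℝ} (hg : 0 < g) :
    N.testMeasure p P .dl {ω | g < N.SINR p τ .dl ω} =
      ∫⁻ r in Ioc 0 p.RM, ENNReal.ofReal (p.fR r *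
        (Real.exp (-(p.N0 * g / (p.Pd * r ^ (-p.η)))) * p.LId τ r (dlArg p g r))) := by
  have hPd := p.Pd_pos
  have hintra := abs_pos.2 (p.intra_pos .dl).ne'
  have hR := measurable_servingDist hN.measurable_bsPos
  have hJ := measurable_dl_disturbance p τ hN.measurable_bsPos hN.measurable_bsGain
      hN.measurable_uePos hN.measurable_ueGain hN.measurable_ueDist hN.measurable_cellVars
  have hcov := measure_lt_sinr hR hN.measurable_desiredGain hJ hN.law_desiredGain
    (hN.indepFun_dl_desiredGain τ) (S := Iic p.RM) measurableSet_Iic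
    (Q := fun r => p.Pd * r ^ (-p.η) * |p.intra .dl| ^ 2) (by fun_prop)
    (hN.ae_servingDist_pos.mono fun ω h => by positivity) (disturbance_ne_zero τ .dl) hg
  have hset : N.active p ∩ {ω | g < N.SINR p τ .dl ω} = {ω | N.servingDist ω ∈ Iic p.RM ∧
      g < (ENNReal.ofReal (p.Pd * N.servingDist ω ^ (-p.η) * |p.intra .dl| ^ 2 *
        N.desiredGain ω) / N.disturbance p τ .dl ω).toReal} := by
    ext ω
    simp only [mem_inter_iff, mem_active_iff, mem_ofPred_eq, mem_Iic, SINR_eq, dl_signal_eq]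
  have hL := measurable_LId_dlArg p τ g
  have hf : Measurable fun r => ENNReal.ofReal
      (Real.exp (-(p.N0 * g / (p.Pd * r ^ (-p.η)))) * p.LId τ r (dlArg p g r)) := by
    have hE : Measurable fun r : ℝ => Real.exp (-(p.N0 * g / (p.Pd * r ^ (-p.η)))) := by fun_prop
    exact (hE.mul hL).ennreal_ofReal
  have hfin : ∀ f : ℝ → ℝ≥0∞, ∫⁻ ω, (Iic p.RM).indicator 1 (N.servingDist ω) *
      f (N.servingDist ω) ∂P = ∫⁻ ω in N.active p, f (N.servingDist ω) ∂P := by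
    intro f
    rw [← lintegral_indicator hN.measurableSet_active]
    refine lintegral_congr fun ω => ?_
    by_cases h : N.servingDist ω ≤ p.RM
    · rw [indicator_of_mem (mem_active_iff.2 h), indicator_of_mem (mem_Iic.2 h), Pi.one_apply,
        one_mul]
    · rw [indicator_of_notMem (mt mem_active_iff.1 h), indicator_of_notMem (by simpa using h),
        zero_mul]
  have hdl := (hN.lintegral_dl_disturbance τ hg).trans (hfin fun r => ENNReal.ofReal
    (Real.exp (-(p.N0 * g / (p.Pd * r ^ (-p.η)))) * p.LId τ r (dlArg p g r)))
  have hact := hN.lintegral_active_servingDist hf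
  change (ProbabilityTheory.cond P (N.active p)) {ω | g < N.SINR p τ .dl ω} = _
  rw [cond_apply hN.measurableSet_active, hset, hcov]
  unfold dlArg at hdl hact ⊢
  rw [hdl, hact]
  refine setLIntegral_congr_fun measurableSet_Ioc fun r hr => ?_
  rw [ENNReal.ofReal_mul (p.fR_nonneg hr.1.le)]

/-- Uplink coverage probability. -/
theorem IsModel.measure_lt_ul_SINR (hN : N.IsModel p P) (τ : NodeTopology) {g : ℝ} (hg : 0 < g) :
    N.testMeasure p P .ul {ω | g < N.SINR p τ .ul ω} =
      ENNReal.ofReal (Real.exp (-(p.N0 * g / p.ρ)) *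
        p.LIu (g / (p.ρ * |p.intra .ul| ^ 2))) := by
  have hPd := p.Pd_pos
  have hρ := p.ρ_pos
  have hN0 := p.N0_pos
  have hβ := p.β_nonneg .ul
  have hintra := abs_pos.2 (p.intra_pos .ul).ne'
  have hBs := measurable_bsSum_univ p hN.measurable_bsPos hN.measurable_bsGain
  have hUe := measurable_ueSum p hN.measurable_uePos hN.measurable_ueGain hN.measurable_ueDist
  have hJ := measurable_ul_disturbance p τ hN.measurable_bsPos hN.measurable_bsGain
      hN.measurable_uePos hN.measurable_ueGain hN.measurable_ueDist hN.measurable_siGain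
  have hcov := measure_lt_sinr measurable_const hN.measurable_desiredGain hJ hN.law_desiredGain
    (hN.indepFun_ul_desiredGain τ) (S := univ) MeasurableSet.univ
    (Q := fun _ => p.ρ * |p.intra .ul| ^ 2) (by fun_prop)
    (ae_of_all _ fun ω => by positivity) (disturbance_ne_zero τ .ul) hg
  simp only [mem_univ, true_and, indicator_univ, Pi.one_apply, one_mul] at hcov
  have hdpos : ∀ᵐ ω ∂P, 0 < N.ulDist ω :=
    ae_of_ae_map hN.measurable_ulDist.aemeasurable (hN.law_ulDist ▸ hN.ae_linkDistLaw_pos)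
  have hset : P {ω | g < N.SINR p τ .ul ω} = P {ω | g < (ENNReal.ofReal
      (p.ρ * |p.intra .ul| ^ 2 * N.desiredGain ω) / N.disturbance p τ .ul ω).toReal} := by
    refine measure_congr ?_
    filter_upwards [hdpos] with ω hω
    refine propext ?_
    change g < N.SINR p τ .ul ω ↔ g < (ENNReal.ofReal
      (p.ρ * |p.intra .ul| ^ 2 * N.desiredGain ω) / N.disturbance p τ .ul ω).toReal
    rw [SINR_eq, ul_signal_eq hω]
  obtain ⟨s, hs_def⟩ : ∃ s, s = g / (p.ρ * |p.intra .ul| ^ 2) := ⟨_, rfl⟩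
  have hs : 0 ≤ s := by rw [hs_def]; positivity
  rw [← hs_def] at hcov ⊢
  have hnoise : s * p.noise .ul = p.N0 * g / p.ρ := by
    rw [hs_def]
    unfold Params.noise
    field_simp
  have h1 : ∀ ω, negExp (ENNReal.ofReal s * N.disturbance p τ .ul ω) =
      ENNReal.ofReal (Real.exp (-(p.N0 * g / p.ρ))) *
      (negExp (ENNReal.ofReal (s * |p.cross .ul| ^ 2) * N.bsSum p univ ω) *
      negExp (ENNReal.ofReal (s * |p.intra .ul| ^ 2) * N.ueSum p ω) *
      negExp (ENNReal.ofReal (s * (p.β .ul * N.siGain ω * p.Pd * |p.cross .ul| ^ 2)))) := by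
    intro ω
    unfold disturbance
    simp only [interference]
    rw [mul_add, mul_add, mul_add, ← mul_assoc, ← mul_assoc, ← ENNReal.ofReal_mul hs,
      ← ENNReal.ofReal_mul hs, ← ENNReal.ofReal_mul hs, ← ENNReal.ofReal_mul hs, negExp_add,
      negExp_add, negExp_add, hnoise, negExp_ofReal (x := p.N0 * g / p.ρ) (by positivity)]
    ring
  have hint1 := lintegral_indepFun hN.indepFun_bsSum_ueSum_siGain (hBs.prodMk hUe)
    hN.measurable_siGain
    (F := fun y h => negExp (ENNReal.ofReal (s * |p.cross .ul| ^ 2) * y.1) *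
      negExp (ENNReal.ofReal (s * |p.intra .ul| ^ 2) * y.2) *
      negExp (ENNReal.ofReal (s * (p.β .ul * h * p.Pd * |p.cross .ul| ^ 2))))
    (by unfold Function.uncurry; fun_prop)
  have hint2 := lintegral_indepFun hN.indepFun_bsSum_ueSum hBs hUe
    (F := fun x y => negExp (ENNReal.ofReal (s * |p.cross .ul| ^ 2) * x) *
      negExp (ENNReal.ofReal (s * |p.intra .ul| ^ 2) * y))
    (by unfold Function.uncurry; fun_prop)
  have e1 : ∫⁻ h, negExp (ENNReal.ofReal (s * (p.β .ul * h * p.Pd * |p.cross .ul| ^ 2)))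
      ∂(P.map N.siGain) = ENNReal.ofReal (p.U3 s) := by
    rw [lintegral_map (by fun_prop) hN.measurable_siGain, hN.lintegral_negExp_siGain_ul hs]
  have e2 : ∫⁻ y, negExp (ENNReal.ofReal (s * |p.intra .ul| ^ 2) * y)
      ∂(P.map fun ω => N.ueSum p ω) = ENNReal.ofReal (ueFactor p (s * |p.intra .ul| ^ 2)) := by
    rw [lintegral_map (by fun_prop) hUe, hN.lintegral_negExp_ueSum (by positivity)]
    rfl
  have e3 : ∀ y : ℝ≥0∞ × ℝ≥0∞, Measurable fun h : ℝ => negExp (ENNReal.ofReal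
      (s * (p.β .ul * h * p.Pd * |p.cross .ul| ^ 2))) := fun y => by fun_prop
  change P {ω | g < N.SINR p τ .ul ω} = _
  rw [hset, hcov]
  simp_rw [h1]
  rw [lintegral_const_mul' _ _ ENNReal.ofReal_ne_top, hint1]
  -- The argument of `e3` is a dummy; the function does not depend on it.
  simp_rw [lintegral_const_mul _ (e3 (0, 0)), e1]
  rw [lintegral_mul_const' _ _ ENNReal.ofReal_ne_top, hint2]
  have e4 : Measurable fun y : ℝ≥0∞ => negExp (ENNReal.ofReal (s * |p.intra .ul| ^ 2) * y) := by
    fun_prop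
  simp_rw [lintegral_const_mul _ e4, e2]
  rw [lintegral_mul_const' _ _ ENNReal.ofReal_ne_top,
    hN.lintegral_negExp_bsSum_univ (by positivity), ← ENNReal.ofReal_mul (Real.exp_pos _).le,
    ← ENNReal.ofReal_mul (mul_nonneg (Real.exp_pos _).le
      (show 0 ≤ ueFactor p (s * |p.intra .ul| ^ 2) from (Real.exp_pos _).le)),
    ← ENNReal.ofReal_mul (Real.exp_pos _).le]
  congr 1
  unfold Params.LIu ueFactor
  have e5 : p.ρ * |p.intra .ul| ^ 2 * s = p.ρ * (s * |p.intra .ul| ^ 2) := by ring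
  rw [e5]
  congr 2
  rw [mul_comm (Real.exp _)]
  congr 2
  ring

end Network

/-! ### Integrability and the rate formulas. -/

lemma integrable_and_integral_eq {α β : Type*} [MeasurableSpace α] [MeasurableSpace β]
    {μ : Measure α} {ν : Measure β} {f : α → ℝ} {h : β → ℝ} (hf : Measurable f)
    (hf0 : 0 ≤ᵐ[μ] f) (hh : Measurable h) (hh0 : 0 ≤ᵐ[ν] h)
    (heq : ∫⁻ x, ENNReal.ofReal (f x) ∂μ = ∫⁻ y, ENNReal.ofReal (h y) ∂ν)
    (hfin : ∫⁻ y, ENNReal.ofReal (h y) ∂ν ≠ ⊤) :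
    Integrable f μ ∧ Integrable h ν ∧ ∫ x, f x ∂μ = ∫ y, h y ∂ν := by
  refine ⟨(lintegral_ofReal_ne_top_iff_integrable hf.aestronglyMeasurable hf0).1 (heq ▸ hfin),
    (lintegral_ofReal_ne_top_iff_integrable hh.aestronglyMeasurable hh0).1 hfin, ?_⟩
  rw [integral_eq_lintegral_of_nonneg_ae hf0 hf.aestronglyMeasurable,
    integral_eq_lintegral_of_nonneg_ae hh0 hh.aestronglyMeasurable, heq]

/-- Separating g ≤ 1 from g ≥ 1 shows g^(1-a) ≤ g + 1. The power makes the integral in g a Gamma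
integral with a free exponent a. -/
lemma inv_add_one_le_rpow {a g : ℝ} (ha : 0 < a) (ha1 : a ≤ 1) (hg : 0 < g) :
    (g + 1)⁻¹ ≤ g ^ (a - 1) := by
  have h : g ^ (1 - a) ≤ g + 1 := by
    rcases le_total g 1 with h | h
    · linarith [Real.rpow_le_one hg.le h (by linarith : 0 ≤ 1 - a)]
    · have := Real.rpow_le_rpow_of_exponent_le h (by linarith : 1 - a ≤ 1)
      rw [Real.rpow_one] at this
      linarith
  have e : g ^ (a - 1) = (g ^ (1 - a))⁻¹ := by rw [← Real.rpow_neg hg.le, neg_sub]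
  rw [e]
  exact inv_anti₀ (by positivity) h

lemma lintegral_exp_div_add_one_le {a b : ℝ} (ha : 0 < a) (ha1 : a ≤ 1) (hb : 0 < b) :
    ∫⁻ g in Ioi (0 : ℝ), ENNReal.ofReal ((g + 1)⁻¹ * Real.exp (-(b * g))) ≤
      ENNReal.ofReal ((1 / b) ^ a * Real.Gamma a) := by
  rw [← lintegral_rpow_mul_exp_neg_mul_Ioi ha hb]
  refine setLIntegral_mono' measurableSet_Ioi fun g hg => ENNReal.ofReal_le_ofReal ?_
  exact mul_le_mul_of_nonneg_right (inv_add_one_le_rpow ha ha1 hg) (Real.exp_pos _).le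

namespace Params

variable (p : Params)

lemma dlIntegrand_eq (τ : NodeTopology) (g r : ℝ) : p.dlIntegrand τ g r =
    p.fR r * (Real.exp (-(p.N0 * g / (p.Pd * r ^ (-p.η)))) * p.LId τ r (Network.dlArg p g r)) *
      (p.bw .dl / ((g + 1) * Real.log 2)) := by
  unfold dlIntegrand Network.dlArg
  ring

lemma dlIntegrand_nonneg (τ : NodeTopology) {g r : ℝ} (hg : 0 ≤ g) (hr : 0 ≤ r) :
    0 ≤ p.dlIntegrand τ g r := by
  rw [dlIntegrand_eq]
  have h1 := p.fR_nonneg hr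
  have h2 := p.LId_nonneg (r := r) (Network.dlArg_nonneg (p := p) hg hr) τ
  have h3 := p.bw_pos .dl
  have h4 : 0 < Real.log 2 := Real.log_pos one_lt_two
  positivity

lemma ulIntegrand_nonneg {g : ℝ} (hg : 0 ≤ g) : 0 ≤ p.ulIntegrand g := by
  have h2 := p.LIu_nonneg (g / (p.ρ * |p.intra .ul| ^ 2))
  have h3 := p.bw_pos .ul
  have h4 : 0 < Real.log 2 := Real.log_pos one_lt_two
  unfold ulIntegrand
  positivity

end Params

namespace Network

variable {Ω : Type*} {N : Network Ω} {p : Params}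

lemma rate_nonneg (τ : NodeTopology) (v : Direction) (ω : Ω) : 0 ≤ N.rate p τ v ω := by
  have h : 0 ≤ N.SINR p τ v ω := ENNReal.toReal_nonneg
  exact mul_nonneg (p.bw_pos v).le (Real.logb_nonneg one_lt_two (by linarith))

variable [MeasurableSpace Ω] {P : Measure Ω}

lemma IsModel.measurable_rate (hN : N.IsModel p P) (τ : NodeTopology) (v : Direction) :
    Measurable (N.rate p τ v) := by
  have h := hN.measurable_SINR τ v
  unfold rate Real.logb
  fun_prop

variable [IsProbabilityMeasure P]

/-- A Laplace transform of a nonnegative variable is at most 1; the sign of the exponent need not be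
examined. -/
lemma IsModel.ueFactor_le_one (hN : N.IsModel p P) {c : ℝ} (hc : 0 ≤ c) : ueFactor p c ≤ 1 := by
  rw [← ENNReal.ofReal_le_one]
  exact (hN.lintegral_negExp_ueSum hc).symm.trans_le (lintegral_negExp_le_one _)

lemma IsModel.LId_dlArg_le_one (hN : N.IsModel p P) (τ : NodeTopology) {g r : ℝ} (hg : 0 ≤ g)
    (hr : 0 < r) : p.LId τ r (dlArg p g r) ≤ 1 := by
  have hs : 0 ≤ dlArg p g r := dlArg_nonneg hg hr.le
  rw [LId_dlArg τ hr]
  have h1 : Real.exp (-(servingExponent p g * r ^ 2)) ≤ 1 :=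
    Real.exp_le_one_iff.2 (neg_nonpos.2 (mul_nonneg (servingExponent_nonneg p hg) (sq_nonneg r)))
  have h2 := hN.ueFactor_le_one (c := dlArg p g r * |p.cross .dl| ^ 2) (by positivity)
  have h3 := ENNReal.ofReal_le_one.1 (hN.ofReal_U1_mul_U2_le_one τ hs hr.le)
  have h4 : 0 ≤ p.U1 r (dlArg p g r) τ * p.U2 r (dlArg p g r) τ :=
    mul_nonneg (p.U1_nonneg hs τ) (p.U2_nonneg r _ τ)
  exact mul_le_one₀ (mul_le_one₀ h1 (Real.exp_pos _).le h2) h4 h3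

lemma IsModel.LIu_le_one (hN : N.IsModel p P) {s : ℝ} (hs : 0 ≤ s) : p.LIu s ≤ 1 := by
  have h1 := (hN.lintegral_negExp_ueSum (c := |p.intra .ul| ^ 2 * s) (by positivity)).symm.trans_le
    (lintegral_negExp_le_one _)
  have h2 := (hN.lintegral_negExp_bsSum_univ (c := s * |p.cross .ul| ^ 2)
    (by positivity)).symm.trans_le (lintegral_negExp_le_one _)
  have h3 := (hN.lintegral_negExp_siGain_ul hs).symm.trans_le (lintegral_negExp_le_one _)
  rw [ENNReal.ofReal_le_one] at h1 h2 h3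
  rw [← mul_assoc, ← mul_assoc] at h1
  exact mul_le_one₀ (mul_le_one₀ h1 (Real.exp_pos _).le h2) (p.U3_nonneg s) h3

lemma IsModel.lintegral_ulIntegrand_ne_top (hN : N.IsModel p P) :
    ∫⁻ g in Ioi (0 : ℝ), ENNReal.ofReal (p.ulIntegrand g) ≠ ⊤ := by
  have hρ := p.ρ_pos
  have hN0 := p.N0_pos
  have hB := p.bw_pos .ul
  have hlog : 0 < Real.log 2 := Real.log_pos one_lt_two
  have hle : ∀ g ∈ Ioi (0 : ℝ), ENNReal.ofReal (p.ulIntegrand g) ≤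
      ENNReal.ofReal (p.bw .ul / Real.log 2) *
        ENNReal.ofReal ((g + 1)⁻¹ * Real.exp (-(p.N0 / p.ρ * g))) := by
    intro g hg
    have hg' : 0 < g := hg
    rw [← ENNReal.ofReal_mul (by positivity)]
    refine ENNReal.ofReal_le_ofReal ?_
    have h := hN.LIu_le_one (s := g / (p.ρ * |p.intra .ul| ^ 2)) (by positivity)
    unfold Params.ulIntegrand
    refine (mul_le_of_le_one_right (by positivity) h).trans_eq ?_
    rw [mul_div_right_comm]
    field_simp
  refine ((setLIntegral_mono' measurableSet_Ioi hle).trans_lt ?_).ne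
  rw [lintegral_const_mul _ (by fun_prop)]
  exact ENNReal.mul_lt_top ENNReal.ofReal_lt_top
    ((lintegral_exp_div_add_one_le one_pos le_rfl (by positivity)).trans_lt ENNReal.ofReal_lt_top)

/-- The noise decays at rate proportional to r^η, so exponent a in the Gamma bound costs r^(-ηa).
With a = 1/η this is 1/r, which the factor r of `fR` cancels, and the bound is uniform in r. With a
= 1 it would be r^(-η), too singular at 0. -/
lemma IsModel.lintegral_dlIntegrand_le (hN : N.IsModel p P) (τ : NodeTopology) {r : ℝ}
    (hr : 0 < r) :
    ∫⁻ g in Ioi (0 : ℝ), ENNReal.ofReal (p.dlIntegrand τ g r) ≤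
      ENNReal.ofReal (p.bw .dl / Real.log 2 *
        (2 * Real.pi * p.lam / (1 - Real.exp (-(Real.pi * p.lam * p.RM ^ 2)))) *
        ((p.Pd / p.N0) ^ (1 / p.η) * Real.Gamma (1 / p.η))) := by
  have hPd := p.Pd_pos
  have hN0 := p.N0_pos
  have hl := p.lam_pos
  have hη := p.two_lt_η
  have hη0 : 0 < p.η := by linarith
  have hB := p.bw_pos .dl
  have hT := p.truncation_pos
  have hlog : 0 < Real.log 2 := Real.log_pos one_lt_two
  have hG : 0 < Real.Gamma (1 / p.η) := Real.Gamma_pos_of_pos (by positivity)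
  have hfR := p.fR_nonneg hr.le
  have hle : ∀ g ∈ Ioi (0 : ℝ), ENNReal.ofReal (p.dlIntegrand τ g r) ≤
      ENNReal.ofReal (p.fR r * (p.bw .dl / Real.log 2)) *
        ENNReal.ofReal ((g + 1)⁻¹ * Real.exp (-(p.N0 / p.Pd * r ^ p.η * g))) := by
    intro g hg
    have hg' : 0 < g := hg
    rw [← ENNReal.ofReal_mul (by positivity)]
    refine ENNReal.ofReal_le_ofReal ?_
    have h := hN.LId_dlArg_le_one τ hg'.le hr
    have e : p.N0 * g / (p.Pd * r ^ (-p.η)) = p.N0 / p.Pd * r ^ p.η * g := by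
      rw [Real.rpow_neg hr.le]
      have : 0 < r ^ p.η := by positivity
      field_simp
    rw [p.dlIntegrand_eq, e]
    refine (mul_le_mul_of_nonneg_right (mul_le_mul_of_nonneg_left
      (mul_le_of_le_one_right (Real.exp_pos _).le h) hfR) (by positivity)).trans_eq ?_
    field_simp
  refine (setLIntegral_mono' measurableSet_Ioi hle).trans ?_
  rw [lintegral_const_mul _ (by fun_prop)]
  refine (mul_le_mul_right (lintegral_exp_div_add_one_le (a := 1 / p.η) (by positivity)
    ((div_le_one hη0).2 (by linarith)) (by positivity)) _).trans ?_
  rw [← ENNReal.ofReal_mul (by positivity)]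
  refine ENNReal.ofReal_le_ofReal ?_
  have e : (1 / (p.N0 / p.Pd * r ^ p.η)) ^ (1 / p.η) = (p.Pd / p.N0) ^ (1 / p.η) * r⁻¹ := by
    have : 1 / (p.N0 / p.Pd * r ^ p.η) = p.Pd / p.N0 * (r⁻¹) ^ p.η := by
      rw [Real.inv_rpow hr.le]
      field_simp
    rw [this, Real.mul_rpow (by positivity) (by positivity), one_div,
      Real.rpow_rpow_inv (by positivity) hη0.ne']
  have hf : p.fR r * r⁻¹ ≤
      2 * Real.pi * p.lam / (1 - Real.exp (-(Real.pi * p.lam * p.RM ^ 2))) := by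
    have h1 : Real.exp (-(Real.pi * p.lam * r ^ 2)) ≤ 1 :=
      Real.exp_le_one_iff.2 (neg_nonpos.2 (by positivity))
    have : p.fR r * r⁻¹ = 2 * Real.pi * p.lam /
        (1 - Real.exp (-(Real.pi * p.lam * p.RM ^ 2))) *
        Real.exp (-(Real.pi * p.lam * r ^ 2)) := by
      unfold Params.fR
      field_simp
    rw [this]
    exact mul_le_of_le_one_right (by positivity) h1
  rw [e]
  calc _ = p.bw .dl / Real.log 2 * (p.fR r * r⁻¹) *
        ((p.Pd / p.N0) ^ (1 / p.η) * Real.Gamma (1 / p.η)) := by ring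
    _ ≤ _ := by gcongr

/-- After exchanging the integrals, a bound uniform in r is integrated over a bounded interval. -/
lemma IsModel.lintegral_dlIntegrand_ne_top (hN : N.IsModel p P) (τ : NodeTopology) :
    ∫⁻ g in Ioi (0 : ℝ), ∫⁻ r in Ioc 0 p.RM, ENNReal.ofReal (p.dlIntegrand τ g r) ≠ ⊤ := by
  rw [lintegral_lintegral_swap (p.measurable_dlIntegrand τ).ennreal_ofReal.aemeasurable]
  refine ((setLIntegral_mono' measurableSet_Ioc fun r hr =>
    hN.lintegral_dlIntegrand_le τ hr.1).trans_lt ?_).ne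
  rw [setLIntegral_const]
  exact ENNReal.mul_lt_top ENNReal.ofReal_lt_top measure_Ioc_lt_top

lemma IsModel.lintegral_dl_rate (hN : N.IsModel p P) (τ : NodeTopology) :
    ∫⁻ ω, ENNReal.ofReal (N.rate p τ .dl ω) ∂(N.testMeasure p P .dl) =
      ∫⁻ g in Ioi (0 : ℝ), ∫⁻ r in Ioc 0 p.RM, ENNReal.ofReal (p.dlIntegrand τ g r) := by
  have : IsProbabilityMeasure (N.testMeasure p P .dl) := hN.isProbabilityMeasure_cond_active
  have hB := p.bw_pos .dl
  have hlog : 0 < Real.log 2 := Real.log_pos one_lt_two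
  refine (lintegral_logb_one_add _ (hN.measurable_SINR τ .dl)
    (fun ω => ENNReal.toReal_nonneg) hB.le).trans ?_
  refine setLIntegral_congr_fun measurableSet_Ioi fun g hg => ?_
  have hg' : 0 < g := hg
  rw [hN.measure_lt_dl_SINR τ hg, ← lintegral_mul_const' _ _ ENNReal.ofReal_ne_top]
  refine lintegral_congr fun r => ?_
  rw [← ENNReal.ofReal_mul' (by positivity), p.dlIntegrand_eq]

lemma IsModel.lintegral_ul_rate (hN : N.IsModel p P) (τ : NodeTopology) :
    ∫⁻ ω, ENNReal.ofReal (N.rate p τ .ul ω) ∂(N.testMeasure p P .ul) =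
      ∫⁻ g in Ioi (0 : ℝ), ENNReal.ofReal (p.ulIntegrand g) := by
  have : IsProbabilityMeasure (N.testMeasure p P .ul) := ‹IsProbabilityMeasure P›
  have hB := p.bw_pos .ul
  have hlog : 0 < Real.log 2 := Real.log_pos one_lt_two
  refine (lintegral_logb_one_add _ (hN.measurable_SINR τ .ul)
    (fun ω => ENNReal.toReal_nonneg) hB.le).trans ?_
  refine setLIntegral_congr_fun measurableSet_Ioi fun g hg => ?_
  have hg' : 0 < g := hg
  rw [hN.measure_lt_ul_SINR τ hg, ← ENNReal.ofReal_mul' (by positivity)]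
  congr 1
  unfold Params.ulIntegrand
  ring

theorem IsModel.dl_rate_formula (hN : N.IsModel p P) (τ : NodeTopology) :
    Integrable (N.rate p τ .dl) (N.testMeasure p P .dl) ∧
      IntegrableOn (fun q : ℝ × ℝ => p.dlIntegrand τ q.1 q.2) (Ioi 0 ×ˢ Ioc 0 p.RM) ∧
      N.ergodicRate p P τ .dl =
        ∫ g in Ioi (0 : ℝ), ∫ r in (0 : ℝ)..p.RM, p.dlIntegrand τ g r := by
  have hm := p.measurable_dlIntegrand τ
  have hvol : (volume : Measure (ℝ × ℝ)).restrict (Ioi 0 ×ˢ Ioc 0 p.RM) =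
      (volume.restrict (Ioi 0)).prod (volume.restrict (Ioc 0 p.RM)) := by
    rw [Measure.prod_restrict, ← Measure.volume_eq_prod]
  have hprod : ∫⁻ q in Ioi 0 ×ˢ Ioc 0 p.RM, ENNReal.ofReal (p.dlIntegrand τ q.1 q.2) =
      ∫⁻ g in Ioi (0 : ℝ), ∫⁻ r in Ioc 0 p.RM, ENNReal.ofReal (p.dlIntegrand τ g r) := by
    rw [hvol, lintegral_prod _ hm.ennreal_ofReal.aemeasurable]
  obtain ⟨h1, h2, h3⟩ := integrable_and_integral_eq (hN.measurable_rate τ .dl)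
    (ae_of_all _ (rate_nonneg τ .dl)) hm
    ((ae_restrict_iff' (measurableSet_Ioi.prod measurableSet_Ioc)).2 (ae_of_all volume
      fun q hq => p.dlIntegrand_nonneg τ (le_of_lt hq.1) hq.2.1.le))
    ((hN.lintegral_dl_rate τ).trans hprod.symm) (hprod ▸ hN.lintegral_dlIntegrand_ne_top τ)
  refine ⟨h1, h2, h3.trans ?_⟩
  simp_rw [intervalIntegral.integral_of_le p.RM_pos.le]
  rw [Measure.volume_eq_prod] at h2 ⊢
  exact setIntegral_prod _ h2

theorem IsModel.ul_rate_formula (hN : N.IsModel p P) (τ : NodeTopology) :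
    Integrable (N.rate p τ .ul) (N.testMeasure p P .ul) ∧
      IntegrableOn p.ulIntegrand (Ioi 0) ∧
      N.ergodicRate p P τ .ul = ∫ g in Ioi (0 : ℝ), p.ulIntegrand g :=
  integrable_and_integral_eq (hN.measurable_rate τ .ul) (ae_of_all _ (rate_nonneg τ .ul))
    p.measurable_ulIntegrand
    ((ae_restrict_iff' measurableSet_Ioi).2 (ae_of_all volume
      fun _ hg => p.ulIntegrand_nonneg (le_of_lt hg)))
    (hN.lintegral_ul_rate τ) hN.lintegral_ulIntegrand_ne_top

end Network

end AlphaDuplex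

end

theorem theorem2 {Ω : Type*} [MeasurableSpace Ω] (P : MeasureTheory.Measure Ω)
    [MeasureTheory.IsProbabilityMeasure P]
    (p : AlphaDuplex.Params) (N : AlphaDuplex.Network Ω) (hN : N.IsModel p P)
    (τ : AlphaDuplex.NodeTopology) :
    -- downlink
    (MeasureTheory.Integrable (N.rate p τ .dl) (N.testMeasure p P .dl) ∧
      MeasureTheory.IntegrableOn (fun q : ℝ × ℝ => p.dlIntegrand τ q.1 q.2)
        (Set.Ioi 0 ×ˢ Set.Ioc 0 p.RM) ∧
      N.ergodicRate p P τ .dl =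
        ∫ g in Set.Ioi (0 : ℝ), ∫ r in (0 : ℝ)..p.RM, p.dlIntegrand τ g r) ∧
    -- uplink
    (MeasureTheory.Integrable (N.rate p τ .ul) (N.testMeasure p P .ul) ∧
      MeasureTheory.IntegrableOn p.ulIntegrand (Set.Ioi 0) ∧
      N.ergodicRate p P τ .ul = ∫ g in Set.Ioi (0 : ℝ), p.ulIntegrand g) :=
  ⟨hN.dl_rate_formula τ, hN.ul_rate_formula τ⟩
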